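/- **Conventions.** For a Riemannian manifold $(M,g)$ (smooth, Hausdorff, finite-dimensional) and an affine connection $\nabla$, put $R(X,Y)Z=\nabla_X\nabla_YZ-\nabla_Y\nabla_XZ-\nabla_{[X,Y]}Z$ and $T(X,Y)=\nabla_XY-\nabla_YX-[X,Y]$. For $X,Y\in T_xM$ let $X\wedge Y\in\mathfrak{so}(T_xM)$ be $Z\mapsto g(X,Z)Y-g(Y,Z)X$. For an endomorphism $B$ of $T_xM$ let $B_*$ be its extension to tensors as a derivation. For a metric connection with curvature $R$, the curvature endomorphism on tensors is $$q(R)=\sum_{i<j}(e_i\wedge e_j)_*\,R(e_i,e_j)_*,$$ where $(e_i)$ is an orthonormal basis of $T_xM$. **Lemma.** Let $(M,g)$ be a Riemannian manifold with Levi-Civita connection $\nabla$, and let $\bar\nabla$ be a (smooth) metric connection whose torsion $\bar T$ is totally skew-symmetric and satisfies $\bar\nabla\bar T=0$. Then $\bar\nabla_XY=\nabla_XY+\tfrac12\bar T(X,Y)$. Write $\bar T_X=\bar T(X,\cdot)$ and let $R$, $\bar R$ be the curvature tensors of $\nabla$, $\bar\nabla$. Then for every $x\in M$, every orthonormal basis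 $(e_i)$ of $T_xM$ and every $p\ge 0$, $$q(R)-q(\bar R)=-\frac14\sum_i(\bar T_{e_i})_*^2\qquad\text{on }\operatorname{Sym}^pT_x^*M\text{ and on }\operatorname{Sym}^pT_xM.$$ **Corollary.** Let $G$ be a (finite-dimensional real) Lie group with Lie algebra $\mathfrak g$, $H\subset G$ a closed subgroup with Lie algebra $\mathfrak h$, $Q$ an $\operatorname{Ad}(G)$-invariant inner product on $\mathfrak g$ and $\mathfrak m=\mathfrak h^{\perp_Q}$. Let $g$ be the normal metric on $M=G/H$, i.e. the $G$-invariant Riemannian metric that equals $Q|_{\mathfrak m}$ at the base point under $\mathfrak m\cong T_{eH}M$. Let $R$ be its Riemannian curvature tensor, and let $\bar R$ be the curvature tensor of the canonical reductive connection $\bar\nabla$, the connection on $TM$ induced by the principal connection $\operatorname{pr}_{\mathfrak h}\circ\theta$ on $G\to G/H$, where $\theta$ is the Maurer–Cartan form. Let $\mathcal A$ be the $G$-invariant tensor with $\mathcal A_XY=[X,Y]_{\mathfrak m}$ for $X,Y\in\mathfrak m$. On tensors, let $\mathcal A$ also denote the map $v\mapsto\sum_ie_i^\flat\otimes(\mathcal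 A_{e_i})_*v$ with values in $T^*M\otimes(\text{tensors})$, and let $\mathcal A^*$ be its metric adjoint. Then, at every point of $M$ and for every $p\ge 0$, $$q(R)-q(\bar R)=\frac14\,\mathcal A^*\mathcal A\qquad\text{on }\operatorname{Sym}^pT^*M\text{ and on }\operatorname{Sym}^pTM.$$ -/

import Mathlib

open Bundle Manifold
open scoped ContDiff

set_option linter.unusedSectionVars false

noncomputable section

namespace SkewTorsion

/-! ### Tensors on a vector space -/

section Tensors

/-- The extension of an endomorphism `B` of `W` to `p`-linear forms on `W`:
`(leibnizExt p B h)(v₁, …, vₚ) = ∑ₖ h(v₁, …, B vₖ, …, vₚ)`. -/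
def leibnizExt {W : Type*} [AddCommGroup W] [Module ℝ W] (p : ℕ) (B : Module.End ℝ W) :
    Module.End ℝ (MultilinearMap ℝ (fun _ : Fin p => W) ℝ) :=
  ∑ k : Fin p, MultilinearMap.compLinearMapₗ (Function.update (fun _ => LinearMap.id) k B)

theorem leibnizExt_apply {W : Type*} [AddCommGroup W] [Module ℝ W] (p : ℕ)
    (B : Module.End ℝ W) (h : MultilinearMap ℝ (fun _ : Fin p => W) ℝ) (v : Fin p → W) :
    leibnizExt p B h v = ∑ k : Fin p, h (Function.update v k (B (v k))) := by
  simp only [leibnizExt, LinearMap.sum_apply, _root_.sum_apply,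
    MultilinearMap.compLinearMapₗ_apply, MultilinearMap.compLinearMap_apply]
  refine Finset.sum_congr rfl fun k _ => congrArg h ?_
  funext i
  by_cases hi : i = k
  · subst hi; simp
  · simp [hi]

/-- Covariant tensors of rank `p` on `T`, i.e. elements of `(T*)^{⊗ p}`. -/
abbrev CovTensor (p : ℕ) (T : Type*) [AddCommGroup T] [Module ℝ T] : Type _ :=
  MultilinearMap ℝ (fun _ : Fin p => T) ℝ

/-- Contravariant tensors of rank `p` on the (finite-dimensional) space `T`, i.e. elements of
`T^{⊗ p}`, regarded as `p`-linear forms on the dual space. -/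
abbrev ContraTensor (p : ℕ) (T : Type*) [AddCommGroup T] [Module ℝ T] : Type _ :=
  MultilinearMap ℝ (fun _ : Fin p => Module.Dual ℝ T) ℝ

/-- A tensor is symmetric if it is invariant under all permutations of its arguments. -/
def IsSymmetricTensor {W : Type*} [AddCommGroup W] [Module ℝ W] {p : ℕ}
    (h : MultilinearMap ℝ (fun _ : Fin p => W) ℝ) : Prop :=
  ∀ (σ : Equiv.Perm (Fin p)) (v : Fin p → W), h (v ∘ σ) = h v

variable {T : Type*} [AddCommGroup T] [Module ℝ T]

/-- The action `B_*` of an endomorphism `B` of `T` as a derivation on covariant tensors: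
`(B_* h)(v₁, …, vₚ) = -∑ₖ h(v₁, …, B vₖ, …, vₚ)`. -/
def covAct (p : ℕ) (B : Module.End ℝ T) : Module.End ℝ (CovTensor p T) :=
  leibnizExt p (-B)

/-- The action `B_*` of an endomorphism `B` of `T` as a derivation on contravariant tensors,
`B_* (X₁ ⊗ ⋯ ⊗ Xₚ) = ∑ₖ X₁ ⊗ ⋯ ⊗ B Xₖ ⊗ ⋯ ⊗ Xₚ`; on forms on the dual space this reads
`(B_* t)(α₁, …, αₚ) = ∑ₖ t(α₁, …, αₖ ∘ B, …, αₚ)`. -/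
def contraAct (p : ℕ) (B : Module.End ℝ T) : Module.End ℝ (ContraTensor p T) :=
  leibnizExt p (LinearMap.dualMap B)

/-- The endomorphism `X ∧ Y : Z ↦ g(X, Z) Y - g(Y, Z) X`. -/
def wedge (g : T →ₗ[ℝ] T →ₗ[ℝ] ℝ) (X Y : T) : Module.End ℝ T :=
  (g X).smulRight Y - (g Y).smulRight X

variable {V : Type*} [AddCommGroup V] [Module ℝ V] {n : ℕ}

/-- The curvature endomorphism `q(R) = ∑_{i < j} (e_i ∧ e_j)_* R(e_i, e_j)_*` on a space `V` of
tensors on which endomorphisms `B` of `T` act by `B_* = ρ B`; here `e` is an orthonormal basis. -/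
def curvatureEndomorphism (ρ : Module.End ℝ T → Module.End ℝ V) (g : T →ₗ[ℝ] T →ₗ[ℝ] ℝ)
    (e : Module.Basis (Fin n) ℝ T) (R : T →ₗ[ℝ] T →ₗ[ℝ] Module.End ℝ T) : Module.End ℝ V :=
  ∑ i : Fin n, ∑ j ∈ Finset.Ioi i, ρ (wedge g (e i) (e j)) ∘ₗ ρ (R (e i) (e j))

/-- The operator `∑_i (B_{e_i})_*²`. -/
def sumSquares (ρ : Module.End ℝ T → Module.End ℝ V) (e : Module.Basis (Fin n) ℝ T)
    (B : T →ₗ[ℝ] Module.End ℝ T) : Module.End ℝ V :=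
  ∑ i : Fin n, ρ (B (e i)) ∘ₗ ρ (B (e i))

/-- The map `V → T* ⊗ V = Hom(T, V)`, `v ↦ ∑_i e_i^♭ ⊗ (A_{e_i})_* v`. -/
def tensorMap (ρ : Module.End ℝ T → Module.End ℝ V) (e : Module.Basis (Fin n) ℝ T)
    (A : T →ₗ[ℝ] Module.End ℝ T) : V →ₗ[ℝ] (T →ₗ[ℝ] V) :=
  ∑ i : Fin n, LinearMap.smulRightₗ (e.coord i) ∘ₗ ρ (A (e i))

/-- The inner product on `p`-linear forms on `W` for which the basis `w` of `W` is orthonormal. -/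
def tensorInner {W : Type*} [AddCommGroup W] [Module ℝ W] {p : ℕ} (w : Fin n → W)
    (h k : MultilinearMap ℝ (fun _ : Fin p => W) ℝ) : ℝ :=
  ∑ f : Fin p → Fin n, h (fun i => w (f i)) * k (fun i => w (f i))

/-- The map `S : T* ⊗ V → V` is the metric adjoint of `A : V → T* ⊗ V`, where `V` carries the inner
product `ip` and `T* ⊗ V = Hom(T, V)` the induced one, `⟨F, F'⟩ = ∑_i ⟨F e_i, F' e_i⟩`. -/
def IsMetricAdjoint (ip : V → V → ℝ) (e : Module.Basis (Fin n) ℝ T)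
    (A : V →ₗ[ℝ] (T →ₗ[ℝ] V)) (S : (T →ₗ[ℝ] V) →ₗ[ℝ] V) : Prop :=
  ∀ (F : T →ₗ[ℝ] V) (v : V), ip (S F) v = ∑ i : Fin n, ip (F (e i)) (A v (e i))

end Tensors

/-! ### Affine connections on a Riemannian manifold -/

section Connections

/-- An affine connection on `M` is a covariant derivative on the tangent bundle;
`cov Y x (X x)` is `(∇_X Y)(x)`. -/
abbrev AffineConnection (E : Type*) [NormedAddCommGroup E] [NormedSpace ℝ E]
    (M : Type*) [TopologicalSpace M] [ChartedSpace E M] [IsManifold 𝓘(ℝ, E) ∞ M] : Type _ :=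
  CovariantDerivative 𝓘(ℝ, E) E (TangentSpace 𝓘(ℝ, E) : M → Type _)

/-- A smooth Riemannian metric on `M`. -/
abbrev RMetric (E : Type*) [NormedAddCommGroup E] [NormedSpace ℝ E]
    (M : Type*) [TopologicalSpace M] [ChartedSpace E M] [IsManifold 𝓘(ℝ, E) ∞ M] : Type _ :=
  ContMDiffRiemannianMetric 𝓘(ℝ, E) ∞ E (TangentSpace 𝓘(ℝ, E) : M → Type _)

variable {E : Type*} [NormedAddCommGroup E] [NormedSpace ℝ E] [FiniteDimensional ℝ E]
  {M : Type*} [TopologicalSpace M] [ChartedSpace E M] [IsManifold 𝓘(ℝ, E) ∞ M]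

/-- The metric at the point `x` as a bilinear form. -/
def metricAt (g : RMetric E M) (x : M) :
    TangentSpace 𝓘(ℝ, E) x →ₗ[ℝ] TangentSpace 𝓘(ℝ, E) x →ₗ[ℝ] ℝ :=
  (ContinuousLinearMap.coeLM ℝ) ∘ₗ (g.inner x).toLinearMap

/-- `e` is an orthonormal basis of `T_x M`. -/
def IsOrthonormalBasis (g : RMetric E M) {x : M} {n : ℕ}
    (e : Module.Basis (Fin n) ℝ (TangentSpace 𝓘(ℝ, E) x)) : Prop :=
  ∀ i j, g.inner x (e i) (e j) = if i = j then 1 else 0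

/-- `∇_X ∇_Y Z - ∇_Y ∇_X Z - ∇_{[X, Y]} Z` for vector fields `X`, `Y`, `Z`. -/
def curvatureOfFields (cov : AffineConnection E M) (X Y Z : Π x : M, TangentSpace 𝓘(ℝ, E) x)
    (x : M) : TangentSpace 𝓘(ℝ, E) x :=
  cov (fun y => cov Z y (Y y)) x (X x) - cov (fun y => cov Z y (X y)) x (Y x)
    - cov Z x (VectorField.mlieBracket 𝓘(ℝ, E) X Y x)

/-- The curvature tensor `R(X, Y) Z = ∇_X ∇_Y Z - ∇_Y ∇_X Z - ∇_{[X, Y]} Z` at `x`. This expression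
is tensorial in `X`, `Y`, `Z`, so it is computed on a local frame which is smooth near `x` and
extended trilinearly from its values on the resulting basis of `T_x M`. -/
def curvature (cov : AffineConnection E M) (x : M) :
    TangentSpace 𝓘(ℝ, E) x →ₗ[ℝ] TangentSpace 𝓘(ℝ, E) x →ₗ[ℝ]
      Module.End ℝ (TangentSpace 𝓘(ℝ, E) x) :=
  letI e := trivializationAt E (TangentSpace 𝓘(ℝ, E) : M → Type _) x
  letI s := e.localFrame (Module.finBasis ℝ E)
  letI b := e.basisAt (Module.finBasis ℝ E) (FiberBundle.mem_baseSet_trivializationAt' x)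
  b.constr ℝ fun i => b.constr ℝ fun j => b.constr ℝ fun k =>
    curvatureOfFields cov (s i) (s j) (s k) x

/-- The torsion `T` as a map `X ↦ T_X = T(X, ·)`. -/
def torsionAt (cov : AffineConnection E M) (x : M) :
    TangentSpace 𝓘(ℝ, E) x →ₗ[ℝ] Module.End ℝ (TangentSpace 𝓘(ℝ, E) x) :=
  (ContinuousLinearMap.coeLM ℝ) ∘ₗ (cov.torsion x).toLinearMap

/-- `X g(Y, Z) = g(∇_X Y, Z) + g(Y, ∇_X Z)`. -/
def IsMetricConnection (g : RMetric E M) (cov : AffineConnection E M) : Prop :=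
  ∀ (x : M) (v : TangentSpace 𝓘(ℝ, E) x) (Y Z : Π x : M, TangentSpace 𝓘(ℝ, E) x),
    MDiffAt (T% Y) x → MDiffAt (T% Z) x →
      (d% (fun y => g.inner y (Y y) (Z y)) x) v =
        g.inner x (cov Y x v) (Z x) + g.inner x (Y x) (cov Z x v)

/-- `g(T(X, Y), Z)` is skew-symmetric in all arguments (it is so in `X`, `Y` for any torsion). -/
def HasSkewTorsion (g : RMetric E M) (cov : AffineConnection E M) : Prop :=
  ∀ (x : M) (X Y Z : TangentSpace 𝓘(ℝ, E) x),
    g.inner x (cov.torsion x X Y) Z = -g.inner x (cov.torsion x X Z) Y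

/-- `∇ T = 0`, i.e. `∇_X (T(Y, Z)) = T(∇_X Y, Z) + T(Y, ∇_X Z)`. -/
def HasParallelTorsion (cov : AffineConnection E M) : Prop :=
  ∀ (x : M) (v : TangentSpace 𝓘(ℝ, E) x) (Y Z : Π x : M, TangentSpace 𝓘(ℝ, E) x),
    MDiffAt (T% Y) x → MDiffAt (T% Z) x →
      cov (fun y => cov.torsion y (Y y) (Z y)) x v =
        cov.torsion x (cov Y x v) (Z x) + cov.torsion x (Y x) (cov Z x v)

/-- The Levi-Civita connection: the smooth, metric and torsion-free connection. -/
structure IsLeviCivita (g : RMetric E M) (cov : AffineConnection E M) : Prop where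
  smooth : cov.ContMDiffCovariantDerivative ∞
  metric : IsMetricConnection g cov
  torsion_free : cov.torsion = 0

/-- A smooth metric connection with parallel and totally skew-symmetric torsion. -/
structure IsMetricWithParallelSkewTorsion (g : RMetric E M) (cov : AffineConnection E M) :
    Prop where
  smooth : cov.ContMDiffCovariantDerivative ∞
  metric : IsMetricConnection g cov
  skew : HasSkewTorsion g cov
  parallel : HasParallelTorsion cov

end Connections

/-! ### Normal homogeneous spaces -/

section Homogeneous

variable {EG : Type*} [NormedAddCommGroup EG] [NormedSpace ℝ EG]
  {G : Type*} [TopologicalSpace G] [ChartedSpace EG G] [Group G]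
  {E : Type*} [NormedAddCommGroup E] [NormedSpace ℝ E]
  {H : Subgroup G} [ChartedSpace E (G ⧸ H)]

variable (EG G) in
/-- An `Ad(G)`-invariant inner product on the Lie algebra of `G`. -/
structure AdInvariantInnerProduct where
  /-- The inner product. -/
  form : LinearMap.BilinForm ℝ (GroupLieAlgebra 𝓘(ℝ, EG) G)
  symm : ∀ X Y, form X Y = form Y X
  pos : ∀ X, X ≠ 0 → 0 < form X X
  ad_invariant : ∀ (a : G) (X Y : GroupLieAlgebra 𝓘(ℝ, EG) G),
    letI Ad : GroupLieAlgebra 𝓘(ℝ, EG) G →L[ℝ] GroupLieAlgebra 𝓘(ℝ, EG) G :=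
      mfderiv 𝓘(ℝ, EG) 𝓘(ℝ, EG) (fun b : G => a * b * a⁻¹) 1
    form (Ad X) (Ad Y) = form X Y

/-- The differential at the identity of left translation by `a`. -/
def leftTranslate (a : G) : GroupLieAlgebra 𝓘(ℝ, EG) G →L[ℝ] TangentSpace 𝓘(ℝ, EG) a :=
  mfderiv 𝓘(ℝ, EG) 𝓘(ℝ, EG) (fun b : G => a * b) 1

variable (EG E H) in
/-- The differential at `a` of the projection `G → G ⧸ H`. -/
def projDeriv (a : G) :
    TangentSpace 𝓘(ℝ, EG) a →L[ℝ] TangentSpace 𝓘(ℝ, E) (a : G ⧸ H) :=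
  mfderiv 𝓘(ℝ, EG) 𝓘(ℝ, E) (fun b : G => (b : G ⧸ H)) a

variable (EG E H) in
/-- The linear map `𝔤 → T_{aH} (G ⧸ H)`, `X ↦ dπ(dL_a X)`. -/
def lieToTangent (a : G) :
    GroupLieAlgebra 𝓘(ℝ, EG) G →L[ℝ] TangentSpace 𝓘(ℝ, E) (a : G ⧸ H) :=
  (projDeriv EG E H a).comp (leftTranslate a)

variable (EG E H) in
/-- The Lie algebra `𝔥` of `H`, i.e. the kernel of the differential at `1` of the submersion
`G → G ⧸ H`. -/
def isotropyAlgebra : Submodule ℝ (GroupLieAlgebra 𝓘(ℝ, EG) G) :=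
  LinearMap.ker (projDeriv EG E H (1 : G)).toLinearMap

variable (E H) in
/-- The orthogonal complement `𝔪` of `𝔥` in `𝔤`. -/
def reductiveComplement (Q : AdInvariantInnerProduct EG G) :
    Submodule ℝ (GroupLieAlgebra 𝓘(ℝ, EG) G) :=
  Q.form.orthogonal (isotropyAlgebra EG E H)

variable (E H) in
/-- The isomorphism `𝔪 ≅ T_{aH} (G ⧸ H)`, `X ↦ dπ(dL_a X)`. The space `dL_a 𝔪` is the horizontal
space at `a` of the principal connection `pr_𝔥 ∘ θ` on `G → G ⧸ H`, so the horizontal lift to `a` of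
the image of `X` is `dL_a X`. -/
def horizontalFrame (Q : AdInvariantInnerProduct EG G) (a : G) :
    reductiveComplement E H Q →L[ℝ] TangentSpace 𝓘(ℝ, E) (a : G ⧸ H) :=
  (lieToTangent EG E H a).comp (reductiveComplement E H Q).subtypeL

/-- A vector field `Y` on `G ⧸ H` corresponds to an `H`-equivariant function `Ŷ : G → 𝔪`, namely
`Y(aH) = dπ(dL_a Ŷ(a))`. This is `Ŷ`, regarded as a function into `𝔤`. -/
def horizontalCoord (Q : AdInvariantInnerProduct EG G)
    (Y : Π x : G ⧸ H, TangentSpace 𝓘(ℝ, E) x) (a : G) : EG :=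
  ((horizontalFrame E H Q a).inverse (Y a)).1

/-- The covariant derivative of `Y` at `aH` induced by the principal connection `pr_𝔥 ∘ θ`: the
function corresponding to `∇_X Y` is the derivative of `Ŷ` along the horizontal lift of `X`. -/
def reductiveDeriv (Q : AdInvariantInnerProduct EG G)
    (Y : Π x : G ⧸ H, TangentSpace 𝓘(ℝ, E) x) (a : G) :
    TangentSpace 𝓘(ℝ, E) (a : G ⧸ H) →L[ℝ] TangentSpace 𝓘(ℝ, E) (a : G ⧸ H) :=
  (lieToTangent EG E H a).comp <| (mvfderiv 𝓘(ℝ, EG) (horizontalCoord Q Y) a).comp <|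
    (leftTranslate a).comp <|
      (reductiveComplement E H Q).subtypeL.comp (horizontalFrame E H Q a).inverse

variable [FiniteDimensional ℝ EG] [LieGroup 𝓘(ℝ, EG) ∞ G] [FiniteDimensional ℝ E]
 [IsManifold 𝓘(ℝ, E) ∞ (G ⧸ H)]
  [ContMDiffSMul 𝓘(ℝ, EG) 𝓘(ℝ, E) ∞ G (G ⧸ H)]

theorem contMDiff_proj : ContMDiff 𝓘(ℝ, EG) 𝓘(ℝ, E) ∞ (fun b : G => (b : G ⧸ H)) := by
  have h : ContMDiff 𝓘(ℝ, EG) 𝓘(ℝ, E) ∞ (fun b : G => b • ((1 : G) : G ⧸ H)) :=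
    (contMDiff_smul (I := 𝓘(ℝ, EG)) (I' := 𝓘(ℝ, E)) (n := ∞) (G := G) (M := G ⧸ H)).comp
      (contMDiff_id.prodMk contMDiff_const)
  convert h using 2 with b
  change _ = ((b * 1 : G) : G ⧸ H)
  rw [mul_one]

theorem lieToTangent_eq (a : G) (X : GroupLieAlgebra 𝓘(ℝ, EG) G) :
    lieToTangent EG E H a X =
      mfderiv 𝓘(ℝ, E) 𝓘(ℝ, E) (fun x : G ⧸ H => a • x) ((1 : G) : G ⧸ H)
        (projDeriv EG E H 1 X) := by
  have h1 : (fun b : G => (b : G ⧸ H)) ∘ (fun b : G => a * b) =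
    (fun x : G ⧸ H => a • x) ∘ (fun b : G => (b : G ⧸ H)) := rfl
  have hp := (contMDiff_proj (EG := EG) (E := E) (H := H)).mdifferentiable (by simp)
  have ha : MDifferentiable 𝓘(ℝ, E) 𝓘(ℝ, E) (fun x : G ⧸ H => a • x) :=
    (ContMDiffSMul.contMDiff_const_smul (I := 𝓘(ℝ, EG)) (I' := 𝓘(ℝ, E)) (n := ∞)
      (M := G ⧸ H) a).mdifferentiable (by simp)
  have hm : MDifferentiable 𝓘(ℝ, EG) 𝓘(ℝ, EG) (fun b : G => a * b) :=
    (contMDiff_mul_left (n := ∞)).mdifferentiable (by simp)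
  have e1 := mfderiv_comp (1 : G) (hp (a * 1)) (hm 1)
  have e2 := mfderiv_comp (1 : G) (ha ((1:G) : G ⧸ H)) (hp 1)
  rw [h1, e2] at e1
  have := DFunLike.congr_fun e1 X
  simp only [lieToTangent, projDeriv, leftTranslate, ContinuousLinearMap.comp_apply] at this ⊢
  have key : ∀ c : G, c = a → (mfderiv 𝓘(ℝ, EG) 𝓘(ℝ, E) (fun b : G => (b : G ⧸ H)) c : EG → E) =
     (mfderiv 𝓘(ℝ, EG) 𝓘(ℝ, E) (fun b : G => (b : G ⧸ H)) a : EG → E) := by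
    rintro c rfl; rfl
  have k2 := congrFun (key (a * 1) (mul_one a))
  exact (k2 _).symm.trans this.symm


theorem isCompl_reductiveComplement (Q : AdInvariantInnerProduct EG G) :
    IsCompl (reductiveComplement E H Q) (isotropyAlgebra EG E H) := by
  have : FiniteDimensional ℝ (GroupLieAlgebra 𝓘(ℝ, EG) G) := inferInstanceAs (FiniteDimensional ℝ EG)
  refine IsCompl.symm ?_
  rw [reductiveComplement, LinearMap.BilinForm.isCompl_orthogonal_iff_disjoint]
  · rw [Submodule.disjoint_def]
    intro x hx hx'
    by_contra h
    exact (Q.pos x h).ne' (hx' x hx)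
  · intro x y h
    rw [Q.symm]; exact h


theorem smulDeriv_bijective (EG : Type*) [NormedAddCommGroup EG] [NormedSpace ℝ EG]
    {G : Type*} [TopologicalSpace G] [ChartedSpace EG G] [Group G]
    {E : Type*} [NormedAddCommGroup E] [NormedSpace ℝ E]
    {H : Subgroup G} [ChartedSpace E (G ⧸ H)]
    [ContMDiffSMul 𝓘(ℝ, EG) 𝓘(ℝ, E) ∞ G (G ⧸ H)] (a : G) (x : G ⧸ H) :
    Function.Bijective (mfderiv 𝓘(ℝ, E) 𝓘(ℝ, E) (fun y : G ⧸ H => a • y) x) := by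
  have h := (Diffeomorph.smul 𝓘(ℝ, EG) 𝓘(ℝ, E) ∞ (M := G ⧸ H) a).mfderivToContinuousLinearEquiv_coe
    (x := x) (by simp)
  have h2 : (mfderiv 𝓘(ℝ, E) 𝓘(ℝ, E) (fun y : G ⧸ H => a • y) x) =
    mfderiv 𝓘(ℝ, E) 𝓘(ℝ, E) (Diffeomorph.smul 𝓘(ℝ, EG) 𝓘(ℝ, E) ∞ (M := G ⧸ H) a) x := rfl
  rw [h2, ← h]
  exact ContinuousLinearEquiv.bijective _

theorem horizontalFrame_isInvertible (Q : AdInvariantInnerProduct EG G)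
    (hπ : Function.Surjective (projDeriv EG E H (1 : G))) (a : G) :
    (horizontalFrame E H Q a).IsInvertible := by
  have hc := isCompl_reductiveComplement (E := E) (H := H) Q
  have hb := smulDeriv_bijective EG (E := E) (H := H) a ((1 : G) : G ⧸ H)
  have hbij : Function.Bijective (horizontalFrame E H Q a) := by
    constructor
    · rw [injective_iff_map_eq_zero]
      intro X hX
      have h1 : lieToTangent EG E H a X = 0 := hX
      rw [lieToTangent_eq] at h1
      have h2 : projDeriv EG E H 1 X.1 = 0 := hb.1 (h1.trans (map_zero _).symm)
      exact Subtype.ext (Submodule.disjoint_def.1 hc.disjoint X.1 X.2 h2)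
    · intro u
      obtain ⟨w, hw⟩ := hb.2 u
      obtain ⟨X, rfl⟩ := hπ w
      obtain ⟨m, hm, h, hh, rfl⟩ := Submodule.mem_sup.1 (hc.sup_eq_top ▸ Submodule.mem_top (x := X))
      refine ⟨⟨m, hm⟩, ?_⟩
      change lieToTangent EG E H a m = u
      rw [lieToTangent_eq, ← hw, map_add]
      have : projDeriv EG E H 1 h = 0 := hh
      rw [this, add_zero]
  have : FiniteDimensional ℝ (GroupLieAlgebra 𝓘(ℝ, EG) G) := inferInstanceAs (FiniteDimensional ℝ EG)
  have : T2Space (GroupLieAlgebra 𝓘(ℝ, EG) G) := inferInstanceAs (T2Space EG)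
  have : FiniteDimensional ℝ (TangentSpace 𝓘(ℝ, E) (a : G ⧸ H)) :=
    inferInstanceAs (FiniteDimensional ℝ E)
  have : T2Space (TangentSpace 𝓘(ℝ, E) (a : G ⧸ H)) := inferInstanceAs (T2Space E)
  exact ⟨(LinearEquiv.ofBijective (horizontalFrame E H Q a).toLinearMap hbij).toContinuousLinearEquiv,
    rfl⟩

theorem lieToTangent_contMDiff (X : GroupLieAlgebra 𝓘(ℝ, EG) G) :
    ContMDiff 𝓘(ℝ, EG) (𝓘(ℝ, E).prod 𝓘(ℝ, E)) 1 (fun a : G =>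
      (⟨(a : G ⧸ H), lieToTangent EG E H a X⟩ : TangentBundle 𝓘(ℝ, E) (G ⧸ H))) := by
  have : LieGroup 𝓘(ℝ, EG) (minSmoothness ℝ 3) G := LieGroup.of_le (n := ∞)
      (by rw [minSmoothness_of_isRCLikeNormedField]; exact ENat.LEInfty.out)
  have h1 : ContMDiff 𝓘(ℝ, EG) 𝓘(ℝ, EG).tangent 1
      (fun a : G => (mulInvariantVectorField X a : TangentBundle 𝓘(ℝ, EG) G)) :=
    (contMDiff_mulInvariantVectorField (I := 𝓘(ℝ, EG)) (G := G) X).of_le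
      (by rw [minSmoothness_of_isRCLikeNormedField]; exact one_le_two)
  have h2 : ContMDiff 𝓘(ℝ, EG).tangent 𝓘(ℝ, E).tangent 1
      (tangentMap 𝓘(ℝ, EG) 𝓘(ℝ, E) (fun b : G => (b : G ⧸ H))) :=
    (contMDiff_proj (EG := EG) (E := E) (H := H)).contMDiff_tangentMap
      (by rw [one_add_one_eq_two]; exact ENat.LEInfty.out)
  exact h2.comp h1

theorem horizontalCoord_mdifferentiableAt (Q : AdInvariantInnerProduct EG G)
    (hπ : Function.Surjective (projDeriv EG E H (1 : G)))
    {Y : Π x : G ⧸ H, TangentSpace 𝓘(ℝ, E) x} {a : G}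
    (hY : MDiffAt (T% Y) (a : G ⧸ H)) :
    MDifferentiableAt 𝓘(ℝ, EG) 𝓘(ℝ, EG) (horizontalCoord Q Y) a := by
  let e := trivializationAt E (TangentSpace 𝓘(ℝ, E) : G ⧸ H → Type _) (a : G ⧸ H)
  have hae : (a : G ⧸ H) ∈ e.baseSet := FiberBundle.mem_baseSet_trivializationAt' _
  have hp := (contMDiff_proj (EG := EG) (E := E) (H := H)).mdifferentiable (by simp)
  obtain ⟨K, hKm, hK⟩ : ∃ K : E →L[ℝ] EG, (∀ w, K w ∈ reductiveComplement E H Q) ∧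
      ∀ w, lieToTangent EG E H a (K w) = e.symmL ℝ (a : G ⧸ H) w := by
    obtain ⟨A, hA⟩ := horizontalFrame_isInvertible (E := E) (H := H) Q hπ a
    refine ⟨(reductiveComplement E H Q).subtypeL.comp
      ((A.symm : _ →L[ℝ] _).comp (e.symmL ℝ (a : G ⧸ H))), fun w => (A.symm _).2, fun w => ?_⟩
    change horizontalFrame E H Q a (A.symm (e.symmL ℝ (a : G ⧸ H) w)) = _
    rw [← hA]
    simp
  let N : G → E →L[ℝ] E := fun b => (e.continuousLinearMapAt ℝ (b : G ⧸ H)).comp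
    ((lieToTangent EG E H b).comp K)
  have hnear : ∀ᶠ b : G in nhds a, (b : G ⧸ H) ∈ e.baseSet :=
    hp.continuous.continuousAt.eventually (e.open_baseSet.mem_nhds hae)
  have hNa : N a = ContinuousLinearMap.id ℝ E := by
    ext w
    change e.continuousLinearMapAt ℝ (a : G ⧸ H) (lieToTangent EG E H a (K w)) = w
    rw [hK]
    exact e.continuousLinearMapAt_symmL hae w
  have hNw : ∀ w : E, ContMDiffAt 𝓘(ℝ, EG) 𝓘(ℝ, E) 1 (fun b => N b w) a := by
    intro w
    have h1 := (contMDiffAt_totalSpace.1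
      (lieToTangent_contMDiff (E := E) (H := H) (K w) a)).2
    refine h1.congr_of_eventuallyEq ?_
    filter_upwards [hnear] with b hb
    change e.continuousLinearMapAt ℝ (b : G ⧸ H) (lieToTangent EG E H b (K w)) = _
    rw [Bundle.Trivialization.continuousLinearMapAt_apply, e.linearMapAt_apply, if_pos hb]
  have hN : MDifferentiableAt 𝓘(ℝ, EG) 𝓘(ℝ, E →L[ℝ] E) N a := by
    let b := Module.finBasis ℝ E
    let L : (Fin (Module.finrank ℝ E) → E) →L[ℝ] (E →L[ℝ] E) := LinearMap.toContinuousLinearMap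
      (LinearMap.toContinuousLinearMap.toLinearMap ∘ₗ (b.constr ℝ).toLinearMap)
    have h1 : N = fun c => L (fun i => N c (b i)) := by
      funext c
      have : (N c : E →ₗ[ℝ] E) = b.constr ℝ (fun i => N c (b i)) :=
        b.ext fun i => by simp
      ext w
      exact DFunLike.congr_fun this w
    have h2 : ContMDiffAt 𝓘(ℝ, EG) 𝓘(ℝ, Fin (Module.finrank ℝ E) → E) 1
      (fun c i => N c (b i)) a := contMDiffAt_pi_space.2 fun i => hNw (b i)
    rw [h1]
    exact L.differentiableAt.comp_mdifferentiableAt (h2.mdifferentiableAt (by simp))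
  have hinv : MDifferentiableAt 𝓘(ℝ, EG) 𝓘(ℝ, E →L[ℝ] E) (fun b => (N b).inverse) a := by
    have : DifferentiableAt ℝ (ContinuousLinearMap.inverse : (E →L[ℝ] E) → _) (N a) := by
      rw [hNa]
      exact ((ContinuousLinearMap.isInvertible_equiv (f := ContinuousLinearEquiv.refl ℝ E)).contDiffAt_map_inverse (n := 1)).differentiableAt (by simp)
    exact this.comp_mdifferentiableAt hN
  have hYe : MDifferentiableAt 𝓘(ℝ, EG) 𝓘(ℝ, E)
      (fun b : G => (e ⟨(b : G ⧸ H), Y b⟩).2) a :=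
    ((mdifferentiableAt_section _ _).1 hY).comp a (hp a)
  have hmain : MDifferentiableAt 𝓘(ℝ, EG) 𝓘(ℝ, EG)
      (fun b : G => K ((N b).inverse (e ⟨(b : G ⧸ H), Y b⟩).2)) a :=
    K.differentiableAt.comp_mdifferentiableAt (hinv.clm_apply hYe)
  refine hmain.congr_of_eventuallyEq ?_
  have hNunit : ∀ᶠ b : G in nhds a, (N b).IsInvertible := by
    have h1 : Set.range ((↑) : (E ≃L[ℝ] E) → E →L[ℝ] E) ∈ nhds (N a) := by
      rw [hNa]
      exact ContinuousLinearEquiv.nhds (ContinuousLinearEquiv.refl ℝ E)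
    exact hN.continuousAt.eventually h1
  filter_upwards [hnear, hNunit] with b hb hNb
  obtain ⟨A, hA⟩ := horizontalFrame_isInvertible (E := E) (H := H) Q hπ b
  obtain ⟨B, hB⟩ := hNb
  change (((horizontalFrame E H Q b).inverse (Y b)).1 : EG) = _
  set w := (N b).inverse (e ⟨(b : G ⧸ H), Y b⟩).2 with hw
  have hNbw : N b w = (e ⟨(b : G ⧸ H), Y b⟩).2 := by
    rw [hw, ← hB]; simp
  have h1 : lieToTangent EG E H b (K w) = Y b := by
    have h2 : e.continuousLinearMapAt ℝ (b : G ⧸ H) (lieToTangent EG E H b (K w)) =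
      e.continuousLinearMapAt ℝ (b : G ⧸ H) (Y b) := by
      refine Eq.trans hNbw ?_
      rw [Bundle.Trivialization.continuousLinearMapAt_apply, e.linearMapAt_apply, if_pos hb]
    have h3 := congrArg (e.symmL ℝ (b : G ⧸ H)) h2
    rwa [e.symmL_continuousLinearMapAt hb, e.symmL_continuousLinearMapAt hb] at h3
  have h4 : horizontalFrame E H Q b ⟨K w, hKm w⟩ = Y b := h1
  rw [← h4, ← hA]
  simp only [ContinuousLinearMap.inverse_equiv]
  exact congrArg Subtype.val (A.symm_apply_apply ⟨K w, hKm w⟩)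

theorem lieToTangent_horizontalCoord (Q : AdInvariantInnerProduct EG G)
    (hπ : Function.Surjective (projDeriv EG E H (1 : G)))
    (Y : Π x : G ⧸ H, TangentSpace 𝓘(ℝ, E) x) (a : G) :
    lieToTangent EG E H a (horizontalCoord (EG := EG) Q Y a) = Y a := by
  obtain ⟨A, hA⟩ := horizontalFrame_isInvertible (E := E) (H := H) Q hπ a
  change horizontalFrame E H Q a ((horizontalFrame E H Q a).inverse (Y a)) = Y a
  rw [← hA]
  simp


theorem reductiveDeriv_add (Q : AdInvariantInnerProduct EG G)
    (hπ : Function.Surjective (projDeriv EG E H (1 : G)))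
    {Y Z : Π x : G ⧸ H, TangentSpace 𝓘(ℝ, E) x} {a : G}
    (hY : MDiffAt (T% Y) (a : G ⧸ H)) (hZ : MDiffAt (T% Z) (a : G ⧸ H)) :
    reductiveDeriv Q (Y + Z) a = reductiveDeriv Q Y a + reductiveDeriv Q Z a := by
  have h1 : horizontalCoord Q (Y + Z) = horizontalCoord Q Y + horizontalCoord Q Z := by
    funext b
    change ((horizontalFrame E H Q b).inverse (Y b + Z b)).1 = _
    rw [map_add]; rfl
  ext u
  unfold reductiveDeriv
  rw [h1, mvfderiv_add (horizontalCoord_mdifferentiableAt Q hπ hY)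
    (horizontalCoord_mdifferentiableAt Q hπ hZ)]
  exact map_add (lieToTangent EG E H a) _ _

theorem reductiveDeriv_leibniz (Q : AdInvariantInnerProduct EG G)
    (hπ : Function.Surjective (projDeriv EG E H (1 : G)))
    {Y : Π x : G ⧸ H, TangentSpace 𝓘(ℝ, E) x} {f : G ⧸ H → ℝ} {a : G}
    (hY : MDiffAt (T% Y) (a : G ⧸ H)) (hf : MDiffAt f (a : G ⧸ H)) :
    reductiveDeriv Q (f • Y) a = f a • reductiveDeriv Q Y a + (d% f (a : G ⧸ H)).smulRight (Y a) := by
  have hp := (contMDiff_proj (EG := EG) (E := E) (H := H)).mdifferentiable (by simp)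
  have h1 : horizontalCoord Q (f • Y) = (f ∘ fun b : G => (b : G ⧸ H)) • horizontalCoord Q Y := by
    funext b
    change ((horizontalFrame E H Q b).inverse (f b • Y b)).1 = _
    rw [map_smul]; rfl
  obtain ⟨A, hA⟩ := horizontalFrame_isInvertible (E := E) (H := H) Q hπ a
  ext u
  unfold reductiveDeriv
  rw [h1, mvfderiv_smul (hf.comp a (hp a)) (horizontalCoord_mdifferentiableAt Q hπ hY),
    mvfderiv_comp a hf (hp a)]
  set X := (horizontalFrame E H Q a).inverse u with hX
  have hXu : projDeriv EG E H a (leftTranslate a X.1) = u := by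
    change horizontalFrame E H Q a ((horizontalFrame E H Q a).inverse u) = u
    rw [← hA]
    simp
  change lieToTangent EG E H a
    ((f a • (mvfderiv 𝓘(ℝ, EG) (horizontalCoord Q Y) a (leftTranslate a X.1)) +
    (d% f (a : G ⧸ H)) (projDeriv EG E H a (leftTranslate a X.1)) • horizontalCoord Q Y a : EG)) = _
  rw [hXu]
  refine (map_add (lieToTangent EG E H a) _ _).trans ?_
  refine congrArg₂ (· + ·) (map_smul (lieToTangent EG E H a) _ _) ?_
  refine (map_smul (lieToTangent EG E H a) _ _).trans ?_
  rw [lieToTangent_horizontalCoord Q hπ]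
  rfl

/-- The canonical reductive connection of `G ⧸ H` with respect to `𝔤 = 𝔥 ⊕ 𝔪`. (Any representative
`a` of the coset `x` may be used, since `Ŷ` is equivariant.) -/
def reductiveConnection (Q : AdInvariantInnerProduct EG G)
    (hπ : Function.Surjective (projDeriv EG E H (1 : G))) : AffineConnection E (G ⧸ H) where
  toFun Y x := (Quotient.out_eq' x : ((x.out : G) : G ⧸ H) = x) ▸ reductiveDeriv Q Y x.out
  isCovariantDerivativeOnUniv :=
    { add := by
        intro Y Z x hY hZ _
        generalize_proofs h
        generalize x.out = a at h
        subst h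
        exact reductiveDeriv_add Q hπ hY hZ
      leibniz := by
        intro Y f x hY hf _
        generalize_proofs h
        generalize x.out = a at h
        subst h
        exact reductiveDeriv_leibniz Q hπ hY hf }

/-- The Lie bracket of `𝔤` as a bilinear map. -/
def lieBracketMap (EG : Type*) [NormedAddCommGroup EG] [NormedSpace ℝ EG] [FiniteDimensional ℝ EG]
    (G : Type*) [TopologicalSpace G] [ChartedSpace EG G] [Group G] [LieGroup 𝓘(ℝ, EG) ∞ G] :
    GroupLieAlgebra 𝓘(ℝ, EG) G →ₗ[ℝ] GroupLieAlgebra 𝓘(ℝ, EG) G →ₗ[ℝ]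
      GroupLieAlgebra 𝓘(ℝ, EG) G :=
  have : LieGroup 𝓘(ℝ, EG) (minSmoothness ℝ 3) G := LieGroup.of_le (n := ∞)
    (by rw [minSmoothness_of_isRCLikeNormedField]; exact ENat.LEInfty.out)
  LinearMap.mk₂ ℝ (fun X Y => ⁅X, Y⁆) add_lie smul_lie lie_add (fun c X Y => lie_smul c X Y)

/-- The tensor `𝒜_X Y = [X, Y]_𝔪` at the point `aH`, where `T_{aH} (G ⧸ H)` is identified with `𝔪`
by means of `X ↦ dπ(dL_a X)`. -/
def reductiveTensor (Q : AdInvariantInnerProduct EG G) (a : G) :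
    TangentSpace 𝓘(ℝ, E) (a : G ⧸ H) →ₗ[ℝ] Module.End ℝ (TangentSpace 𝓘(ℝ, E) (a : G ⧸ H)) :=
  letI incl : TangentSpace 𝓘(ℝ, E) (a : G ⧸ H) →ₗ[ℝ] GroupLieAlgebra 𝓘(ℝ, EG) G :=
    (reductiveComplement E H Q).subtype ∘ₗ (horizontalFrame E H Q a).inverse.toLinearMap
  letI pr : GroupLieAlgebra 𝓘(ℝ, EG) G →ₗ[ℝ] reductiveComplement E H Q :=
    Submodule.projectionOnto _ _ (isCompl_reductiveComplement Q)
  ((lieBracketMap EG G).compl₁₂ incl incl).compr₂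
    ((horizontalFrame E H Q a).toLinearMap ∘ₗ pr)

/-- The normal metric on `G ⧸ H` induced by `Q`: the `G`-invariant Riemannian metric which coincides
with the restriction of `Q` to `𝔪` at the base point. -/
structure IsNormalMetric (Q : AdInvariantInnerProduct EG G) (g : RMetric E (G ⧸ H)) : Prop where
  invariant : ∀ (a : G) (x : G ⧸ H) (u v : TangentSpace 𝓘(ℝ, E) x),
    g.inner (a • x) (mfderiv 𝓘(ℝ, E) 𝓘(ℝ, E) (fun y : G ⧸ H => a • y) x u)
      (mfderiv 𝓘(ℝ, E) 𝓘(ℝ, E) (fun y : G ⧸ H => a • y) x v) = g.inner x u v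
  base : ∀ X ∈ reductiveComplement E H Q, ∀ Y ∈ reductiveComplement E H Q,
    g.inner ((1 : G) : G ⧸ H) (projDeriv EG E H 1 X) (projDeriv EG E H 1 Y) = Q.form X Y

end Homogeneous

end SkewTorsion

end

open SkewTorsion

/-!
Let `∇̄` be a metric connection with parallel skew torsion `B = T̄`. Comparing `∇̄` with the
Levi-Civita connection in the manner of the Koszul formula gives `∇̄ = ∇ + ½ B`
(`eq_add_half_torsion`), and inserting this into the definition of the curvature, with `∇̄ B = 0`,
gives the difference tensor
`S(X, Y) = R(X, Y) - R̄(X, Y) = ¼ [B_X, B_Y] - ½ B_{B_X Y}` (`curvature_sub`).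

What remains is linear algebra in a single tangent space. Since `S` is skew-symmetric in its
arguments, `∑_{i < j} (e_i ∧ e_j)_* S(e_i, e_j)_*` can be split into the terms in which both
derivations act on the same slot of a tensor and those in which they act on different slots, and in
either case the wedge product collapses to a single sum over the basis (`sum_wedge`). On one slot
the result is `∑_j S(u, e_j) e_j = -¼ ∑_j B_j² u`. On two slots it is `∑_j e_j ⊗ S(u, e_j) v`, which
on a *symmetric* form equals `-¼ ∑_j B_j u ⊗ B_j v`: skew-symmetric endomorphisms such as `B_u` may
be moved from one factor to the other, which identifies the terms with `B_u B_v` and `B_v B_u`, and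
the term with `B_{B_u v}` cancels against itself. Together these say that `S` contributes
`-¼ ∑_i (B_{e_i})_*²` (`sum_wedge_skewCurvature`). Contravariant tensors are reduced to covariant
ones by lowering indices.

For a normal homogeneous space one checks that the canonical reductive connection belongs to this
class of connections. Its covariant derivative is the derivative of the function `Ŷ : G → 𝔪` along
horizontal directions. The fields `dL_b Ŷ(b)` on `G` are related to `Y` by the projection, so the
naturality of the Lie bracket (`mfderiv_mlieBracket_of_related`) and a formula for the bracket of
two such fields on `G` (`mlieBracket_leftField`) yield the torsion `T̄(X, Y) = -[X, Y]_𝔪 = -𝒜_X Y`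
(`torsion_reductiveConnection`). It is parallel since it is given by a constant bilinear map on `𝔪`,
and it is totally skew-symmetric since an `Ad(G)`-invariant inner product is `ad(𝔤)`-invariant. The
latter needs that the derivative of `Ad` is the bracket of `𝔤` (`mvfderiv_adInv`), which comes from
the fact that left-invariant and right-invariant vector fields commute
(`mlieBracket_rightField_leftField`). Finally each `𝒜_X` acts skew-symmetrically on tensors, so that
`𝒜* 𝒜 = -∑_i (𝒜_{e_i})_*²` (`exists_metricAdjoint`).

Tangent spaces at different points are all the model space, by definition. Derivatives at points
which are only propositionally equal, such as `b⁻¹ * 1 * b` and `1`, or the projections of `a` and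
`a * h` with `h ∈ H`, are therefore compared as maps between the model spaces.
-/

noncomputable section

namespace SkewTorsion

/-! ### Linear algebra of the curvature endomorphism -/

section Algebra

theorem eq_zero_of_eq_neg_self {V : Type*} [AddCommGroup V] [Module ℝ V] {x : V} (h : x = -x) :
    x = 0 := by
  have h2 : (2 : ℝ) • x = 0 := by
    rw [two_smul]
    nth_rewrite 1 [h]
    exact neg_add_cancel x
  exact (smul_eq_zero.1 h2).resolve_left two_ne_zero

/-- Summing over ordered pairs `i < j` a function of the form `a(i, j) + a(j, i)`, where `a`
vanishes on the diagonal, gives the sum of `a` over all pairs. -/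
theorem sum_Ioi_add_swap {n : ℕ} {A : Type*} [AddCommMonoid A] (a : Fin n → Fin n → A)
    (h0 : ∀ i, a i i = 0) :
    ∑ i, ∑ j ∈ Finset.Ioi i, (a i j + a j i) = ∑ i, ∑ j, a i j := by
  have h1 : ∀ i, ∑ j, a i j = ∑ j ∈ Finset.Ioi i, a i j + ∑ j ∈ Finset.Iio i, a i j := by
    intro i
    rw [← Finset.sum_union]
    · rw [← Finset.sum_subset (Finset.subset_univ _)]
      intro j _ hj
      have : j = i := by
        simp only [Finset.mem_union, Finset.mem_Ioi, Finset.mem_Iio, not_or, not_lt] at hj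
        exact le_antisymm hj.1 hj.2
      rw [this, h0]
    · rw [Finset.disjoint_left]
      intro j hj hj'
      simp only [Finset.mem_Ioi, Finset.mem_Iio] at hj hj'
      exact lt_asymm hj hj'
  have h2 : ∑ i, ∑ j ∈ Finset.Iio i, a i j = ∑ i, ∑ j ∈ Finset.Ioi i, a j i :=
    Finset.sum_comm' (by simp)
  simp only [Finset.sum_add_distrib, h1, h2]

variable {T : Type*} [AddCommGroup T] [Module ℝ T] {n : ℕ}

/-- `C` is skew-symmetric with respect to the bilinear form `g`. -/
def IsSkew (g : T →ₗ[ℝ] T →ₗ[ℝ] ℝ) (C : Module.End ℝ T) : Prop :=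
  ∀ Y Z, g (C Y) Z = -g (C Z) Y

/-- The algebraic difference `¼ [B_X, B_Y] - ½ B_{B_X Y}` between the curvature of the Levi-Civita
connection and that of a metric connection with parallel skew torsion `B`. -/
def skewCurvature (B : T →ₗ[ℝ] Module.End ℝ T) (X Y : T) : Module.End ℝ T :=
  (1 / 4 : ℝ) • (B X * B Y - B Y * B X) - (1 / 2 : ℝ) • B (B X Y)

variable {g : T →ₗ[ℝ] T →ₗ[ℝ] ℝ} {e : Module.Basis (Fin n) ℝ T}

theorem orthonormal_repr (he : ∀ i j, g (e i) (e j) = if i = j then 1 else 0) (u : T) (i : Fin n) :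
    e.repr u i = g (e i) u := by
  conv_rhs => rw [← e.sum_repr u]
  simp only [map_sum, map_smul, he, smul_eq_mul, mul_ite, mul_one, mul_zero, Finset.sum_ite_eq,
    Finset.mem_univ, if_true]

theorem orthonormal_expand (he : ∀ i j, g (e i) (e j) = if i = j then 1 else 0) (u : T) :
    u = ∑ i, g (e i) u • e i := by
  simp only [← orthonormal_repr he]
  exact (e.sum_repr u).symm

theorem orthonormal_symm (he : ∀ i j, g (e i) (e j) = if i = j then 1 else 0) (u v : T) :
    g u v = g v u := by
  have : g = g.flip := e.ext fun i => e.ext fun j => by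
    rw [LinearMap.flip_apply, he, he]; simp only [eq_comm]
  conv_lhs => rw [this]
  rfl

/-- Over an orthonormal basis, a skew-symmetric endomorphism can be moved from one argument of a
bilinear expression to the other, at the cost of a sign. -/
theorem sum_skew_left (he : ∀ i j, g (e i) (e j) = if i = j then 1 else 0)
    {A : Module.End ℝ T} (hA : IsSkew g A) (C : Module.End ℝ T) (β : T →ₗ[ℝ] T →ₗ[ℝ] ℝ) :
    ∑ j, β (A (e j)) (C (e j)) = -∑ j, β (e j) (C (A (e j))) := by
  have h1 : ∀ j, β (A (e j)) (C (e j)) = ∑ m, g (e m) (A (e j)) * β (e m) (C (e j)) := by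
    intro j
    conv_lhs => rw [orthonormal_expand he (A (e j))]
    simp
  have h2 : ∀ m, β (e m) (C (A (e m))) = ∑ j, g (e j) (A (e m)) * β (e m) (C (e j)) := by
    intro m
    conv_lhs => rw [orthonormal_expand he (A (e m))]
    simp
  simp only [h1, h2]
  rw [Finset.sum_comm, ← Finset.sum_neg_distrib]
  refine Finset.sum_congr rfl fun m _ => ?_
  rw [← Finset.sum_neg_distrib]
  refine Finset.sum_congr rfl fun j _ => ?_
  rw [orthonormal_symm he (e m), hA, orthonormal_symm he (A (e m))]
  ring

theorem sum_skew_eq_zero (he : ∀ i j, g (e i) (e j) = if i = j then 1 else 0)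
    {A : Module.End ℝ T} (hA : IsSkew g A) {β : T →ₗ[ℝ] T →ₗ[ℝ] ℝ} (hβ : ∀ x y, β x y = β y x) :
    ∑ j, β (e j) (A (e j)) = 0 := by
  have h := sum_skew_left he hA LinearMap.id β
  simp only [LinearMap.id_apply] at h
  simp only [hβ (A _)] at h
  linarith

/-- In the definition of `q`, the sum over `i < j` of an expression which is linear in
`(e_i ∧ e_j) u` and in `S(e_i, e_j)` collapses to a single sum. -/
theorem sum_wedge (he : ∀ i j, g (e i) (e j) = if i = j then 1 else 0)
    {S : T →ₗ[ℝ] T →ₗ[ℝ] Module.End ℝ T} (hS : ∀ X Y, S X Y = -S Y X)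
    (φ : T →ₗ[ℝ] Module.End ℝ T →ₗ[ℝ] ℝ) (u : T) :
    ∑ i, ∑ j ∈ Finset.Ioi i, φ (wedge g (e i) (e j) u) (S (e i) (e j)) =
      ∑ j, φ (e j) (S u (e j)) := by
  have h0 : ∀ X, S X X = 0 := fun X => eq_zero_of_eq_neg_self (hS X X)
  have h1 := sum_Ioi_add_swap (fun i j => g (e i) u * φ (e j) (S (e i) (e j)))
    (fun i => by simp [h0])
  have h2 : ∀ i j, φ (wedge g (e i) (e j) u) (S (e i) (e j)) =
      g (e i) u * φ (e j) (S (e i) (e j)) + g (e j) u * φ (e i) (S (e j) (e i)) := by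
    intro i j
    rw [hS (e j) (e i)]
    simp only [wedge, LinearMap.sub_apply, LinearMap.smulRight_apply, map_sub, map_smul,
      LinearMap.smul_apply, smul_eq_mul, map_neg]
    ring
  simp only [h2]
  rw [h1, Finset.sum_comm]
  refine Finset.sum_congr rfl fun j _ => ?_
  conv_rhs => rw [orthonormal_expand he u]
  simp

variable {B : T →ₗ[ℝ] Module.End ℝ T}

theorem skewCurvature_antisymm (hB : ∀ X Y, B X Y = -B Y X) (X Y : T) :
    skewCurvature B X Y = -skewCurvature B Y X := by
  simp only [skewCurvature, hB X Y, map_neg]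
  module

theorem isSkew_wedge (X Y : T) : IsSkew g (wedge g X Y) := by
  intro U V
  simp only [wedge, LinearMap.sub_apply, LinearMap.smulRight_apply, map_sub, map_smul,
    LinearMap.smul_apply, smul_eq_mul]
  ring

theorem isSkew_skewCurvature (hg : ∀ u v, g u v = g v u) (hB : ∀ X, IsSkew g (B X)) (X Y : T) :
    IsSkew g (skewCurvature B X Y) := by
  have h : ∀ (X Y U V : T), g (B X (B Y U)) V = g (B Y (B X V)) U := by
    intro X Y U V
    rw [hB X, hg, hB Y, neg_neg]
  intro U V
  simp only [skewCurvature, LinearMap.sub_apply, LinearMap.smul_apply, Module.End.mul_apply,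
    map_sub, map_smul, smul_eq_mul, h X Y U V, h Y X U V, hB (B X Y) U V]
  ring

/-- The part of `q` which acts on a single slot: `∑_j S(u, e_j) e_j = -¼ ∑_j B_j² u`. -/
theorem sum_skewCurvature_apply (hB : ∀ X Y, B X Y = -B Y X) (e : Module.Basis (Fin n) ℝ T)
    (l : T →ₗ[ℝ] ℝ) (u : T) :
    ∑ j, l (skewCurvature B u (e j) (e j)) = -(1 / 4 : ℝ) * ∑ j, l (B (e j) (B (e j) u)) := by
  have hz : ∀ X, B X X = 0 := fun X => eq_zero_of_eq_neg_self (hB X X)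
  rw [Finset.mul_sum]
  refine Finset.sum_congr rfl fun j _ => ?_
  rw [skewCurvature, hB u (e j), map_neg]
  simp only [LinearMap.sub_apply, LinearMap.smul_apply, Module.End.mul_apply, hz, hB u (e j),
    map_zero, LinearMap.neg_apply, hB (B (e j) u) (e j), map_neg, map_sub, map_smul, smul_eq_mul]
  ring

/-- The part of `q` which acts on two different slots, on a symmetric form. -/
theorem sum_skewCurvature_bilin (hB : ∀ X Y, B X Y = -B Y X)
    (he : ∀ i j, g (e i) (e j) = if i = j then 1 else 0) (hBs : ∀ X, IsSkew g (B X))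
    {β : T →ₗ[ℝ] T →ₗ[ℝ] ℝ} (hβ : ∀ x y, β x y = β y x) (u v : T) :
    ∑ j, β (e j) (skewCurvature B u (e j) v) =
      -(1 / 4 : ℝ) * ∑ j, β (B (e j) u) (B (e j) v) := by
  have h1 : ∀ j, β (e j) (skewCurvature B u (e j) v) =
      -(1 / 4 : ℝ) * β (e j) (B u (B v (e j))) + (1 / 4 : ℝ) * β (e j) (B (B u v) (e j))
        + (1 / 2 : ℝ) * β (e j) (B v (B u (e j))) := by
    intro j
    simp only [skewCurvature, LinearMap.sub_apply, LinearMap.smul_apply, Module.End.mul_apply,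
      map_sub, map_smul, smul_eq_mul, hB (e j) v, hB (e j) (B u v), hB (B u (e j)) v, map_neg]
    ring
  -- moving `B_u` or `B_v` across turns the terms with `B_u B_v` and `B_v B_u` into the same sum
  have h2 := sum_skew_left he (hBs u) (B v) β
  have h3 := sum_skew_left he (hBs v) (B u) β
  simp only [hβ (B v _)] at h3
  have h4 : ∀ j, β (B (e j) u) (B (e j) v) = β (B u (e j)) (B v (e j)) := by
    intro j
    rw [hB (e j) u, hB (e j) v]; simp
  simp only [h1, h4, Finset.sum_add_distrib, ← Finset.mul_sum, sum_skew_eq_zero he (hBs _) hβ]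
  linarith

section LeibnizExt

variable {W : Type*} [AddCommGroup W] [Module ℝ W] {p : ℕ}

theorem leibnizExt_add (A C : Module.End ℝ W) :
    leibnizExt p (A + C) = leibnizExt p A + leibnizExt p C := by
  ext h v
  simp [leibnizExt_apply, Finset.sum_add_distrib]

theorem leibnizExt_neg (A : Module.End ℝ W) : leibnizExt p (-A) = -leibnizExt p A := by
  ext h v
  simp [leibnizExt_apply]

/-- The bilinear form obtained from a multilinear form by letting the slots `k` and `l` vary. -/
def twoSlots (h : MultilinearMap ℝ (fun _ : Fin p => W) ℝ) (v : Fin p → W) {k l : Fin p}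
    (hkl : l ≠ k) : W →ₗ[ℝ] W →ₗ[ℝ] ℝ :=
  LinearMap.mk₂ ℝ (fun x y => h (Function.update (Function.update v k x) l y))
    (by intro x x' y; simp only [Function.update_comm hkl.symm, h.map_update_add])
    (by intro c x y; simp only [Function.update_comm hkl.symm, h.map_update_smul])
    (by intro x y y'; simp only [h.map_update_add])
    (by intro c x y; simp only [h.map_update_smul])

theorem twoSlots_symm {h : MultilinearMap ℝ (fun _ : Fin p => W) ℝ} (hh : IsSymmetricTensor h)
    (v : Fin p → W) {k l : Fin p} (hkl : l ≠ k) (x y : W) :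
    twoSlots h v hkl x y = twoSlots h v hkl y x := by
  change h _ = h _
  rw [← hh (Equiv.swap k l)]
  congr 1
  funext i
  simp only [Function.comp]
  rcases eq_or_ne i k with rfl | hik
  · simp [hkl.symm]
  rcases eq_or_ne i l with rfl | hil
  · simp [hkl.symm]
  · rw [Equiv.swap_apply_of_ne_of_ne hik hil]
    simp [hik, hil]

open Classical in
/-- A sum of compositions of two derivations, split into the part acting twice on the same slot and
the part acting on two different slots. -/
theorem sum_leibnizExt_leibnizExt_apply {ι : Type*} (s : Finset ι) (A C : ι → Module.End ℝ W)
    (h : MultilinearMap ℝ (fun _ : Fin p => W) ℝ) (v : Fin p → W) :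
    ∑ x ∈ s, leibnizExt p (A x) (leibnizExt p (C x) h) v =
      ∑ k, (∑ x ∈ s, h.toLinearMap v k (C x (A x (v k))) +
        ∑ l, if hkl : l ≠ k then ∑ x ∈ s, twoSlots h v hkl (A x (v k)) (C x (v l)) else 0) := by
  have h1 : ∀ x, leibnizExt p (A x) (leibnizExt p (C x) h) v =
      ∑ k, (h.toLinearMap v k (C x (A x (v k))) +
        ∑ l, if hkl : l ≠ k then twoSlots h v hkl (A x (v k)) (C x (v l)) else 0) := by
    intro x
    simp only [leibnizExt_apply]
    refine Finset.sum_congr rfl fun k _ => ?_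
    rw [← Finset.add_sum_erase _ _ (Finset.mem_univ k),
      ← Finset.add_sum_erase _ (fun l => dite (l ≠ k) _ _) (Finset.mem_univ k)]
    simp only [Function.update_self, Function.update_idem, ne_eq, not_true_eq_false, dite_false,
      zero_add]
    congr 1
    refine Finset.sum_congr rfl fun l hl => ?_
    have hlk : l ≠ k := Finset.ne_of_mem_erase hl
    rw [dif_pos hlk, Function.update_of_ne hlk]
    rfl
  simp only [h1]
  rw [Finset.sum_comm]
  refine Finset.sum_congr rfl fun k _ => ?_
  rw [Finset.sum_add_distrib, Finset.sum_comm]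
  congr 1
  refine Finset.sum_congr rfl fun l _ => ?_
  split_ifs <;> simp

end LeibnizExt

/-- The bilinear map `S` given pointwise by `skewCurvature`. -/
def skewCurvatureMap (B : T →ₗ[ℝ] Module.End ℝ T) : T →ₗ[ℝ] T →ₗ[ℝ] Module.End ℝ T :=
  LinearMap.mk₂ ℝ (skewCurvature B)
    (by intro X X' Y; simp only [skewCurvature, map_add, LinearMap.add_apply, add_mul, mul_add]
        module)
    (by intro c X Y; simp only [skewCurvature, map_smul, LinearMap.smul_apply, smul_mul_assoc,
          mul_smul_comm]
        module)
    (by intro X Y Y'; simp only [skewCurvature, map_add, add_mul, mul_add]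
        module)
    (by intro c X Y; simp only [skewCurvature, map_smul, smul_mul_assoc,
          mul_smul_comm]
        module)

/-- The core identity: `∑_{i<j} (e_i ∧ e_j)_* S(e_i, e_j)_* = -¼ ∑_i (B_i)_*²` on symmetric
forms. -/
theorem sum_wedge_skewCurvature (hB : ∀ X Y, B X Y = -B Y X)
    (he : ∀ i j, g (e i) (e j) = if i = j then 1 else 0) (hBs : ∀ X, IsSkew g (B X)) {p : ℕ}
    {h : CovTensor p T} (hh : IsSymmetricTensor h) :
    ∑ i, ∑ j ∈ Finset.Ioi i, leibnizExt p (wedge g (e i) (e j))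
      (leibnizExt p (skewCurvature B (e i) (e j)) h) =
    -(1 / 4 : ℝ) • ∑ i, leibnizExt p (B (e i)) (leibnizExt p (B (e i)) h) := by
  classical
  have hS : ∀ X Y, skewCurvatureMap B X Y = -skewCurvatureMap B Y X := skewCurvature_antisymm hB
  have hsum : ∀ F : Fin n → Fin n → ℝ, ∑ x ∈ Finset.univ.sigma fun i => Finset.Ioi i, F x.1 x.2 =
      ∑ i, ∑ j ∈ Finset.Ioi i, F i j := fun F => Finset.sum_sigma _ _ _
  ext v
  simp only [sum_apply, smul_apply, smul_eq_mul]
  rw [← hsum (fun i j => leibnizExt p (wedge g (e i) (e j))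
      (leibnizExt p (skewCurvature B (e i) (e j)) h) v), sum_leibnizExt_leibnizExt_apply,
    sum_leibnizExt_leibnizExt_apply, Finset.mul_sum]
  refine Finset.sum_congr rfl fun k _ => ?_
  rw [mul_add]
  congr 1
  · rw [← sum_skewCurvature_apply hB e (h.toLinearMap v k) (v k)]
    let φ : T →ₗ[ℝ] Module.End ℝ T →ₗ[ℝ] ℝ :=
      (LinearMap.id (R := ℝ) (M := Module.End ℝ T)).flip.compr₂ (h.toLinearMap v k)
    exact (hsum _).trans (sum_wedge he hS φ (v k))
  · rw [Finset.mul_sum]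
    refine Finset.sum_congr rfl fun l _ => ?_
    split_ifs with hkl
    · rw [← sum_skewCurvature_bilin hB he hBs (twoSlots_symm hh v hkl) (v k) (v l)]
      let φ : T →ₗ[ℝ] Module.End ℝ T →ₗ[ℝ] ℝ :=
        (twoSlots h v hkl).compl₂ (LinearMap.applyₗ (v l))
      exact (hsum _).trans (sum_wedge he hS φ (v k))
    · simp

theorem covAct_sub (p : ℕ) (A C : Module.End ℝ T) :
    covAct p (A - C) = covAct p A - covAct p C := by
  rw [covAct, covAct, covAct, neg_sub', sub_eq_add_neg, leibnizExt_add, leibnizExt_neg (-C)]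
  ext h v
  simp [sub_eq_add_neg]

theorem contraAct_sub (p : ℕ) (A C : Module.End ℝ T) :
    contraAct p (A - C) = contraAct p A - contraAct p C := by
  have : LinearMap.dualMap (A - C) = LinearMap.dualMap A + -LinearMap.dualMap C := by
    ext; simp [sub_eq_add_neg]
  rw [contraAct, this, leibnizExt_add, leibnizExt_neg, contraAct, contraAct]
  ext h v
  simp [sub_eq_add_neg]

theorem curvatureEndomorphism_sub {V : Type*} [AddCommGroup V] [Module ℝ V]
    {ρ : Module.End ℝ T → Module.End ℝ V} (hρ : ∀ A C, ρ (A - C) = ρ A - ρ C)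
    (R R' : T →ₗ[ℝ] T →ₗ[ℝ] Module.End ℝ T) (v : V) :
    curvatureEndomorphism ρ g e R v - curvatureEndomorphism ρ g e R' v =
      ∑ i, ∑ j ∈ Finset.Ioi i, ρ (wedge g (e i) (e j)) (ρ (R (e i) (e j) - R' (e i) (e j)) v) := by
  simp only [curvatureEndomorphism, LinearMap.sum_apply, LinearMap.comp_apply, hρ,
    LinearMap.sub_apply, map_sub, Finset.sum_sub_distrib]

/-- Algebraic form of the comparison of curvature endomorphisms, on symmetric covariant tensors. -/
theorem curvatureEndomorphism_cov_sub (hB : ∀ X Y, B X Y = -B Y X)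
    (he : ∀ i j, g (e i) (e j) = if i = j then 1 else 0) (hBs : ∀ X, IsSkew g (B X))
    {R R' : T →ₗ[ℝ] T →ₗ[ℝ] Module.End ℝ T} (hR : ∀ X Y, R X Y - R' X Y = skewCurvature B X Y)
    {p : ℕ} {h : CovTensor p T} (hh : IsSymmetricTensor h) :
    curvatureEndomorphism (covAct p) g e R h - curvatureEndomorphism (covAct p) g e R' h =
      -(1 / 4 : ℝ) • sumSquares (covAct p) e B h := by
  rw [curvatureEndomorphism_sub (covAct_sub p)]
  simp only [hR, covAct, sumSquares, leibnizExt_neg, LinearMap.sum_apply, LinearMap.comp_apply,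
    LinearMap.neg_apply, map_neg, neg_neg]
  exact sum_wedge_skewCurvature hB he hBs hh

/-- Lowering the indices of a contravariant tensor with the help of `g`. -/
def lower (g : T →ₗ[ℝ] T →ₗ[ℝ] ℝ) {p : ℕ} : ContraTensor p T →ₗ[ℝ] CovTensor p T :=
  MultilinearMap.compLinearMapₗ fun _ => g

theorem lower_injective (he : ∀ i j, g (e i) (e j) = if i = j then 1 else 0) {p : ℕ} :
    Function.Injective (lower g (p := p)) := by
  intro h k hk
  ext α
  have hα : α = fun i => g (∑ j, α i (e j) • e j) := by
    funext i
    refine e.ext fun m => ?_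
    simp [he]
  rw [hα]
  exact DFunLike.congr_fun hk _

/-- Lowering indices commutes with the action of a skew-symmetric endomorphism `C`: the dual action
of `C` on `T*` corresponds under `g` to the action of `-C` on the arguments. -/
theorem lower_contraAct {C : Module.End ℝ T} (hC : IsSkew g C) (hg : ∀ u v, g u v = g v u) {p : ℕ}
    (h : ContraTensor p T) : lower g (contraAct p C h) = covAct p C (lower g h) := by
  ext v
  change contraAct p C h (fun i => g (v i)) = _
  rw [contraAct, covAct, leibnizExt_apply, leibnizExt_apply]
  refine Finset.sum_congr rfl fun k _ => ?_
  change _ = h _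
  congr 1
  funext i
  by_cases hi : i = k
  · subst hi
    simp only [Function.update_self]
    ext w
    rw [LinearMap.dualMap_apply, LinearMap.neg_apply, map_neg, LinearMap.neg_apply, hC, neg_neg, hg]
  · simp [hi]

theorem IsSymmetricTensor.lower {p : ℕ} {h : ContraTensor p T} (hh : IsSymmetricTensor h) :
    IsSymmetricTensor (lower g h) := fun σ v => hh σ fun i => g (v i)

/-- Algebraic form of the comparison of curvature endomorphisms, on symmetric contravariant
tensors. -/
theorem curvatureEndomorphism_contra_sub (hB : ∀ X Y, B X Y = -B Y X)
    (he : ∀ i j, g (e i) (e j) = if i = j then 1 else 0) (hBs : ∀ X, IsSkew g (B X))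
    {R R' : T →ₗ[ℝ] T →ₗ[ℝ] Module.End ℝ T} (hR : ∀ X Y, R X Y - R' X Y = skewCurvature B X Y)
    {p : ℕ} {h : ContraTensor p T} (hh : IsSymmetricTensor h) :
    curvatureEndomorphism (contraAct p) g e R h - curvatureEndomorphism (contraAct p) g e R' h =
      -(1 / 4 : ℝ) • sumSquares (contraAct p) e B h := by
  have hg := orthonormal_symm he
  apply lower_injective he
  have h1 := curvatureEndomorphism_cov_sub hB he hBs hR (hh.lower (g := g))
  rw [curvatureEndomorphism_sub (covAct_sub p)] at h1
  rw [curvatureEndomorphism_sub (contraAct_sub p)]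
  simp only [hR, sumSquares, map_sum, map_smul, LinearMap.sum_apply, LinearMap.comp_apply] at h1 ⊢
  simp only [lower_contraAct (isSkew_wedge _ _) hg, lower_contraAct (hBs _) hg,
    lower_contraAct (isSkew_skewCurvature hg hBs _ _) hg]
  exact h1

/-- A derivation which is skew-symmetric in an orthonormal basis acts skew-symmetrically on
tensors. -/
theorem tensorInner_leibnizExt {W : Type*} [AddCommGroup W] [Module ℝ W] {p : ℕ}
    (w : Module.Basis (Fin n) ℝ W) {C : Module.End ℝ W}
    (hC : ∀ i j, w.repr (C (w j)) i = -w.repr (C (w i)) j)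
    (h k : MultilinearMap ℝ (fun _ : Fin p => W) ℝ) :
    tensorInner w (leibnizExt p C h) k = -tensorInner w h (leibnizExt p C k) := by
  have key : ∀ (h : MultilinearMap ℝ (fun _ : Fin p => W) ℝ) (f : Fin p → Fin n),
      leibnizExt p C h (fun i => w (f i)) =
        ∑ m, ∑ l, w.repr (C (w (f m))) l * h (fun i => w (Function.update f m l i)) := by
    intro h f
    rw [leibnizExt_apply]
    refine Finset.sum_congr rfl fun m _ => ?_
    conv_lhs => rw [← w.sum_repr (C (w (f m)))]
    rw [h.map_update_sum]
    refine Finset.sum_congr rfl fun l _ => ?_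
    rw [h.map_update_smul, smul_eq_mul]
    congr 2
    funext i
    by_cases hi : i = m
    · subst hi; simp
    · simp [hi]
  simp only [tensorInner, key, Finset.sum_mul, Finset.mul_sum]
  rw [Finset.sum_comm, ← Finset.sum_neg_distrib]
  conv_rhs => rw [Finset.sum_congr rfl fun f _ => (Finset.sum_neg_distrib _).symm]
  rw [Finset.sum_comm (s := Finset.univ (α := Fin p → Fin n))]
  refine Finset.sum_congr rfl fun m _ => ?_
  rw [← Finset.sum_product', ← Finset.sum_congr rfl fun f _ => Finset.sum_neg_distrib _,
    ← Finset.sum_product']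
  -- exchange the old and the new value of the index in slot `m`
  refine Finset.sum_nbij' (fun x => (Function.update x.1 m x.2, x.1 m))
    (fun x => (Function.update x.1 m x.2, x.1 m)) (by simp) (by simp) (by simp) (by simp) ?_
  rintro ⟨f, l⟩ -
  simp only [Function.update_self, Function.update_idem, Function.update_eq_self]
  rw [hC]
  ring

theorem covAct_tensorInner (he : ∀ i j, g (e i) (e j) = if i = j then 1 else 0)
    {C : Module.End ℝ T} (hC : IsSkew g C) {p : ℕ} (h k : CovTensor p T) :
    tensorInner e (covAct p C h) k = -tensorInner e h (covAct p C k) := by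
  refine tensorInner_leibnizExt e (fun i j => ?_) h k
  simp only [orthonormal_repr he, LinearMap.neg_apply, map_neg, Finsupp.neg_apply,
    orthonormal_symm he (e _) (C _), hC (e j) (e i)]

theorem contraAct_tensorInner (he : ∀ i j, g (e i) (e j) = if i = j then 1 else 0)
    {C : Module.End ℝ T} (hC : IsSkew g C) {p : ℕ} (h k : ContraTensor p T) :
    tensorInner e.coord (contraAct p C h) k = -tensorInner e.coord h (contraAct p C k) := by
  rw [← e.coe_dualBasis]
  refine tensorInner_leibnizExt e.dualBasis (fun i j => ?_) h k
  simp only [Module.Basis.dualBasis_repr, LinearMap.dualMap_apply, e.coe_dualBasis,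
    Module.Basis.coord_apply, orthonormal_repr he, orthonormal_symm he (e _) (C _), hC (e i) (e j)]

/-- If `T* ⊗ V` and `V` carry the natural inner products and each `(A_{e_i})_*` is skew-symmetric,
the adjoint of `v ↦ ∑_i e_i^♭ ⊗ (A_{e_i})_* v` is `F ↦ -∑_i (A_{e_i})_* F(e_i)`, and so
`𝒜* 𝒜 = -∑_i (A_{e_i})_*²`. -/
theorem exists_metricAdjoint {V : Type*} [AddCommGroup V] [Module ℝ V] {ip : V → V → ℝ}
    {ρ : Module.End ℝ T → Module.End ℝ V} {A : T →ₗ[ℝ] Module.End ℝ T}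
    (hadd : ∀ {ι : Type} (s : Finset ι) (f : ι → V) v, ip (∑ i ∈ s, f i) v = ∑ i ∈ s, ip (f i) v)
    (hneg : ∀ u v, ip (-u) v = -ip u v)
    (hρ : ∀ i u v, ip (ρ (A (e i)) u) v = -ip u (ρ (A (e i)) v)) :
    ∃ S : (T →ₗ[ℝ] V) →ₗ[ℝ] V, IsMetricAdjoint ip e (tensorMap ρ e A) S ∧
      ∀ v, S (tensorMap ρ e A v) = -sumSquares ρ e A v := by
  have hA : ∀ v i, tensorMap ρ e A v (e i) = ρ (A (e i)) v := by
    intro v i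
    simp [tensorMap, LinearMap.sum_apply, Finsupp.single_apply, ite_smul]
  refine ⟨-∑ i, ρ (A (e i)) ∘ₗ LinearMap.applyₗ (e i), fun F v => ?_, fun v => ?_⟩
  · simp only [LinearMap.neg_apply, LinearMap.sum_apply, LinearMap.comp_apply,
      LinearMap.applyₗ_apply_apply, hneg, hadd, hA, hρ, Finset.sum_neg_distrib, neg_neg]
  · simp only [LinearMap.neg_apply, LinearMap.sum_apply, LinearMap.comp_apply,
      LinearMap.applyₗ_apply_apply, hA, sumSquares]

end Algebra

/-! ### Comparison of two connections -/

section Comparison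

open FiberBundle

variable {E : Type*} [NormedAddCommGroup E] [NormedSpace ℝ E] [FiniteDimensional ℝ E]
  {M : Type*} [TopologicalSpace M] [ChartedSpace E M] [IsManifold 𝓘(ℝ, E) ∞ M]

theorem exists_section_extending (x : M) (v : TangentSpace 𝓘(ℝ, E) x) :
    ∃ Y : Π y : M, TangentSpace 𝓘(ℝ, E) y, MDiffAt (T% Y) x ∧ Y x = v :=
  ⟨extend E v, mdifferentiableAt_extend 𝓘(ℝ, E) E v, extend_apply_self E v⟩

theorem mdifferentiableAt_smul_const_section {Y : Π y : M, TangentSpace 𝓘(ℝ, E) y} {x : M} (c : ℝ)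
    (hY : MDiffAt (T% Y) x) : MDiffAt (T% (c • Y)) x :=
  MDifferentiableAt.smul_section (f := fun _ => c) mdifferentiableAt_const hY

theorem AffineConnection.add_apply (cov : AffineConnection E M)
    {Y Z : Π y : M, TangentSpace 𝓘(ℝ, E) y} {x : M} (hY : MDiffAt (T% Y) x)
    (hZ : MDiffAt (T% Z) x) (v : TangentSpace 𝓘(ℝ, E) x) :
    cov (Y + Z) x v = cov Y x v + cov Z x v := by
  rw [cov.isCovariantDerivativeOnUniv.add hY hZ]
  rfl

/-- The difference of two affine connections is a tensor. -/
theorem exists_difference (cov cov' : AffineConnection E M) (x : M) :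
    ∃ D : TangentSpace 𝓘(ℝ, E) x →L[ℝ] TangentSpace 𝓘(ℝ, E) x →L[ℝ] TangentSpace 𝓘(ℝ, E) x,
      ∀ (Y : Π y : M, TangentSpace 𝓘(ℝ, E) y) (v : TangentSpace 𝓘(ℝ, E) x), MDiffAt (T% Y) x →
        cov Y x v = cov' Y x v + D (Y x) v := by
  refine ⟨cov.difference cov' x, fun Y v hY => ?_⟩
  have h := IsCovariantDerivativeOn.difference_apply cov.isCovariantDerivativeOnUniv
    cov'.isCovariantDerivativeOnUniv (x := x) trivial hY
  have h' := DFunLike.congr_fun h v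
  change cov.difference cov' x (Y x) v = cov Y x v - cov' Y x v at h'
  rw [h', add_sub_cancel]

variable {g : RMetric E M} {nabla nablaBar : AffineConnection E M}

/-- A metric connection with totally skew torsion is the Levi-Civita connection plus half of its
torsion. -/
theorem eq_add_half_torsion (hm : IsMetricConnection g nabla) (h0 : nabla.torsion = 0)
    (hm' : IsMetricConnection g nablaBar) (hs : HasSkewTorsion g nablaBar) (x : M)
    (v : TangentSpace 𝓘(ℝ, E) x) {Y : Π y : M, TangentSpace 𝓘(ℝ, E) y} (hY : MDiffAt (T% Y) x) :
    nablaBar Y x v = nabla Y x v + (1 / 2 : ℝ) • nablaBar.torsion x v (Y x) := by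
  obtain ⟨D, hD⟩ := exists_difference nablaBar nabla x
  have hskew : ∀ u y z : TangentSpace 𝓘(ℝ, E) x, g.inner x (D y u) z = -g.inner x (D z u) y := by
    intro u y z
    obtain ⟨Y, hY, rfl⟩ := exists_section_extending x y
    obtain ⟨Z, hZ, rfl⟩ := exists_section_extending x z
    have h1 := (hm x u Y Z hY hZ).symm.trans (hm' x u Y Z hY hZ)
    rw [hD Y u hY, hD Z u hZ, map_add, map_add, _root_.add_apply] at h1
    rw [g.symm x (D (Z x) u)]
    linarith
  have htor : ∀ y z : TangentSpace 𝓘(ℝ, E) x, nablaBar.torsion x y z = D z y - D y z := by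
    intro y z
    obtain ⟨Y, hY, rfl⟩ := exists_section_extending x y
    obtain ⟨Z, hZ, rfl⟩ := exists_section_extending x z
    have h1 := nabla.torsion_apply hY hZ
    rw [h0] at h1
    rw [nablaBar.torsion_apply hY hZ, hD Y _ hY, hD Z _ hZ]
    have h2 : nabla Z x (Y x) - nabla Y x (Z x) - VectorField.mlieBracket 𝓘(ℝ, E) Y Z x = 0 :=
      h1.symm
    rw [add_sub_add_comm, add_sub_right_comm, h2, zero_add]
  -- the cyclic symmetry forced by total skewness, as in the Koszul formula
  have hhalf : ∀ y z w : TangentSpace 𝓘(ℝ, E) x,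
      g.inner x (nablaBar.torsion x y z) w = 2 * g.inner x (D z y) w := by
    intro y z w
    have h1 := hs x y z w
    have h2 := hs x y w z
    have h3 := hs x z y w
    have h4 := hs x z w y
    have h5 := hs x w z y
    have h6 := hs x w y z
    simp only [htor, map_sub, _root_.sub_apply] at h1 h2 h3 h4 h5 h6 ⊢
    linarith [hskew y z w, hskew z y w, hskew w y z, hskew y w z, hskew z w y, hskew w z y]
  rw [hD Y v hY]
  congr 1
  set d := D (Y x) v - (1 / 2 : ℝ) • nablaBar.torsion x v (Y x) with hd
  by_contra hne
  have hd0 : d ≠ 0 := fun h => hne (sub_eq_zero.1 h)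
  refine (g.pos x d hd0).ne' ?_
  have h1 := hhalf v (Y x) d
  have h2 : g.inner x d = g.inner x (D (Y x) v) -
      (1 / 2 : ℝ) • g.inner x (nablaBar.torsion x v (Y x)) := by rw [hd, map_sub, map_smul]
  rw [h2, _root_.sub_apply, _root_.smul_apply, h1, smul_eq_mul]
  ring

/-- The curvatures of two connections which differ by half of the (parallel) torsion, evaluated on
vector fields. -/
theorem curvatureOfFields_sub (hp : HasParallelTorsion nablaBar)
    (hhalf : ∀ (x : M) (v : TangentSpace 𝓘(ℝ, E) x) (Y : Π y : M, TangentSpace 𝓘(ℝ, E) y),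
      MDiffAt (T% Y) x →
      nablaBar Y x v = nabla Y x v + (1 / 2 : ℝ) • nablaBar.torsion x v (Y x))
    {x : M} {X Y Z : Π y : M, TangentSpace 𝓘(ℝ, E) y} (hX : MDiffAt (T% X) x)
    (hY : MDiffAt (T% Y) x) (hZ : ∀ᶠ y in nhds x, MDiffAt (T% Z) y)
    (hXZ : MDiffAt (T% (fun y => nabla Z y (X y))) x)
    (hYZ : MDiffAt (T% (fun y => nabla Z y (Y y))) x)
    (hTX : MDiffAt (T% (fun y => nablaBar.torsion y (X y) (Z y))) x)
    (hTY : MDiffAt (T% (fun y => nablaBar.torsion y (Y y) (Z y))) x) :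
    curvatureOfFields nabla X Y Z x - curvatureOfFields nablaBar X Y Z x =
      skewCurvature (torsionAt nablaBar x) (X x) (Y x) (Z x) := by
  -- the iterated derivative `∇̄_X ∇̄_Y Z` in terms of `∇`, by means of `∇̄ T̄ = 0`
  have key : ∀ (X Y : Π y : M, TangentSpace 𝓘(ℝ, E) y), MDiffAt (T% Y) x →
      MDiffAt (T% (fun y => nabla Z y (Y y))) x →
      MDiffAt (T% (fun y => nablaBar.torsion y (Y y) (Z y))) x →
      nablaBar (fun y => nablaBar Z y (Y y)) x (X x) =
        nabla (fun y => nabla Z y (Y y)) x (X x)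
        + (1 / 2 : ℝ) • nablaBar.torsion x (X x) (nabla Z x (Y x))
        + (1 / 2 : ℝ) • (nablaBar.torsion x (nablaBar Y x (X x)) (Z x)
          + nablaBar.torsion x (Y x) (nablaBar Z x (X x))) := by
    intro X Y hY hA hT
    have hT2 : MDiffAt (T% ((1 / 2 : ℝ) • fun y => nablaBar.torsion y (Y y) (Z y))) x :=
      mdifferentiableAt_smul_const_section _ hT
    have hsum := mdifferentiableAt_add_section hA hT2
    have hev : ∀ᶠ y in nhds x, nablaBar Z y (Y y) = ((fun y => nabla Z y (Y y)) +
        ((1 / 2 : ℝ) • fun y => nablaBar.torsion y (Y y) (Z y))) y :=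
      hZ.mono fun y hy => hhalf y (Y y) Z hy
    have hbar : MDiffAt (T% (fun y => nablaBar Z y (Y y))) x := by
      refine hsum.congr_of_eventuallyEq ?_
      filter_upwards [hev] with y hy
      rw [hy]
    rw [nablaBar.isCovariantDerivativeOnUniv.congr_of_eventuallyEq hbar hsum Filter.univ_mem hev,
      nablaBar.add_apply hA hT2, hhalf x _ _ hA,
      nablaBar.isCovariantDerivativeOnUniv.smul_const _ hT, _root_.smul_apply,
      hp x _ Y Z hY hZ.self_of_nhds]
  have hZ0 := hZ.self_of_nhds
  have htor := nablaBar.torsion_apply hX hY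
  simp only [curvatureOfFields]
  rw [key X Y hY hYZ hTY, key Y X hX hXZ hTX, hhalf x (X x) Z hZ0,
    hhalf x (Y x) Z hZ0, hhalf x (VectorField.mlieBracket 𝓘(ℝ, E) X Y x) Z hZ0]
  have hbr : VectorField.mlieBracket 𝓘(ℝ, E) X Y x =
    nablaBar Y x (X x) - nablaBar X x (Y x) - nablaBar.torsion x (X x) (Y x) := by
    rw [htor]; abel
  have hS : skewCurvature (torsionAt nablaBar x) (X x) (Y x) (Z x) =
      (1 / 4 : ℝ) • (nablaBar.torsion x (X x) (nablaBar.torsion x (Y x) (Z x)) -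
        nablaBar.torsion x (Y x) (nablaBar.torsion x (X x) (Z x))) -
      (1 / 2 : ℝ) • nablaBar.torsion x (nablaBar.torsion x (X x) (Y x)) (Z x) := rfl
  have hbrT : nablaBar.torsion x (VectorField.mlieBracket 𝓘(ℝ, E) X Y x) (Z x) =
      nablaBar.torsion x (nablaBar Y x (X x)) (Z x) - nablaBar.torsion x (nablaBar X x (Y x)) (Z x)
        - nablaBar.torsion x (nablaBar.torsion x (X x) (Y x)) (Z x) := by
    rw [hbr, map_sub, map_sub]; rfl
  rw [hS, hbrT, map_add, map_add, map_smul, map_smul]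
  module

/-- The local frame of the tangent bundle by means of which `curvature` is defined. -/
abbrev tangentFrame (x : M) (i : Fin (Module.finrank ℝ E)) : Π y : M, TangentSpace 𝓘(ℝ, E) y :=
  (trivializationAt E (TangentSpace 𝓘(ℝ, E) : M → Type _) x).localFrame (Module.finBasis ℝ E) i

theorem eventually_mdifferentiableAt_tangentFrame (x : M) (i : Fin (Module.finrank ℝ E)) :
    ∀ᶠ y in nhds x, MDiffAt (T% (tangentFrame (E := E) x i)) y := by
  filter_upwards [(trivializationAt E (TangentSpace 𝓘(ℝ, E) : M → Type _) x).open_baseSet.mem_nhds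
    (FiberBundle.mem_baseSet_trivializationAt' x)] with y hy
  exact (contMDiffAt_localFrame_of_mem 1 _ (Module.finBasis ℝ E) i hy).mdifferentiableAt one_ne_zero

/-- The curvatures of two connections which differ by half of the (parallel) torsion. -/
theorem curvature_sub (hp : HasParallelTorsion nablaBar)
    (hhalf : ∀ (x : M) (v : TangentSpace 𝓘(ℝ, E) x) (Y : Π y : M, TangentSpace 𝓘(ℝ, E) y),
      MDiffAt (T% Y) x →
      nablaBar Y x v = nabla Y x v + (1 / 2 : ℝ) • nablaBar.torsion x v (Y x)) (x : M)
    (hs : ∀ i j, MDiffAt (T% (fun y => nabla (tangentFrame x j) y (tangentFrame x i y))) x)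
    (hT : ∀ i j, MDiffAt
      (T% (fun y => nablaBar.torsion y (tangentFrame x i y) (tangentFrame x j y))) x)
    (X Y : TangentSpace 𝓘(ℝ, E) x) :
    curvature nabla x X Y - curvature nablaBar x X Y =
      skewCurvature (torsionAt nablaBar x) X Y := by
  let b := (trivializationAt E (TangentSpace 𝓘(ℝ, E) : M → Type _) x).basisAt
    (Module.finBasis ℝ E) (FiberBundle.mem_baseSet_trivializationAt' x)
  have hb : ∀ i, tangentFrame (E := E) x i x = b i := fun i =>
    Bundle.Trivialization.localFrame_apply_of_mem_baseSet _ _ _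
  have hc : ∀ (cov : AffineConnection E M) i j k, curvature cov x (b i) (b j) (b k) =
      curvatureOfFields cov (tangentFrame x i) (tangentFrame x j) (tangentFrame x k) x := by
    intro cov i j k
    simp only [curvature, b, Module.Basis.constr_basis]
  have hmain : curvature nabla x - curvature nablaBar x =
      skewCurvatureMap (torsionAt nablaBar x) := by
    refine b.ext fun i => b.ext fun j => b.ext fun k => ?_
    have hd := fun i => eventually_mdifferentiableAt_tangentFrame (E := E) x i
    have h := curvatureOfFields_sub hp hhalf (hd i).self_of_nhds (hd j).self_of_nhds (hd k)
      (hs i k) (hs j k) (hT i k) (hT j k)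
    rw [hb, hb, hb] at h
    simp only [LinearMap.sub_apply, hc, h]
    rfl
  exact DFunLike.congr_fun (DFunLike.congr_fun hmain X) Y

/-- Each member of the local frame agrees near `x` with a globally smooth vector field. This is the
step which needs `M` to be Hausdorff; the smoothness of a connection only speaks of such fields. -/
theorem exists_smooth_tangentFrame [T2Space M] (x : M) (i : Fin (Module.finrank ℝ E)) :
    ∃ σ : Π y : M, TangentSpace 𝓘(ℝ, E) y, CMDiff ∞ (T% σ) ∧
      ∀ᶠ y in nhds x, σ y = tangentFrame x i y := by
  let e := trivializationAt E (TangentSpace 𝓘(ℝ, E) : M → Type _) x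
  obtain ⟨f, -, hf⟩ := (SmoothBumpFunction.nhds_basis_tsupport (I := 𝓘(ℝ, E)) x).mem_iff.1
    (e.open_baseSet.mem_nhds (FiberBundle.mem_baseSet_trivializationAt' x))
  refine ⟨(f : M → ℝ) • tangentFrame x i, ?_, ?_⟩
  · exact ContMDiffOn.smul_section_of_tsupport f.contMDiff.contMDiffOn e.open_baseSet hf
      (e.contMDiffOn_localFrame_baseSet _ (Module.finBasis ℝ E) i)
  · filter_upwards [f.eventuallyEq_one] with y hy
    simp [hy]

theorem mdifferentiableAt_cov_tangentFrame [T2Space M] {cov : AffineConnection E M}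
    (hcov : cov.ContMDiffCovariantDerivative ∞) (x : M) (i j : Fin (Module.finrank ℝ E)) :
    MDiffAt (T% (fun y => cov (tangentFrame x j) y (tangentFrame x i y))) x := by
  obtain ⟨σ, hσ, hσe⟩ := exists_smooth_tangentFrame (E := E) x j
  have h1 := (hcov.contMDiff.contMDiff (σ := σ) (hσ.contMDiffOn)).contMDiffAt (x := x)
    Filter.univ_mem
  have h2 := ContMDiffAt.clm_bundle_apply h1
    (contMDiffAt_localFrame_of_mem ∞ _ (Module.finBasis ℝ E) i
      (FiberBundle.mem_baseSet_trivializationAt' x))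
  refine (h2.mdifferentiableAt (by simp)).congr_of_eventuallyEq ?_
  filter_upwards [hσe.eventually_nhds, eventually_mdifferentiableAt_tangentFrame (E := E) x j]
    with y hy hdy
  have := cov.isCovariantDerivativeOnUniv.congr_of_eventuallyEq hdy
    (hσ.mdifferentiable (by simp) y) Filter.univ_mem (hy.mono fun _ h => h.symm)
  rw [this]

/-- The torsion is twice the difference of the two connections, and so inherits their
differentiability. -/
theorem mdifferentiableAt_torsion_tangentFrame [T2Space M]
    (hn : nabla.ContMDiffCovariantDerivative ∞) (hn' : nablaBar.ContMDiffCovariantDerivative ∞)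
    (hhalf : ∀ (x : M) (v : TangentSpace 𝓘(ℝ, E) x) (Y : Π y : M, TangentSpace 𝓘(ℝ, E) y),
      MDiffAt (T% Y) x →
      nablaBar Y x v = nabla Y x v + (1 / 2 : ℝ) • nablaBar.torsion x v (Y x)) (x : M)
    (i j : Fin (Module.finrank ℝ E)) :
    MDiffAt (T% (fun y => nablaBar.torsion y (tangentFrame x i y) (tangentFrame x j y))) x := by
  have h := mdifferentiableAt_smul_const_section (2 : ℝ)
    (mdifferentiableAt_sub_section (mdifferentiableAt_cov_tangentFrame hn' x i j)
      (mdifferentiableAt_cov_tangentFrame hn x i j))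
  refine h.congr_of_eventuallyEq ?_
  filter_upwards [eventually_mdifferentiableAt_tangentFrame (E := E) x j] with y hy
  have := hhalf y (tangentFrame x i y) _ hy
  congr 1
  simp only [Pi.smul_apply, Pi.sub_apply, this]
  module

theorem isSkew_torsionAt (hs : HasSkewTorsion g nablaBar) (x : M) (X : TangentSpace 𝓘(ℝ, E) x) :
    IsSkew (metricAt g x) (torsionAt nablaBar x X) := fun Y Z => hs x X Y Z

theorem torsionAt_antisymm (x : M) (X Y : TangentSpace 𝓘(ℝ, E) x) :
    torsionAt nablaBar x X Y = -torsionAt nablaBar x Y X := nablaBar.torsion_antisymm X Y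

end Comparison

/-! ### Naturality of the Lie bracket -/

section Related

open VectorField

variable {F : Type*} [NormedAddCommGroup F] [NormedSpace ℝ F]
  {E : Type*} [NormedAddCommGroup E] [NormedSpace ℝ E]

/-- The Lie bracket is natural with respect to related vector fields, in vector spaces. The proof is
the symmetry of the second derivative. -/
theorem fderiv_lieBracket_of_related {f : F → E} {u : F} (hf : ContDiffAt ℝ 2 f u) {V W : F → F}
    {V' W' : E → E} (hV : DifferentiableAt ℝ V u) (hW : DifferentiableAt ℝ W u)
    (hV' : DifferentiableAt ℝ V' (f u)) (hW' : DifferentiableAt ℝ W' (f u))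
    (hVV' : ∀ᶠ y in nhds u, fderiv ℝ f y (V y) = V' (f y))
    (hWW' : ∀ᶠ y in nhds u, fderiv ℝ f y (W y) = W' (f y)) :
    fderiv ℝ f u (lieBracket ℝ V W u) = lieBracket ℝ V' W' (f u) := by
  have hdf : DifferentiableAt ℝ (fderiv ℝ f) u :=
    (hf.fderiv_right (m := 1) (by norm_num)).differentiableAt one_ne_zero
  have hfu : DifferentiableAt ℝ f u := hf.differentiableAt two_ne_zero
  have key : ∀ {V : F → F} {V' : E → E}, DifferentiableAt ℝ V u → DifferentiableAt ℝ V' (f u) →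
      (∀ᶠ y in nhds u, fderiv ℝ f y (V y) = V' (f y)) → ∀ w,
      fderiv ℝ (fderiv ℝ f) u w (V u) + fderiv ℝ f u (fderiv ℝ V u w) =
        fderiv ℝ V' (f u) (fderiv ℝ f u w) := by
    intro V V' hV hV' h w
    have h1 := (hdf.hasFDerivAt.clm_apply hV.hasFDerivAt).fderiv
    have h2 := (hV'.hasFDerivAt.comp u hfu.hasFDerivAt).fderiv
    have h3 : (fun y => fderiv ℝ f y (V y)) =ᶠ[nhds u] V' ∘ f := h
    rw [h3.fderiv_eq, h2] at h1
    have := DFunLike.congr_fun h1 w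
    simp only [ContinuousLinearMap.comp_apply, _root_.add_apply,
      ContinuousLinearMap.flip_apply] at this
    rw [this, add_comm]
  have hsymm : fderiv ℝ (fderiv ℝ f) u (V u) (W u) = fderiv ℝ (fderiv ℝ f) u (W u) (V u) :=
    hf.isSymmSndFDerivAt (by simp [minSmoothness_of_isRCLikeNormedField]) _ _
  have h1 := key hW hW' hWW' (V u)
  have h2 := key hV hV' hVV' (W u)
  rw [lieBracket, lieBracket, map_sub, ← hVV'.self_of_nhds, ← hWW'.self_of_nhds, ← h1, ← h2, hsymm]
  abel

variable [CompleteSpace E] {M : Type*} [TopologicalSpace M] [ChartedSpace E M]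
  [IsManifold 𝓘(ℝ, E) ∞ M]

/-- The Lie bracket is natural with respect to related vector fields, for a map from a vector space
to a manifold. -/
theorem mfderiv_lieBracket_of_related {f : F → M} {u : F}
    (hf : ContMDiffAt 𝓘(ℝ, F) 𝓘(ℝ, E) 2 f u) {V W : F → F}
    {V' W' : Π x : M, TangentSpace 𝓘(ℝ, E) x} (hV : DifferentiableAt ℝ V u)
    (hW : DifferentiableAt ℝ W u) (hV' : MDiffAt (T% V') (f u))
    (hW' : MDiffAt (T% W') (f u))
    (hVV' : ∀ᶠ y in nhds u, mfderiv 𝓘(ℝ, F) 𝓘(ℝ, E) f y (V y) = V' (f y))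
    (hWW' : ∀ᶠ y in nhds u, mfderiv 𝓘(ℝ, F) 𝓘(ℝ, E) f y (W y) = W' (f y)) :
    mfderiv 𝓘(ℝ, F) 𝓘(ℝ, E) f u (lieBracket ℝ V W u : F) =
      mlieBracket 𝓘(ℝ, E) V' W' (f u) := by
  set φ := extChartAt 𝓘(ℝ, E) (f u) with hφ
  -- `P V'` represents the vector field `V'` in the chart at `f u`
  let P : (Π x : M, TangentSpace 𝓘(ℝ, E) x) → E → E :=
    fun V' => mpullbackWithin 𝓘(ℝ, E) 𝓘(ℝ, E) φ.symm V' (Set.range 𝓘(ℝ, E))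
  have hφc : ContMDiffAt 𝓘(ℝ, E) 𝓘(ℝ, E) ∞ φ (f u) := contMDiffAt_extChartAt
  have hcomp : ContDiffAt ℝ 2 (φ ∘ f) u :=
    ((hφc.of_le (by exact_mod_cast ENat.LEInfty.out)).comp u hf).contDiffAt
  have hsrc : ∀ᶠ y in nhds u, f y ∈ φ.source :=
    hf.continuousAt.eventually (extChartAt_source_mem_nhds (f u))
  have hfd : ∀ᶠ y in nhds u, MDifferentiableAt 𝓘(ℝ, F) 𝓘(ℝ, E) f y :=
    (contMDiffAt_iff_contMDiffAt_nhds (by simp) |>.1 hf).mono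
      fun y hy => hy.mdifferentiableAt two_ne_zero
  have hchain : ∀ y, f y ∈ φ.source → MDifferentiableAt 𝓘(ℝ, F) 𝓘(ℝ, E) f y → ∀ w : F,
      fderiv ℝ (φ ∘ f) y w =
        mfderiv 𝓘(ℝ, E) 𝓘(ℝ, E) φ (f y) (mfderiv 𝓘(ℝ, F) 𝓘(ℝ, E) f y w) := by
    intro y hy hfy w
    have hφy : MDifferentiableAt 𝓘(ℝ, E) 𝓘(ℝ, E) φ (f y) :=
      mdifferentiableAt_extChartAt (by rwa [← extChartAt_source 𝓘(ℝ, E)])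
    have h := mfderiv_comp y hφy hfy
    rw [mfderiv_eq_fderiv] at h
    exact DFunLike.congr_fun h w
  have hP : ∀ {V' : Π x : M, TangentSpace 𝓘(ℝ, E) x}, MDiffAt (T% V') (f u) →
      DifferentiableAt ℝ (P V') ((φ ∘ f) u) := by
    intro V' hV'
    have h := MDifferentiableWithinAt.differentiableWithinAt_mpullbackWithin_vectorField
      (mdifferentiableWithinAt_univ.2 hV')
    have hset : (extChartAt 𝓘(ℝ, E) (f u)).symm ⁻¹' Set.univ ∩ Set.range 𝓘(ℝ, E) = Set.univ := by
      simp
    rw [hset] at h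
    exact h.differentiableAt Filter.univ_mem
  have hrel : ∀ {V : F → F} {V' : Π x : M, TangentSpace 𝓘(ℝ, E) x},
      (∀ᶠ y in nhds u, mfderiv 𝓘(ℝ, F) 𝓘(ℝ, E) f y (V y) = V' (f y)) →
      ∀ᶠ y in nhds u, fderiv ℝ (φ ∘ f) y (V y) = P V' ((φ ∘ f) y) := by
    intro V V' h
    have h1 : V' =ᶠ[nhds (f u)] mpullback 𝓘(ℝ, E) 𝓘(ℝ, E) φ (P V') := by
      have := eventuallyEq_mpullback_mpullbackWithin_extChartAt (I := 𝓘(ℝ, E)) (x := f u)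
        (s := Set.univ) V'
      rwa [nhdsWithin_univ] at this
    filter_upwards [h, hf.continuousAt.eventually h1, hsrc, hfd] with y hy hy1 hy2 hy3
    rw [hchain y hy2 hy3, hy, hy1, mpullback_apply]
    obtain ⟨A, hA⟩ := isInvertible_mfderiv_extChartAt (I := 𝓘(ℝ, E)) hy2
    rw [← hA, ContinuousLinearMap.inverse_equiv]
    exact A.apply_symm_apply _
  have hmain := fderiv_lieBracket_of_related hcomp hV hW (hP hV') (hP hW') (hrel hVV') (hrel hWW')
  rw [hchain u hsrc.self_of_nhds hfd.self_of_nhds] at hmain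
  rw [← mlieBracketWithin_univ, mlieBracketWithin_apply]
  simp only [Set.preimage_univ, modelWithCornersSelf_coe, Set.range_id, Set.inter_self]
  obtain ⟨A, hA⟩ := isInvertible_mfderiv_extChartAt (I := 𝓘(ℝ, E)) hsrc.self_of_nhds
  have h2 : (mfderiv 𝓘(ℝ, E) 𝓘(ℝ, E) φ (f u)).inverse
      (mfderiv 𝓘(ℝ, E) 𝓘(ℝ, E) φ (f u) (mfderiv 𝓘(ℝ, F) 𝓘(ℝ, E) f u
        (lieBracket ℝ V W u : F))) =
      mfderiv 𝓘(ℝ, F) 𝓘(ℝ, E) f u (lieBracket ℝ V W u : F) := by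
    rw [← hA, ContinuousLinearMap.inverse_equiv]
    exact A.symm_apply_apply _
  rw [← h2, hmain]
  simp only [P, modelWithCornersSelf_coe, Set.range_id]
  exact congrArg (mfderiv 𝓘(ℝ, E) 𝓘(ℝ, E) φ (f u)).inverse
    (congrFun (lieBracketWithin_univ (𝕜 := ℝ) (E := E)) _).symm

/-- Any vector field is, near a given point, related to a vector field on the model space by means
of a chart. -/
theorem exists_chart_related {V : Π x : M, TangentSpace 𝓘(ℝ, E) x} {x : M}
    (hV : MDiffAt (T% V) x) :
    ∃ V' : E → E,
      DifferentiableAt ℝ V' (extChartAt 𝓘(ℝ, E) x x) ∧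
      ∀ᶠ y in nhds (extChartAt 𝓘(ℝ, E) x x),
        mfderiv 𝓘(ℝ, E) 𝓘(ℝ, E) (extChartAt 𝓘(ℝ, E) x).symm y (V' y) =
          V ((extChartAt 𝓘(ℝ, E) x).symm y) := by
  refine ⟨mpullbackWithin 𝓘(ℝ, E) 𝓘(ℝ, E) (extChartAt 𝓘(ℝ, E) x).symm V (Set.range 𝓘(ℝ, E)),
    ?_, ?_⟩
  · have h := MDifferentiableWithinAt.differentiableWithinAt_mpullbackWithin_vectorField
      (mdifferentiableWithinAt_univ.2 hV)
    have hset : (extChartAt 𝓘(ℝ, E) x).symm ⁻¹' Set.univ ∩ Set.range 𝓘(ℝ, E) = Set.univ := by simp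
    rw [hset] at h
    exact h.differentiableAt Filter.univ_mem
  · filter_upwards [extChartAt_target_mem_nhds (I := 𝓘(ℝ, E)) x] with y hy
    obtain ⟨A, hA⟩ := isInvertible_mfderivWithin_extChartAt_symm (I := 𝓘(ℝ, E)) hy
    rw [mpullbackWithin_apply]
    have h1 : mfderiv 𝓘(ℝ, E) 𝓘(ℝ, E) (extChartAt 𝓘(ℝ, E) x).symm y =
      mfderivWithin 𝓘(ℝ, E) 𝓘(ℝ, E) (extChartAt 𝓘(ℝ, E) x).symm (Set.range 𝓘(ℝ, E)) y := by
      simp only [modelWithCornersSelf_coe, Set.range_id, mfderivWithin_univ]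
    rw [h1, ← hA, ContinuousLinearMap.inverse_equiv]
    exact A.apply_symm_apply _

theorem contMDiffAt_extChartAt_symm_self (x : M) :
    ContMDiffAt 𝓘(ℝ, E) 𝓘(ℝ, E) ∞ (extChartAt 𝓘(ℝ, E) x).symm (extChartAt 𝓘(ℝ, E) x x) :=
  (contMDiffOn_extChartAt_symm x).contMDiffAt (extChartAt_target_mem_nhds x)

variable {E' : Type*} [NormedAddCommGroup E'] [NormedSpace ℝ E'] [CompleteSpace E']
  {M' : Type*} [TopologicalSpace M'] [ChartedSpace E' M'] [IsManifold 𝓘(ℝ, E') ∞ M']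

/-- The Lie bracket is natural with respect to related vector fields. -/
theorem mfderiv_mlieBracket_of_related {f : M → M'} {x : M}
    (hf : ContMDiffAt 𝓘(ℝ, E) 𝓘(ℝ, E') ∞ f x) {V W : Π y : M, TangentSpace 𝓘(ℝ, E) y}
    {V' W' : Π y : M', TangentSpace 𝓘(ℝ, E') y} (hV : MDiffAt (T% V) x) (hW : MDiffAt (T% W) x)
    (hV' : MDiffAt (T% V') (f x)) (hW' : MDiffAt (T% W') (f x))
    (hVV' : ∀ᶠ y in nhds x, mfderiv 𝓘(ℝ, E) 𝓘(ℝ, E') f y (V y) = V' (f y))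
    (hWW' : ∀ᶠ y in nhds x, mfderiv 𝓘(ℝ, E) 𝓘(ℝ, E') f y (W y) = W' (f y)) :
    mfderiv 𝓘(ℝ, E) 𝓘(ℝ, E') f x (mlieBracket 𝓘(ℝ, E) V W x) =
      mlieBracket 𝓘(ℝ, E') V' W' (f x) := by
  obtain ⟨A, hA, hAV⟩ := exists_chart_related hV
  obtain ⟨B, hB, hBW⟩ := exists_chart_related hW
  have hψ := contMDiffAt_extChartAt_symm_self (E := E) x
  have hψx : (extChartAt 𝓘(ℝ, E) x).symm (extChartAt 𝓘(ℝ, E) x x) = x := extChartAt_to_inv x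
  -- both brackets are images of the bracket of the coordinate representations in the chart at `x`
  generalize (extChartAt 𝓘(ℝ, E) x).symm = ψ at *
  generalize extChartAt 𝓘(ℝ, E) x x = u at *
  subst hψx
  have h2 : (2 : WithTop ℕ∞) ≤ ∞ := by exact_mod_cast ENat.LEInfty.out
  have hψ2 := hψ.of_le h2
  have hψd : ∀ᶠ y in nhds u, MDifferentiableAt 𝓘(ℝ, E) 𝓘(ℝ, E) ψ y :=
    (contMDiffAt_iff_contMDiffAt_nhds (by simp) |>.1 hψ2).mono
      fun y hy => hy.mdifferentiableAt two_ne_zero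
  have hfd : ∀ᶠ y in nhds u, MDifferentiableAt 𝓘(ℝ, E) 𝓘(ℝ, E') f (ψ y) :=
    hψ.continuousAt.eventually
      ((contMDiffAt_iff_contMDiffAt_nhds (by simp) |>.1 (hf.of_le h2)).mono
        fun y hy => hy.mdifferentiableAt two_ne_zero)
  have hrel : ∀ {A : E → E} {V : Π y : M, TangentSpace 𝓘(ℝ, E) y}
      {V' : Π y : M', TangentSpace 𝓘(ℝ, E') y},
      (∀ᶠ y in nhds u, mfderiv 𝓘(ℝ, E) 𝓘(ℝ, E) ψ y (A y) = V (ψ y)) →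
      (∀ᶠ y in nhds (ψ u), mfderiv 𝓘(ℝ, E) 𝓘(ℝ, E') f y (V y) = V' (f y)) →
      ∀ᶠ y in nhds u, mfderiv 𝓘(ℝ, E) 𝓘(ℝ, E') (f ∘ ψ) y (A y) = V' ((f ∘ ψ) y) := by
    intro A V V' h h'
    filter_upwards [h, hψ.continuousAt.eventually h', hψd, hfd] with y h1 h2 h3 h4
    exact (DFunLike.congr_fun (mfderiv_comp y h4 h3) (A y)).trans
      ((congrArg (mfderiv 𝓘(ℝ, E) 𝓘(ℝ, E') f (ψ y)) h1).trans h2)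
  have e1 := mfderiv_lieBracket_of_related hψ2 hA hB hV hW hAV hBW
  have e2 := mfderiv_lieBracket_of_related (f := f ∘ ψ) ((hf.of_le h2).comp u hψ2) hA hB hV' hW'
    (hrel hAV hVV') (hrel hBW hWW')
  rw [← e1]
  exact (DFunLike.congr_fun (mfderiv_comp u hfd.self_of_nhds hψd.self_of_nhds) _).symm.trans e2

end Related

/-! ### Derivatives of vector-valued functions on a manifold -/

section Derivatives

variable {E : Type*} [NormedAddCommGroup E] [NormedSpace ℝ E]
  {M : Type*} [TopologicalSpace M] [ChartedSpace E M]
  {F₁ F₂ F₃ : Type*} [NormedAddCommGroup F₁] [NormedSpace ℝ F₁]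
  [NormedAddCommGroup F₂] [NormedSpace ℝ F₂] [NormedAddCommGroup F₃] [NormedSpace ℝ F₃]

theorem mvfderiv_comp_of_hasFDerivAt {L : F₁ → F₂} {L' : F₁ →L[ℝ] F₂} {c : M → F₁} {a : M}
    (hL : HasFDerivAt L L' (c a)) (hc : MDiffAt c a) (w : TangentSpace 𝓘(ℝ, E) a) :
    mvfderiv 𝓘(ℝ, E) (fun b => L (c b)) a w = L' (mvfderiv 𝓘(ℝ, E) c a w) := by
  have h := mfderiv_comp (I := 𝓘(ℝ, E)) (I' := 𝓘(ℝ, F₁)) (I'' := 𝓘(ℝ, F₂)) a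
    hL.differentiableAt.mdifferentiableAt hc
  rw [mfderiv_eq_fderiv, hL.fderiv] at h
  exact DFunLike.congr_fun h w

theorem mvfderiv_clm_apply (L : F₁ →L[ℝ] F₂) {c : M → F₁} {a : M} (hc : MDiffAt c a)
    (w : TangentSpace 𝓘(ℝ, E) a) :
    mvfderiv 𝓘(ℝ, E) (fun b => L (c b)) a w = L (mvfderiv 𝓘(ℝ, E) c a w) :=
  mvfderiv_comp_of_hasFDerivAt L.hasFDerivAt hc w

theorem mdifferentiableAt_bilin (B : F₁ →L[ℝ] F₂ →L[ℝ] F₃) {c : M → F₁} {d : M → F₂} {a : M}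
    (hc : MDiffAt c a) (hd : MDiffAt d a) :
    MDiffAt (fun b => B (c b) (d b)) a :=
  (B.differentiableAt.comp_mdifferentiableAt hc).clm_apply hd

theorem mvfderiv_bilin (B : F₁ →L[ℝ] F₂ →L[ℝ] F₃) {c : M → F₁} {d : M → F₂} {a : M}
    (hc : MDiffAt c a) (hd : MDiffAt d a) (w : TangentSpace 𝓘(ℝ, E) a) :
    mvfderiv 𝓘(ℝ, E) (fun b => B (c b) (d b)) a w =
      B (mvfderiv 𝓘(ℝ, E) c a w) (d a) + B (c a) (mvfderiv 𝓘(ℝ, E) d a w) := by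
  have hcd : MDifferentiableAt 𝓘(ℝ, E) 𝓘(ℝ, F₁ × F₂) (fun b => (c b, d b)) a :=
    hc.prodMk_space hd
  have hB := B.isBoundedBilinearMap.hasFDerivAt (c a, d a)
  have h2 := mvfderiv_clm_apply (ContinuousLinearMap.fst ℝ F₁ F₂) hcd w
  have h3 := mvfderiv_clm_apply (ContinuousLinearMap.snd ℝ F₁ F₂) hcd w
  simp only [ContinuousLinearMap.coe_fst', ContinuousLinearMap.coe_snd'] at h2 h3
  refine (mvfderiv_comp_of_hasFDerivAt (c := fun b => (c b, d b)) hB hcd w).trans ?_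
  rw [h2, h3, add_comm]
  rfl

end Derivatives

/-! ### Vector fields on a Lie group -/

section LieGroup

open VectorField

variable {EG : Type*} [NormedAddCommGroup EG] [NormedSpace ℝ EG] [FiniteDimensional ℝ EG]
  {G : Type*} [TopologicalSpace G] [ChartedSpace EG G] [Group G] [LieGroup 𝓘(ℝ, EG) ∞ G]

variable (EG G) in
theorem lieGroup_minSmoothness : LieGroup 𝓘(ℝ, EG) (minSmoothness ℝ 3) G :=
  LieGroup.of_le (n := ∞) (by rw [minSmoothness_of_isRCLikeNormedField]; exact ENat.LEInfty.out)

/-- The vector field on `G` whose value at `b` is the left translate of `c b ∈ 𝔤`. -/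
def leftField (c : G → EG) (b : G) : TangentSpace 𝓘(ℝ, EG) b := leftTranslate b (c b)

/-- The left-invariant vector fields belonging to a basis of `𝔤`. -/
abbrev leftFrame (G : Type*) [TopologicalSpace G] [ChartedSpace EG G] [Group G]
    [LieGroup 𝓘(ℝ, EG) ∞ G] (i : Fin (Module.finrank ℝ EG)) :
    Π b : G, TangentSpace 𝓘(ℝ, EG) b :=
  mulInvariantVectorField (Module.finBasis ℝ EG i : EG)

variable (EG) in
/-- The coordinate functions on `𝔤`. -/
abbrev lieCoord (i : Fin (Module.finrank ℝ EG)) : EG →L[ℝ] ℝ :=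
  LinearMap.toContinuousLinearMap ((Module.finBasis ℝ EG).coord i)

theorem leftTranslate_sum_coord (b : G) (X : EG) :
    leftTranslate b X = ∑ i, lieCoord EG i X • leftFrame G i b := by
  have h : X = ∑ i, lieCoord EG i X • Module.finBasis ℝ EG i :=
    ((Module.finBasis ℝ EG).sum_repr X).symm
  refine (congrArg (leftTranslate b) h).trans ?_
  exact (map_sum (leftTranslate (EG := EG) b) _ _).trans
    (Finset.sum_congr rfl fun i _ => map_smul (leftTranslate (EG := EG) b) _ _)

theorem leftField_eq_sum (c : G → EG) :
    leftField c = ∑ i, (fun b => lieCoord EG i (c b)) • leftFrame G i := by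
  funext b
  rw [Finset.sum_apply]
  exact leftTranslate_sum_coord b (c b)

theorem mdifferentiableAt_leftFrame (a : G) (i : Fin (Module.finrank ℝ EG)) :
    MDiffAt (T% (leftFrame (EG := EG) G i)) a := by
  have := lieGroup_minSmoothness EG G
  exact mdifferentiableAt_mulInvariantVectorField _

theorem mdifferentiableAt_lieCoord {c : G → EG} {a : G} (hc : MDiffAt c a)
    (i : Fin (Module.finrank ℝ EG)) : MDiffAt (fun b => lieCoord EG i (c b)) a :=
  (lieCoord EG i).differentiableAt.comp_mdifferentiableAt hc

theorem mdifferentiableAt_leftField {c : G → EG} {a : G} (hc : MDiffAt c a) :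
    MDiffAt (T% (leftField c)) a := by
  rw [leftField_eq_sum]
  have := MDifferentiableAt.sum_section (s := Finset.univ)
    (t := fun i => (fun b => lieCoord EG i (c b)) • leftFrame (EG := EG) G i) (x₀ := a)
    fun i _ => MDifferentiableAt.smul_section (mdifferentiableAt_lieCoord hc i)
      (mdifferentiableAt_leftFrame a i)
  convert this using 3
  exact Finset.sum_apply _ _ _

/-- The bracket is a first-order operator in its first argument, so it is determined by the brackets
of the left-invariant fields. -/
theorem mlieBracket_leftField_left {c : G → EG} {a : G} (hc : MDiffAt c a)
    (W : Π b : G, TangentSpace 𝓘(ℝ, EG) b) :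
    mlieBracket 𝓘(ℝ, EG) (leftField c) W a = -leftTranslate a (mvfderiv 𝓘(ℝ, EG) c a (W a)) +
      ∑ i, lieCoord EG i (c a) • mlieBracket 𝓘(ℝ, EG) (leftFrame G i) W a := by
  have hsum : ∀ s : Finset (Fin (Module.finrank ℝ EG)),
      MDiffAt (T% (∑ i ∈ s, (fun b => lieCoord EG i (c b)) • leftFrame (EG := EG) G i)) a ∧
      mlieBracket 𝓘(ℝ, EG) (∑ i ∈ s, (fun b => lieCoord EG i (c b)) • leftFrame G i) W a =
      ∑ i ∈ s, (-(lieCoord EG i (mvfderiv 𝓘(ℝ, EG) c a (W a)) • leftFrame G i a) +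
        lieCoord EG i (c a) • mlieBracket 𝓘(ℝ, EG) (leftFrame G i) W a) := by
    intro s
    induction s using Finset.induction_on with
    | empty =>
      simp only [Finset.sum_empty]
      refine ⟨mdifferentiableAt_zeroSection .., ?_⟩
      rw [mlieBracket_zero_left]; rfl
    | insert i s his ih =>
      have hi := MDifferentiableAt.smul_section (mdifferentiableAt_lieCoord hc i)
        (mdifferentiableAt_leftFrame a i)
      simp only [Finset.sum_insert his]
      refine ⟨mdifferentiableAt_add_section hi ih.1, ?_⟩
      rw [mlieBracket_add_left hi ih.1, ih.2,
        mlieBracket_smul_left (mdifferentiableAt_lieCoord hc i) (mdifferentiableAt_leftFrame a i)]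
      rw [mvfderiv_clm_apply (lieCoord EG i) hc, neg_smul]
  rw [leftField_eq_sum, (hsum _).2, Finset.sum_add_distrib, Finset.sum_neg_distrib,
    leftTranslate_sum_coord]

/-- The bracket of two vector fields on a Lie group in terms of their coordinate functions with
respect to left-invariant fields. -/
theorem mlieBracket_leftField {c d : G → EG} {a : G} (hc : MDiffAt c a) (hd : MDiffAt d a) :
    mlieBracket 𝓘(ℝ, EG) (leftField c) (leftField d) a =
      leftTranslate a (mvfderiv 𝓘(ℝ, EG) d a (leftField c a))
        - leftTranslate a (mvfderiv 𝓘(ℝ, EG) c a (leftField d a))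
        + leftTranslate a (lieBracketMap EG G (c a) (d a)) := by
  have := lieGroup_minSmoothness EG G
  have h1 : ∀ i, mlieBracket 𝓘(ℝ, EG) (leftFrame G i) (leftField d) a =
      leftTranslate a (mvfderiv 𝓘(ℝ, EG) d a (leftFrame G i a)) +
      ∑ j, lieCoord EG j (d a) • mlieBracket 𝓘(ℝ, EG) (leftFrame G i) (leftFrame G j) a := by
    intro i
    rw [mlieBracket_swap_apply, mlieBracket_leftField_left hd, neg_add, neg_neg,
      ← Finset.sum_neg_distrib]
    congr 1
    refine Finset.sum_congr rfl fun j _ => ?_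
    rw [← smul_neg, ← mlieBracket_swap_apply]
  have h2 : ∀ i j, mlieBracket 𝓘(ℝ, EG) (leftFrame G i) (leftFrame G j) a =
      leftTranslate a (lieBracketMap EG G (Module.finBasis ℝ EG i : EG)
        (Module.finBasis ℝ EG j : EG)) := by
    intro i j
    exact (congrFun (mulInvariantVector_mlieBracket (I := 𝓘(ℝ, EG)) (G := G)
      (Module.finBasis ℝ EG i : EG) (Module.finBasis ℝ EG j : EG)) a).symm
  let b := Module.finBasis ℝ EG
  have hexp : ∀ X : EG, X = ∑ i, lieCoord EG i X • b i := fun X => (b.sum_repr X).symm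
  have h3 : ∑ i, lieCoord EG i (c a) • leftTranslate a (mvfderiv 𝓘(ℝ, EG) d a (leftFrame G i a)) =
      leftTranslate a (mvfderiv 𝓘(ℝ, EG) d a (leftField c a)) := by
    have e : leftField c a = ∑ i, lieCoord EG i (c a) • leftFrame G i a :=
      leftTranslate_sum_coord a (c a)
    let L' : TangentSpace 𝓘(ℝ, EG) a →ₗ[ℝ] TangentSpace 𝓘(ℝ, EG) a :=
      ((leftTranslate (EG := EG) a).comp (mvfderiv 𝓘(ℝ, EG) d a)).toLinearMap
    change _ = L' (leftField c a)
    rw [e, map_sum]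
    exact Finset.sum_congr rfl fun i _ => (map_smul L' _ _).symm
  have h4 : ∑ i, lieCoord EG i (c a) • ∑ j, lieCoord EG j (d a) •
      mlieBracket 𝓘(ℝ, EG) (leftFrame G i) (leftFrame G j) a =
      leftTranslate a (lieBracketMap EG G (c a) (d a)) := by
    simp only [h2]
    let B : EG →ₗ[ℝ] EG →ₗ[ℝ] TangentSpace 𝓘(ℝ, EG) a :=
      (lieBracketMap EG G).compr₂ (leftTranslate (EG := EG) a).toLinearMap
    change ∑ i, lieCoord EG i (c a) • ∑ j, lieCoord EG j (d a) • B (b i) (b j) = B (c a) (d a)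
    conv_rhs => rw [hexp (c a), hexp (d a)]
    simp only [map_sum, map_smul, LinearMap.sum_apply, LinearMap.smul_apply]
    simp only [Finset.smul_sum]
    rw [Finset.sum_comm]
    exact Finset.sum_congr rfl fun i _ =>
      Finset.sum_congr rfl fun j _ => smul_comm _ _ _
  rw [mlieBracket_leftField_left hc]
  simp only [h1, smul_add, Finset.sum_add_distrib, h3, h4]
  abel

end LieGroup

/-! ### The derivative of the adjoint representation -/

section Adjoint

open VectorField

variable {EG : Type*} [NormedAddCommGroup EG] [NormedSpace ℝ EG] [FiniteDimensional ℝ EG]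
  {G : Type*} [TopologicalSpace G] [ChartedSpace EG G] [Group G] [LieGroup 𝓘(ℝ, EG) ∞ G]

variable (EG) in
/-- The function `b ↦ Ad(b⁻¹) Z` on `G`, with values in `𝔤`. -/
def adInv (G : Type*) [TopologicalSpace G] [ChartedSpace EG G] [Group G]
    [LieGroup 𝓘(ℝ, EG) ∞ G] (Z : EG) (b : G) : EG :=
  mfderiv 𝓘(ℝ, EG) 𝓘(ℝ, EG) (fun x : G => b⁻¹ * x * b) 1 Z

/-- The right-invariant vector field on `G` with value `Z` at `1`. -/
def rightField (G : Type*) [TopologicalSpace G] [ChartedSpace EG G] [Group G]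
    [LieGroup 𝓘(ℝ, EG) ∞ G] (Z : EG) (b : G) : TangentSpace 𝓘(ℝ, EG) b :=
  (mfderiv 𝓘(ℝ, EG) 𝓘(ℝ, EG) (fun x : G => x * b) 1 Z : EG)

theorem mdifferentiable_mul_left (a : G) :
    MDifferentiable 𝓘(ℝ, EG) 𝓘(ℝ, EG) (fun b : G => a * b) :=
  (contMDiff_mul_left (n := ∞)).mdifferentiable (by simp)

theorem mdifferentiable_mul_right (a : G) :
    MDifferentiable 𝓘(ℝ, EG) 𝓘(ℝ, EG) (fun b : G => b * a) :=
  (contMDiff_mul_right (n := ∞)).mdifferentiable (by simp)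

/-- Derivatives at equal points agree as maps between the model spaces. -/
theorem mfderiv_eq_of_eq {M : Type*} [TopologicalSpace M] [ChartedSpace EG M]
    {E : Type*} [NormedAddCommGroup E] [NormedSpace ℝ E]
    {N : Type*} [TopologicalSpace N] [ChartedSpace E N] (f : M → N) {x y : M} (h : x = y)
    (v : EG) : (mfderiv 𝓘(ℝ, EG) 𝓘(ℝ, E) f x v : E) = mfderiv 𝓘(ℝ, EG) 𝓘(ℝ, E) f y v := by
  subst h; rfl

theorem mdifferentiableAt_adInv (Z : EG) (a : G) : MDiffAt (adInv EG G Z) a := by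
  have hf : ContMDiff (𝓘(ℝ, EG).prod 𝓘(ℝ, EG)) 𝓘(ℝ, EG) ∞
      (Function.uncurry fun b x : G => b⁻¹ * x * b) :=
    (contMDiff_fst.inv.mul contMDiff_snd).mul contMDiff_fst
  have h := ContMDiffAt.mfderiv (m := 1) (n := ∞) (x₀ := a) (fun b x : G => b⁻¹ * x * b)
    (fun _ : G => (1 : G)) (hf _) contMDiffAt_const
    (by rw [one_add_one_eq_two]; exact ENat.LEInfty.out)
  -- `h` concerns `Ad(b⁻¹)` written in the trivializations at `1` and at `a⁻¹ * 1 * a`, which is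
  -- again the point `1`; composing with the constant maps `D` and `N` removes these coordinates
  let e := trivializationAt EG (TangentSpace 𝓘(ℝ, EG) : G → Type _)
  let D : EG →L[ℝ] EG := (e (1 : G)).continuousLinearMapAt ℝ (1 : G)
  let N : EG →L[ℝ] EG := (e (a⁻¹ * 1 * a)).symmL ℝ (1 : G)
  have hND : (e (1 : G)).symmL ℝ (1 : G) (D Z) = Z :=
    (e (1 : G)).symmL_continuousLinearMapAt (FiberBundle.mem_baseSet_trivializationAt' _) Z
  have hinv : ∀ y : G, y = 1 → ∀ w : EG,
      N ((e (a⁻¹ * 1 * a)).continuousLinearMapAt ℝ y w) = w := by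
    rintro y rfl w
    refine (e (a⁻¹ * 1 * a)).symmL_continuousLinearMapAt ?_ w
    have : a⁻¹ * 1 * a = 1 := by group
    rw [this]
    exact FiberBundle.mem_baseSet_trivializationAt' _
  have heq : adInv EG G Z = fun b => N (ContinuousLinearMap.inCoordinates EG
      (TangentSpace 𝓘(ℝ, EG)) EG (TangentSpace 𝓘(ℝ, EG)) 1 1 (a⁻¹ * 1 * a) (b⁻¹ * 1 * b)
      (mfderiv 𝓘(ℝ, EG) 𝓘(ℝ, EG) (fun x : G => b⁻¹ * x * b) 1) (D Z)) := by
    funext b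
    refine (hinv (b⁻¹ * 1 * b) (by group) _).symm.trans ?_
    refine congrArg N (congrArg _ ?_)
    exact congrArg (mfderiv 𝓘(ℝ, EG) 𝓘(ℝ, EG) (fun x : G => b⁻¹ * x * b) 1) hND.symm
  rw [heq]
  exact N.differentiableAt.comp_mdifferentiableAt
    ((h.mdifferentiableAt one_ne_zero).clm_apply mdifferentiableAt_const)

/-- `dR_b Z = dL_b (Ad(b⁻¹) Z)`. -/
theorem rightField_eq_leftField (Z : EG) : rightField G Z = leftField (adInv EG G Z) := by
  funext b
  have h0 : (fun x : G => x * b) = (fun x => b * x) ∘ fun x => b⁻¹ * x * b := by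
    funext x; simp [mul_assoc]
  have h1 := mfderiv_comp (I := 𝓘(ℝ, EG)) (I' := 𝓘(ℝ, EG)) (I'' := 𝓘(ℝ, EG)) (1 : G)
    (mdifferentiable_mul_left b (b⁻¹ * 1 * b))
    ((mdifferentiable_mul_right b (b⁻¹ * 1)).comp 1 (mdifferentiable_mul_left b⁻¹ 1))
  have h2 := mfderiv_eq_of_eq (EG := EG) (E := EG) (fun x : G => b * x)
    (show b⁻¹ * 1 * b = 1 by group) (adInv EG G Z b)
  refine Eq.trans ?_ h2
  refine Eq.trans ?_ (DFunLike.congr_fun h1 Z)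
  exact congrArg (fun f : G → G => (mfderiv 𝓘(ℝ, EG) 𝓘(ℝ, EG) f 1 : EG → EG) Z) h0

theorem mfderiv_mul_right_rightField (Z : EG) (a b : G) :
    (mfderiv 𝓘(ℝ, EG) 𝓘(ℝ, EG) (fun x : G => x * b) a (rightField G Z a) : EG) =
      rightField G Z (a * b) := by
  have h0 : (fun x : G => x * (a * b)) = (fun x => x * b) ∘ fun x => x * a := by
    funext x; simp [mul_assoc]
  have h1 := mfderiv_comp (I := 𝓘(ℝ, EG)) (I' := 𝓘(ℝ, EG)) (I'' := 𝓘(ℝ, EG)) (1 : G)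
    (mdifferentiable_mul_right b (1 * a)) (mdifferentiable_mul_right a 1)
  have h2 := mfderiv_eq_of_eq (EG := EG) (E := EG) (fun x : G => x * b) (one_mul a)
    (rightField G Z a)
  refine h2.symm.trans ?_
  refine (DFunLike.congr_fun h1 Z).symm.trans ?_
  exact congrArg (fun f : G → G => (mfderiv 𝓘(ℝ, EG) 𝓘(ℝ, EG) f 1 : EG → EG) Z) h0.symm

theorem mfderiv_mul_left_leftTranslate (X : EG) (a b : G) :
    (mfderiv 𝓘(ℝ, EG) 𝓘(ℝ, EG) (fun x : G => a * x) b (leftTranslate b X) : EG) =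
      leftTranslate (a * b) X := by
  have h0 : (fun x : G => (a * b) * x) = (fun x => a * x) ∘ fun x => b * x := by
    funext x; simp [mul_assoc]
  have h1 := mfderiv_comp (I := 𝓘(ℝ, EG)) (I' := 𝓘(ℝ, EG)) (I'' := 𝓘(ℝ, EG)) (1 : G)
    (mdifferentiable_mul_left a (b * 1)) (mdifferentiable_mul_left b 1)
  have h2 := mfderiv_eq_of_eq (EG := EG) (E := EG) (fun x : G => a * x) (mul_one b)
    (leftTranslate b X)
  refine h2.symm.trans ?_
  refine (DFunLike.congr_fun h1 X).symm.trans ?_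
  exact congrArg (fun f : G → G => (mfderiv 𝓘(ℝ, EG) 𝓘(ℝ, EG) f 1 : EG → EG) X) h0.symm

/-- Right-invariant and left-invariant vector fields commute: in a chart `ψ⁻¹` at `1`, they are
related by multiplication `(u, v) ↦ ψ(u) ψ(v)` to vector fields in the first and in the second
variable. -/
theorem mlieBracket_rightField_leftField (Z X : EG) :
    mlieBracket 𝓘(ℝ, EG) (rightField G Z) (leftField fun _ => X) (1 : G) = 0 := by
  have hR : ∀ a : G, MDiffAt (T% (rightField G Z)) a := fun a => by
    rw [rightField_eq_leftField]
    exact mdifferentiableAt_leftField (mdifferentiableAt_adInv Z a)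
  have hL : ∀ a : G, MDiffAt (T% (leftField (G := G) fun _ => X)) a := fun a =>
    mdifferentiableAt_leftField mdifferentiableAt_const
  obtain ⟨A, hA, hAV⟩ := exists_chart_related (hR 1)
  obtain ⟨B, hB, hBW⟩ := exists_chart_related (hL 1)
  have hψ := contMDiffAt_extChartAt_symm_self (E := EG) (1 : G)
  have hψx : (extChartAt 𝓘(ℝ, EG) (1 : G)).symm (extChartAt 𝓘(ℝ, EG) (1 : G) 1) = 1 :=
    extChartAt_to_inv (1 : G)
  generalize (extChartAt 𝓘(ℝ, EG) (1 : G)).symm = ψ at *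
  generalize extChartAt 𝓘(ℝ, EG) (1 : G) 1 = u at *
  have h2 : (2 : WithTop ℕ∞) ≤ ∞ := by exact_mod_cast ENat.LEInfty.out
  have hψ2 := hψ.of_le h2
  have hψd : ∀ᶠ y in nhds u, MDifferentiableAt 𝓘(ℝ, EG) 𝓘(ℝ, EG) ψ y :=
    (contMDiffAt_iff_contMDiffAt_nhds (by simp) |>.1 hψ2).mono
      fun y hy => hy.mdifferentiableAt two_ne_zero
  let f : EG × EG → G := fun p => ψ p.1 * ψ p.2
  have hf : ContMDiffAt 𝓘(ℝ, EG × EG) 𝓘(ℝ, EG) 2 f (u, u) := by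
    have : ContMDiffMul 𝓘(ℝ, EG) 2 G := ContMDiffMul.of_le (n := ∞) h2
    refine ContMDiffAt.mul ?_ ?_
    · exact hψ2.comp (u, u) (contDiffAt_fst.contMDiffAt)
    · exact hψ2.comp (u, u) (contDiffAt_snd.contMDiffAt)
  have hfd : ∀ᶠ p in nhds (u, u), MDifferentiableAt 𝓘(ℝ, EG × EG) 𝓘(ℝ, EG) f p :=
    (contMDiffAt_iff_contMDiffAt_nhds (by simp) |>.1 hf).mono
      fun y hy => hy.mdifferentiableAt two_ne_zero
  have hfst : Filter.Tendsto (Prod.fst : EG × EG → EG) (nhds (u, u)) (nhds u) :=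
    continuous_fst.tendsto (u, u)
  have hsnd : Filter.Tendsto (Prod.snd : EG × EG → EG) (nhds (u, u)) (nhds u) :=
    continuous_snd.tendsto (u, u)
  have hfu : f (u, u) = 1 := by simp [f, hψx]
  have key := mfderiv_lieBracket_of_related (E := EG) (V := fun p : EG × EG => (A p.1, 0))
    (W := fun p : EG × EG => (0, B p.2)) (V' := rightField G Z) (W' := leftField fun _ => X) hf
    ((DifferentiableAt.comp (u, u) hA differentiableAt_fst).prodMk (differentiableAt_const _))
    ((differentiableAt_const _).prodMk (DifferentiableAt.comp (u, u) hB differentiableAt_snd))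
    (hR _) (hL _) ?_ ?_
  · have h0 : lieBracket ℝ (fun p : EG × EG => (A p.1, (0 : EG))) (fun p => ((0 : EG), B p.2))
        (u, u) = 0 := by
      have e1 : HasFDerivAt (fun p : EG × EG => (A p.1, (0 : EG))) _ (u, u) :=
        (hA.hasFDerivAt.comp (u, u) hasFDerivAt_fst).prodMk (hasFDerivAt_const (0 : EG) _)
      have e2 : HasFDerivAt (fun p : EG × EG => ((0 : EG), B p.2)) _ (u, u) :=
        (hasFDerivAt_const (0 : EG) _).prodMk (hB.hasFDerivAt.comp (u, u) hasFDerivAt_snd)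
      rw [lieBracket, e1.fderiv, e2.fderiv]
      simp
    rw [h0, hfu] at key
    rw [← key]
    exact (mfderiv 𝓘(ℝ, EG × EG) 𝓘(ℝ, EG) f (u, u)).map_zero
  · filter_upwards [hfd, hfst.eventually hψd, hfst.eventually hAV] with p hp hp1 hpA
    have h1 := mfderiv_comp (I := 𝓘(ℝ, EG)) (I' := 𝓘(ℝ, EG × EG)) (I'' := 𝓘(ℝ, EG)) p.1
      (f := fun x => (x, p.2)) hp
      (differentiableAt_id.prodMk (differentiableAt_const _)).mdifferentiableAt
    have h2 := mfderiv_comp (I := 𝓘(ℝ, EG)) (I' := 𝓘(ℝ, EG)) (I'' := 𝓘(ℝ, EG)) p.1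
      (mdifferentiable_mul_right (ψ p.2) (ψ p.1)) hp1
    have e1 : HasFDerivAt (𝕜 := ℝ) (fun x : EG => (x, p.2)) _ p.1 :=
      (hasFDerivAt_id p.1).prodMk (hasFDerivAt_const p.2 p.1)
    rw [mfderiv_eq_fderiv, e1.fderiv] at h1
    have h3 := DFunLike.congr_fun h1 (A p.1)
    have h4 := DFunLike.congr_fun h2 (A p.1)
    refine h3.symm.trans (h4.trans ?_)
    refine Eq.trans ?_ (mfderiv_mul_right_rightField Z (ψ p.1) (ψ p.2))
    exact congrArg (mfderiv 𝓘(ℝ, EG) 𝓘(ℝ, EG) (fun x : G => x * ψ p.2) (ψ p.1)) hpA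
  · filter_upwards [hfd, hsnd.eventually hψd, hsnd.eventually hBW] with p hp hp1 hpA
    have h1 := mfderiv_comp (I := 𝓘(ℝ, EG)) (I' := 𝓘(ℝ, EG × EG)) (I'' := 𝓘(ℝ, EG)) p.2
      (f := fun x => (p.1, x)) hp
      ((differentiableAt_const _).prodMk differentiableAt_id).mdifferentiableAt
    have h2 := mfderiv_comp (I := 𝓘(ℝ, EG)) (I' := 𝓘(ℝ, EG)) (I'' := 𝓘(ℝ, EG)) p.2
      (mdifferentiable_mul_left (ψ p.1) (ψ p.2)) hp1
    have e1 : HasFDerivAt (𝕜 := ℝ) (fun x : EG => (p.1, x)) _ p.2 :=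
      (hasFDerivAt_const p.1 p.2).prodMk (hasFDerivAt_id p.2)
    rw [mfderiv_eq_fderiv, e1.fderiv] at h1
    have h3 := DFunLike.congr_fun h1 (B p.2)
    have h4 := DFunLike.congr_fun h2 (B p.2)
    refine h3.symm.trans (h4.trans ?_)
    refine Eq.trans ?_ (mfderiv_mul_left_leftTranslate X (ψ p.1) (ψ p.2))
    exact congrArg (mfderiv 𝓘(ℝ, EG) 𝓘(ℝ, EG) (fun x : G => ψ p.1 * x) (ψ p.2)) hpA

theorem leftTranslate_one (X : EG) : leftTranslate (1 : G) X = X := by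
  have : (fun b : G => 1 * b) = id := by funext b; simp
  change (mfderiv 𝓘(ℝ, EG) 𝓘(ℝ, EG) (fun b : G => 1 * b) 1 : EG → EG) X = X
  rw [this, mfderiv_id]
  rfl

theorem adInv_one (Z : EG) : adInv EG G Z 1 = Z := by
  have : (fun b : G => 1⁻¹ * b * 1) = id := by funext b; simp
  change (mfderiv 𝓘(ℝ, EG) 𝓘(ℝ, EG) (fun b : G => 1⁻¹ * b * 1) 1 : EG → EG) Z = Z
  rw [this, mfderiv_id]
  rfl

variable (EG G) in
/-- The Lie bracket of `𝔤` as a continuous bilinear map. -/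
def continuousBracket : EG →L[ℝ] EG →L[ℝ] EG :=
  let B : EG →ₗ[ℝ] EG →ₗ[ℝ] EG := lieBracketMap EG G
  LinearMap.toContinuousBilinearMap B

/-- The derivative of the adjoint representation is the bracket of `𝔤`. -/
theorem mvfderiv_adInv (Z X : EG) :
    mvfderiv 𝓘(ℝ, EG) (adInv EG G Z) 1 X = continuousBracket EG G Z X := by
  have h := mlieBracket_leftField (mdifferentiableAt_adInv Z (1 : G))
    (mdifferentiableAt_const (c := X))
  rw [← rightField_eq_leftField, mlieBracket_rightField_leftField, mvfderiv_const, adInv_one] at h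
  have h' : (0 : EG) = 0 - mvfderiv 𝓘(ℝ, EG) (adInv EG G Z) 1 (leftField (fun _ => X) 1) +
      continuousBracket EG G Z X := by
    refine h.trans ?_
    refine congrArg₂ (· + ·) (congrArg₂ (· - ·) ?_ ?_) ?_
    · exact map_zero _
    · exact leftTranslate_one _
    · exact leftTranslate_one _
  have h2 : leftField (fun _ => X) (1 : G) = X := leftTranslate_one X
  rw [h2, zero_sub] at h'
  exact (neg_add_eq_zero.1 h'.symm)

/-- The form of an `Ad`-invariant inner product as a continuous bilinear map. -/
def continuousForm (Q : AdInvariantInnerProduct EG G) : EG →L[ℝ] EG →L[ℝ] ℝ :=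
  let B : EG →ₗ[ℝ] EG →ₗ[ℝ] ℝ := Q.form
  LinearMap.toContinuousBilinearMap B

theorem continuousForm_adInv (Q : AdInvariantInnerProduct EG G) (Z W : EG) (b : G) :
    continuousForm Q (adInv EG G Z b) (adInv EG G W b) = continuousForm Q Z W := by
  have h0 : (fun x : G => b⁻¹ * x * b) = fun x => b⁻¹ * x * b⁻¹⁻¹ := by rw [inv_inv]
  have h : ∀ Z : EG, adInv EG G Z b =
      (mfderiv 𝓘(ℝ, EG) 𝓘(ℝ, EG) (fun x : G => b⁻¹ * x * b⁻¹⁻¹) 1 : EG → EG) Z := fun Z =>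
    congrArg (fun f : G → G => (mfderiv 𝓘(ℝ, EG) 𝓘(ℝ, EG) f 1 : EG → EG) Z) h0
  rw [h, h]
  exact Q.ad_invariant b⁻¹ Z W

/-- An `Ad`-invariant inner product is `ad`-invariant. -/
theorem continuousForm_continuousBracket (Q : AdInvariantInnerProduct EG G) (X Z W : EG) :
    continuousForm Q (continuousBracket EG G Z X) W +
      continuousForm Q Z (continuousBracket EG G W X) = 0 := by
  have h := mvfderiv_bilin (continuousForm Q) (mdifferentiableAt_adInv Z (1 : G))
    (mdifferentiableAt_adInv W (1 : G)) X
  have hc : (fun b : G => continuousForm Q (adInv EG G Z b) (adInv EG G W b)) =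
      fun _ => continuousForm Q Z W := funext fun b => continuousForm_adInv Q Z W b
  rw [hc, mvfderiv_const, mvfderiv_adInv, mvfderiv_adInv, adInv_one, adInv_one] at h
  exact h.symm

end Adjoint

/-! ### Equivariance under the isotropy group -/

section Equivariance

variable {EG : Type*} [NormedAddCommGroup EG] [NormedSpace ℝ EG] [FiniteDimensional ℝ EG]
  {G : Type*} [TopologicalSpace G] [ChartedSpace EG G] [Group G] [LieGroup 𝓘(ℝ, EG) ∞ G]

theorem mdifferentiable_conj (a : G) :
    MDifferentiable 𝓘(ℝ, EG) 𝓘(ℝ, EG) (fun x : G => a⁻¹ * x * a) :=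
  (mdifferentiable_mul_right a).comp (mdifferentiable_mul_left a⁻¹)

theorem adInv_adInv_inv (Z : EG) (b : G) : adInv EG G (adInv EG G Z b⁻¹) b = Z := by
  have h0 : (fun x : G => b⁻¹ * x * b) ∘ (fun x => b⁻¹⁻¹ * x * b⁻¹) = id := by
    funext x; simp [mul_assoc]
  have h1 := mfderiv_comp (I := 𝓘(ℝ, EG)) (I' := 𝓘(ℝ, EG)) (I'' := 𝓘(ℝ, EG)) (1 : G)
    (mdifferentiable_conj b (b⁻¹⁻¹ * 1 * b⁻¹)) (mdifferentiable_conj b⁻¹ 1)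
  rw [h0, mfderiv_id] at h1
  have h2 := mfderiv_eq_of_eq (EG := EG) (E := EG) (fun x : G => b⁻¹ * x * b)
    (show b⁻¹⁻¹ * 1 * b⁻¹ = 1 by group) (adInv EG G Z b⁻¹)
  exact h2.symm.trans (DFunLike.congr_fun h1 Z).symm

theorem leftTranslate_mul_adInv (X : EG) (a h : G) :
    (leftTranslate (EG := EG) (a * h) (adInv EG G X h) : EG) =
      mfderiv 𝓘(ℝ, EG) 𝓘(ℝ, EG) (fun x : G => x * h) a (leftTranslate a X) := by
  have h1 := mfderiv_comp (I := 𝓘(ℝ, EG)) (I' := 𝓘(ℝ, EG)) (I'' := 𝓘(ℝ, EG)) (1 : G)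
    (mdifferentiable_mul_left (a * h) (h⁻¹ * 1 * h)) (mdifferentiable_conj h 1)
  have h2 := mfderiv_comp (I := 𝓘(ℝ, EG)) (I' := 𝓘(ℝ, EG)) (I'' := 𝓘(ℝ, EG)) (1 : G)
    (mdifferentiable_mul_right h (a * 1)) (mdifferentiable_mul_left a 1)
  have h0 : (fun x : G => a * h * x) ∘ (fun x => h⁻¹ * x * h) =
      (fun x => x * h) ∘ fun x => a * x := by
    funext x; simp [mul_assoc]
  rw [h0] at h1
  have e1 := mfderiv_eq_of_eq (EG := EG) (E := EG) (fun x : G => a * h * x)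
    (show h⁻¹ * 1 * h = 1 by group) (adInv EG G X h)
  have e2 := mfderiv_eq_of_eq (EG := EG) (E := EG) (fun x : G => x * h)
    (mul_one a) (leftTranslate a X)
  refine e1.symm.trans (Eq.trans ?_ e2)
  exact (DFunLike.congr_fun h1 X).symm.trans (DFunLike.congr_fun h2 X)

variable {E : Type*} [NormedAddCommGroup E] [NormedSpace ℝ E] [FiniteDimensional ℝ E]
  {H : Subgroup G} [ChartedSpace E (G ⧸ H)] [IsManifold 𝓘(ℝ, E) ∞ (G ⧸ H)]
  [ContMDiffSMul 𝓘(ℝ, EG) 𝓘(ℝ, E) ∞ G (G ⧸ H)]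

variable (EG E H) in
theorem mdifferentiable_proj :
    MDifferentiable 𝓘(ℝ, EG) 𝓘(ℝ, E) (fun b : G => (b : G ⧸ H)) :=
  contMDiff_proj.mdifferentiable (by simp)

theorem coe_mul_of_mem (a : G) {h : G} (hh : h ∈ H) : ((a * h : G) : G ⧸ H) = a :=
  QuotientGroup.mk_mul_of_mem a hh

theorem projDeriv_mul_right (a : G) {h : G} (hh : h ∈ H) (w : EG) :
    (projDeriv EG E H (a * h)
      (mfderiv 𝓘(ℝ, EG) 𝓘(ℝ, EG) (fun x : G => x * h) a w : EG) : E) =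
      projDeriv EG E H a w := by
  have h1 := mfderiv_comp (I := 𝓘(ℝ, EG)) (I' := 𝓘(ℝ, EG)) (I'' := 𝓘(ℝ, E)) a
    (mdifferentiable_proj EG E H (a * h)) (mdifferentiable_mul_right h a)
  have h0 : (fun b : G => (b : G ⧸ H)) ∘ (fun x => x * h) = fun b : G => (b : G ⧸ H) :=
    funext fun x => coe_mul_of_mem x hh
  have h2 : (mfderiv 𝓘(ℝ, EG) 𝓘(ℝ, E) ((fun b : G => (b : G ⧸ H)) ∘ (fun x => x * h)) a :
      EG → E) w = (mfderiv 𝓘(ℝ, EG) 𝓘(ℝ, E) (fun b : G => (b : G ⧸ H)) a : EG → E) w := by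
    rw [h0]
  exact (DFunLike.congr_fun h1 w).symm.trans h2

/-- The map `𝔤 → T_{aH} (G ⧸ H)` changes by `Ad(h)` if `a` is replaced by `a * h`. -/
theorem lieToTangent_mul_adInv (X : EG) (a : G) {h : G} (hh : h ∈ H) :
    (lieToTangent EG E H (a * h) (adInv EG G X h) : E) = lieToTangent EG E H a X := by
  refine Eq.trans ?_ (projDeriv_mul_right (EG := EG) a hh (leftTranslate a X))
  exact congrArg (projDeriv EG E H (a * h)) (leftTranslate_mul_adInv X a h)

theorem mem_isotropyAlgebra_iff (a : G) (X : GroupLieAlgebra 𝓘(ℝ, EG) G) :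
    X ∈ isotropyAlgebra EG E H ↔ lieToTangent EG E H a X = 0 := by
  rw [lieToTangent_eq]
  have hb := smulDeriv_bijective EG (E := E) (H := H) a ((1 : G) : G ⧸ H)
  constructor
  · intro h
    have : projDeriv EG E H 1 X = 0 := h
    rw [this]
    exact map_zero _
  · intro h
    exact hb.1 (h.trans (map_zero _).symm)

theorem adInv_mem_isotropyAlgebra {X : EG} (hX : X ∈ isotropyAlgebra EG E H) {h : G}
    (hh : h ∈ H) : adInv EG G X h ∈ isotropyAlgebra EG E H := by
  refine (mem_isotropyAlgebra_iff (1 * h) _).2 ?_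
  exact (lieToTangent_mul_adInv X 1 hh).trans ((mem_isotropyAlgebra_iff 1 X).1 hX)

theorem adInv_mem_reductiveComplement (Q : AdInvariantInnerProduct EG G) {X : EG}
    (hX : X ∈ reductiveComplement E H Q) {h : G} (hh : h ∈ H) :
    adInv EG G X h ∈ reductiveComplement E H Q := by
  intro Y hY
  have h1 := hX (adInv EG G Y h⁻¹) (adInv_mem_isotropyAlgebra (EG := EG) hY (H.inv_mem hh))
  have h2 := continuousForm_adInv Q (adInv EG G Y h⁻¹) X h
  have h3 : adInv EG G (adInv EG G Y h⁻¹) h = Y := adInv_adInv_inv (EG := EG) Y h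
  exact (congrArg (fun W : EG => continuousForm Q W (adInv EG G X h)) h3.symm).trans (h2.trans h1)

/-- The element of `𝔪` which represents a tangent vector at `aH`. -/
def lieLift (Q : AdInvariantInnerProduct EG G) (a : G)
    (u : TangentSpace 𝓘(ℝ, E) (a : G ⧸ H)) : EG :=
  ((horizontalFrame E H Q a).inverse u).1

variable (Q : AdInvariantInnerProduct EG G)

theorem lieLift_mem (a : G) (u : TangentSpace 𝓘(ℝ, E) (a : G ⧸ H)) :
    lieLift Q a u ∈ reductiveComplement E H Q :=
  ((horizontalFrame E H Q a).inverse u).2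

theorem lieToTangent_lieLift (hπ : Function.Surjective (projDeriv EG E H (1 : G))) (a : G)
    (u : TangentSpace 𝓘(ℝ, E) (a : G ⧸ H)) :
    lieToTangent EG E H a (lieLift (EG := EG) Q a u) = u := by
  obtain ⟨A, hA⟩ := horizontalFrame_isInvertible (E := E) (H := H) Q hπ a
  change horizontalFrame E H Q a ((horizontalFrame E H Q a).inverse u) = u
  rw [← hA]
  simp

theorem eq_of_lieToTangent_eq {a : G} {X Y : EG} (hX : X ∈ reductiveComplement E H Q)
    (hY : Y ∈ reductiveComplement E H Q)
    (h : lieToTangent EG E H a X = lieToTangent EG E H a Y) : X = Y := by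
  have h1 : X - Y ∈ isotropyAlgebra EG E H := by
    refine (mem_isotropyAlgebra_iff a _).2 ?_
    exact (map_sub (lieToTangent EG E H a) X Y).trans (sub_eq_zero.2 h)
  have h2 : X - Y ∈ reductiveComplement E H Q := Submodule.sub_mem _ hX hY
  exact sub_eq_zero.1
    (Submodule.disjoint_def.1 (isCompl_reductiveComplement Q).disjoint (X - Y) h2 h1)

theorem lieLift_lieToTangent (hπ : Function.Surjective (projDeriv EG E H (1 : G))) {a : G}
    {X : EG} (hX : X ∈ reductiveComplement E H Q) :
    lieLift Q a (lieToTangent EG E H a X) = X :=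
  eq_of_lieToTangent_eq Q (lieLift_mem Q a _) hX (lieToTangent_lieLift Q hπ a _)

theorem lieLift_mul (hπ : Function.Surjective (projDeriv EG E H (1 : G))) (a : G) {h : G}
    (hh : h ∈ H) (u : E) :
    lieLift (E := E) (H := H) Q (a * h) u = adInv EG G (lieLift (E := E) (H := H) Q a u) h := by
  refine eq_of_lieToTangent_eq Q (lieLift_mem Q _ _)
    (adInv_mem_reductiveComplement Q (lieLift_mem Q a _) hh) (a := a * h) ?_
  refine (lieToTangent_lieLift Q hπ _ _).trans ?_
  refine Eq.trans ?_ (lieToTangent_mul_adInv _ a hh).symm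
  exact (lieToTangent_lieLift Q hπ a u).symm

/-- The function `Ŷ` is `H`-equivariant. -/
theorem horizontalCoord_mul (hπ : Function.Surjective (projDeriv EG E H (1 : G)))
    (Y : Π x : G ⧸ H, TangentSpace 𝓘(ℝ, E) x) (a : G) {h : G} (hh : h ∈ H) :
    horizontalCoord Q Y (a * h) = adInv EG G (horizontalCoord Q Y a) h := by
  have hY : ∀ x y : G ⧸ H, x = y → (Y x : E) = Y y := by rintro x _ rfl; rfl
  refine Eq.trans ?_ (lieLift_mul Q hπ a hh (Y a))
  exact congrArg (lieLift (E := E) (H := H) Q (a * h)) (hY _ _ (coe_mul_of_mem a hh))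

variable (G) in
/-- `Ad(h⁻¹)` as a continuous linear map. -/
def adInvCLM (h : G) : EG →L[ℝ] EG := mfderiv 𝓘(ℝ, EG) 𝓘(ℝ, EG) (fun x : G => h⁻¹ * x * h) 1

theorem mdifferentiableAt_horizontalCoord_mul
    (hπ : Function.Surjective (projDeriv EG E H (1 : G)))
    {Y : Π x : G ⧸ H, TangentSpace 𝓘(ℝ, E) x} {a : G} {h : G} (hh : h ∈ H)
    (hY : MDiffAt (horizontalCoord Q Y) a) : MDiffAt (horizontalCoord Q Y) (a * h) := by
  have h0 : horizontalCoord Q Y = fun b => adInvCLM G h (horizontalCoord Q Y (b * h⁻¹)) := by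
    funext b
    conv_lhs => rw [show b = b * h⁻¹ * h by group]
    exact horizontalCoord_mul Q hπ Y (b * h⁻¹) hh
  rw [h0]
  refine (adInvCLM (EG := EG) G h).differentiableAt.comp_mdifferentiableAt ?_
  have hY' : MDiffAt (horizontalCoord Q Y) (a * h * h⁻¹) := by
    rwa [mul_inv_cancel_right]
  exact MDifferentiableAt.comp (I' := 𝓘(ℝ, EG)) (a * h) (f := fun b => b * h⁻¹) hY'
    (mdifferentiable_mul_right h⁻¹ (a * h))

/-- The covariant derivative at `aH` does not depend on the representative `a`. -/
theorem reductiveDeriv_mul (hπ : Function.Surjective (projDeriv EG E H (1 : G)))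
    {Y : Π x : G ⧸ H, TangentSpace 𝓘(ℝ, E) x} {a : G} {h : G} (hh : h ∈ H)
    (hY : MDiffAt (horizontalCoord Q Y) a) (u : E) :
    (reductiveDeriv Q Y (a * h) u : E) = reductiveDeriv Q Y a u := by
  have hY' := mdifferentiableAt_horizontalCoord_mul Q hπ hh hY
  have h1 := mvfderiv_clm_apply (adInvCLM (EG := EG) G h) hY
    (leftTranslate a (lieLift (EG := EG) (E := E) (H := H) Q a u))
  have h2 : (fun b => adInvCLM (EG := EG) G h (horizontalCoord Q Y b)) =
      horizontalCoord Q Y ∘ fun b => b * h :=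
    funext fun b => (horizontalCoord_mul Q hπ Y b hh).symm
  have h3 := mfderiv_comp (I := 𝓘(ℝ, EG)) (I' := 𝓘(ℝ, EG)) (I'' := 𝓘(ℝ, EG)) a hY'
    (mdifferentiable_mul_right h a)
  rw [h2] at h1
  have h4 := (DFunLike.congr_fun h3
    (leftTranslate a (lieLift (EG := EG) (E := E) (H := H) Q a u))).symm.trans h1
  refine Eq.trans ?_ (lieToTangent_mul_adInv (E := E) (H := H) _ a hh)
  refine congrArg (lieToTangent EG E H (a * h)) (Eq.trans ?_ h4)
  refine congrArg (mfderiv 𝓘(ℝ, EG) 𝓘(ℝ, EG) (horizontalCoord Q Y) (a * h)) ?_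
  refine Eq.trans ?_ (leftTranslate_mul_adInv _ a h)
  exact congrArg (leftTranslate (EG := EG) (a * h)) (lieLift_mul Q hπ a hh u)

theorem reductiveConnection_apply (hπ : Function.Surjective (projDeriv EG E H (1 : G)))
    {Y : Π x : G ⧸ H, TangentSpace 𝓘(ℝ, E) x} {a : G}
    (hY : MDiffAt (horizontalCoord Q Y) a) :
    reductiveConnection Q hπ Y (a : G ⧸ H) = reductiveDeriv Q Y a := by
  -- the connection is defined by a chosen representative of the coset, and a transport to `aH`
  have hcast : ∀ (x y : G ⧸ H) (e : x = y) (D : TangentSpace 𝓘(ℝ, E) x →L[ℝ]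
      TangentSpace 𝓘(ℝ, E) x) (u : E), (((e ▸ D : TangentSpace 𝓘(ℝ, E) y →L[ℝ]
      TangentSpace 𝓘(ℝ, E) y) : E → E) u) = (D : E → E) u := by
    rintro x _ rfl D u; rfl
  ext u
  refine (hcast _ (a : G ⧸ H) (Quotient.out_eq' (a : G ⧸ H))
    (reductiveDeriv Q Y (Quotient.out (a : G ⧸ H))) u).trans ?_
  have hout : ((Quotient.out (a : G ⧸ H) : G) : G ⧸ H) = a := Quotient.out_eq' _
  generalize Quotient.out (a : G ⧸ H) = b at hout ⊢
  have hmem : a⁻¹ * b ∈ H := QuotientGroup.eq.1 hout.symm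
  have hb : b = a * (a⁻¹ * b) := by group
  generalize a⁻¹ * b = h at hmem hb
  subst hb
  exact reductiveDeriv_mul Q hπ hmem hY u

end Equivariance

/-! ### Local sections of the projection -/

section LocalSection

variable {EG : Type*} [NormedAddCommGroup EG] [NormedSpace ℝ EG] [FiniteDimensional ℝ EG]
  {G : Type*} [TopologicalSpace G] [ChartedSpace EG G] [Group G] [LieGroup 𝓘(ℝ, EG) ∞ G]
  {E : Type*} [NormedAddCommGroup E] [NormedSpace ℝ E] [FiniteDimensional ℝ E]
  {H : Subgroup G} [ChartedSpace E (G ⧸ H)] [IsManifold 𝓘(ℝ, E) ∞ (G ⧸ H)]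
  [ContMDiffSMul 𝓘(ℝ, EG) 𝓘(ℝ, E) ∞ G (G ⧸ H)]

/-- A map between vector spaces which is strictly differentiable with surjective derivative has a
differentiable local right inverse. -/
theorem exists_local_rightInverse {F : EG → E} {F' : EG →L[ℝ] E} {u : EG}
    (hF : HasStrictFDerivAt F F' u) (hF' : Function.Surjective F') :
    ∃ s : E → EG, DifferentiableAt ℝ s (F u) ∧ s (F u) = u ∧ ∀ᶠ y in nhds (F u), F (s y) = y := by
  obtain ⟨K, hK⟩ := F'.toLinearMap.exists_rightInverse_of_surjective (LinearMap.range_eq_top.2 hF')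
  let K' : E →L[ℝ] EG := LinearMap.toContinuousLinearMap K
  have hp : HasStrictFDerivAt (fun w : E => u + K' w) K' 0 := K'.hasStrictFDerivAt.const_add u
  have hF0 : HasStrictFDerivAt F F' (u + K' 0) := by simpa using hF
  have hP : HasStrictFDerivAt (fun w : E => F (u + K' w))
      ((ContinuousLinearEquiv.refl ℝ E : E ≃L[ℝ] E) : E →L[ℝ] E) 0 := by
    have h := HasStrictFDerivAt.comp (0 : E) hF0 hp
    have e : F'.comp K' = ((ContinuousLinearEquiv.refl ℝ E : E ≃L[ℝ] E) : E →L[ℝ] E) := by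
      ext w
      exact LinearMap.congr_fun hK w
    rwa [e] at h
  have h0 : F (u + K' 0) = F u := by simp
  have h1 := hP.to_localInverse
  have h2 := hP.eventually_right_inverse
  have h3 : hP.localInverse _ _ 0 (F (u + K' 0)) = 0 := hP.localInverse_apply_image
  generalize hP.localInverse _ _ 0 = s at h1 h2 h3
  simp only [h0] at h1 h2 h3
  refine ⟨fun y => u + K' (s y), ?_, ?_, h2⟩
  · exact (K'.differentiableAt.comp _ h1.hasFDerivAt.differentiableAt).const_add u
  · simp [h3]

theorem projDeriv_surjective (Q : AdInvariantInnerProduct EG G)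
    (hπ : Function.Surjective (projDeriv EG E H (1 : G))) (a : G) :
    Function.Surjective (projDeriv EG E H a) := fun u =>
  ⟨leftTranslate a (lieLift (EG := EG) Q a u), lieToTangent_lieLift Q hπ a u⟩

/-- The projection `G → G ⧸ H` has local sections. The inner product only serves to split its
derivative. -/
theorem exists_local_section (Q : AdInvariantInnerProduct EG G)
    (hπ : Function.Surjective (projDeriv EG E H (1 : G))) (a : G) :
    ∃ σ : G ⧸ H → G, MDifferentiableAt 𝓘(ℝ, E) 𝓘(ℝ, EG) σ (a : G ⧸ H) ∧ σ (a : G ⧸ H) = a ∧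
      ∀ᶠ x in nhds (a : G ⧸ H), ((σ x : G) : G ⧸ H) = x := by
  have hψ := contMDiffAt_extChartAt_symm_self (E := EG) a
  have hψa : (extChartAt 𝓘(ℝ, EG) a).symm (extChartAt 𝓘(ℝ, EG) a a) = a := extChartAt_to_inv a
  have hψi : (mfderiv 𝓘(ℝ, EG) 𝓘(ℝ, EG) (extChartAt 𝓘(ℝ, EG) a).symm
      (extChartAt 𝓘(ℝ, EG) a a)).IsInvertible := by
    have := isInvertible_mfderivWithin_extChartAt_symm (I := 𝓘(ℝ, EG))
      (mem_extChartAt_target (I := 𝓘(ℝ, EG)) a)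
    simpa only [modelWithCornersSelf_coe, Set.range_id, mfderivWithin_univ] using this
  have hφ : ContMDiffAt 𝓘(ℝ, E) 𝓘(ℝ, E) ∞ (extChartAt 𝓘(ℝ, E) (a : G ⧸ H)) (a : G ⧸ H) :=
    contMDiffAt_extChartAt
  have hφi := isInvertible_mfderiv_extChartAt (I := 𝓘(ℝ, E))
    (mem_extChartAt_source (I := 𝓘(ℝ, E)) (a : G ⧸ H))
  have hinj := (extChartAt 𝓘(ℝ, E) (a : G ⧸ H)).injOn
  have hsrc := extChartAt_source_mem_nhds (I := 𝓘(ℝ, E)) (a : G ⧸ H)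
  generalize (extChartAt 𝓘(ℝ, EG) a).symm = ψ at *
  generalize extChartAt 𝓘(ℝ, EG) a a = u at *
  generalize extChartAt 𝓘(ℝ, E) (a : G ⧸ H) = φ at *
  subst hψa
  -- the projection, written in charts
  let F : EG → E := fun w => φ ((ψ w : G) : G ⧸ H)
  have hpc : ContMDiffAt 𝓘(ℝ, EG) 𝓘(ℝ, E) ∞ (fun w => ((ψ w : G) : G ⧸ H)) u :=
    (contMDiff_proj (EG := EG) (E := E) (H := H)).contMDiffAt.comp u hψ
  have hFc : ContMDiffAt 𝓘(ℝ, EG) 𝓘(ℝ, E) ∞ F u := ContMDiffAt.comp u hφ hpc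
  have hF := hFc.contDiffAt.hasStrictFDerivAt (by simp)
  have hF' : Function.Surjective (fderiv ℝ F u) := by
    have h1 := mfderiv_comp (I := 𝓘(ℝ, EG)) (I' := 𝓘(ℝ, E)) (I'' := 𝓘(ℝ, E)) u
      (hφ.mdifferentiableAt (by simp)) (hpc.mdifferentiableAt (by simp))
    have h2 := mfderiv_comp (I := 𝓘(ℝ, EG)) (I' := 𝓘(ℝ, EG)) (I'' := 𝓘(ℝ, E)) u
      (mdifferentiable_proj EG E H (ψ u)) (hψ.mdifferentiableAt (by simp))
    intro w
    obtain ⟨A, hA⟩ := hφi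
    obtain ⟨B, hB⟩ := hψi
    obtain ⟨v, hv⟩ := projDeriv_surjective Q hπ (ψ u) (A.symm w)
    refine ⟨B.symm v, ?_⟩
    have h3 : mfderiv 𝓘(ℝ, EG) 𝓘(ℝ, E) F u (B.symm v) = w := by
      refine (DFunLike.congr_fun h1 _).trans ?_
      have h4 : mfderiv 𝓘(ℝ, EG) 𝓘(ℝ, E) (fun w => ((ψ w : G) : G ⧸ H)) u (B.symm v) =
          A.symm w := by
        refine (DFunLike.congr_fun h2 _).trans (Eq.trans ?_ hv)
        refine congrArg (projDeriv EG E H (ψ u)) ?_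
        rw [← hB]
        exact B.apply_symm_apply v
      refine (congrArg (mfderiv 𝓘(ℝ, E) 𝓘(ℝ, E) φ ((ψ u : G) : G ⧸ H)) h4).trans ?_
      rw [← hA]
      exact A.apply_symm_apply w
    rw [mfderiv_eq_fderiv] at h3
    exact h3
  obtain ⟨s, hs, hsu, hsF⟩ := exists_local_rightInverse hF hF'
  have hsφ : MDifferentiableAt 𝓘(ℝ, E) 𝓘(ℝ, EG) (fun x => s (φ x)) ((ψ u : G) : G ⧸ H) :=
    DifferentiableAt.comp_mdifferentiableAt hs (hφ.mdifferentiableAt (by simp))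
  have hψs : MDifferentiableAt 𝓘(ℝ, EG) 𝓘(ℝ, EG) ψ (s (φ ((ψ u : G) : G ⧸ H))) := by
    have : s (φ ((ψ u : G) : G ⧸ H)) = u := hsu
    rw [this]
    exact hψ.mdifferentiableAt (by simp)
  have hσ : MDifferentiableAt 𝓘(ℝ, E) 𝓘(ℝ, EG) (fun x => ψ (s (φ x))) ((ψ u : G) : G ⧸ H) :=
    MDifferentiableAt.comp _ hψs hsφ
  have hσa : ψ (s (φ ((ψ u : G) : G ⧸ H))) = ψ u := congrArg ψ hsu
  refine ⟨fun x => ψ (s (φ x)), hσ, hσa, ?_⟩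
  have hc : Filter.Tendsto (fun x => ((ψ (s (φ x)) : G) : G ⧸ H)) (nhds ((ψ u : G) : G ⧸ H))
      (nhds ((ψ u : G) : G ⧸ H)) := by
    have h1 : ContinuousAt (fun x => ((ψ (s (φ x)) : G) : G ⧸ H)) ((ψ u : G) : G ⧸ H) :=
      (mdifferentiable_proj EG E H).continuous.continuousAt.comp hσ.continuousAt
    have h2 := h1.tendsto
    rwa [hσa] at h2
  filter_upwards [hφ.continuousAt.eventually hsF, hsrc, hc.eventually hsrc] with x hx1 hx2 hx3
  exact hinj hx3 hx2 hx1

variable (Q : AdInvariantInnerProduct EG G)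

/-- A vector field on `G ⧸ H` is differentiable if its coordinate function on `G` is. -/
theorem mdifferentiableAt_of_horizontalCoord
    (hπ : Function.Surjective (projDeriv EG E H (1 : G)))
    {W : Π x : G ⧸ H, TangentSpace 𝓘(ℝ, E) x} {a : G}
    (hW : MDiffAt (horizontalCoord Q W) a) : MDiffAt (T% W) (a : G ⧸ H) := by
  obtain ⟨σ, hσ, hσa, hσπ⟩ := exists_local_section Q hπ a
  -- `W`, pulled back to `G`, is the image of the horizontal lift of `W` under the projection
  let Λ : G → TangentBundle 𝓘(ℝ, E) (G ⧸ H) := fun b => ⟨(b : G ⧸ H), W b⟩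
  have hΛ : MDifferentiableAt 𝓘(ℝ, EG) 𝓘(ℝ, E).tangent Λ a := by
    have h1 : MDifferentiable 𝓘(ℝ, EG).tangent 𝓘(ℝ, E).tangent
        (tangentMap 𝓘(ℝ, EG) 𝓘(ℝ, E) (fun b : G => (b : G ⧸ H))) :=
      ((contMDiff_proj (EG := EG) (E := E) (H := H)).contMDiff_tangentMap (m := 1)
        (by rw [one_add_one_eq_two]; exact ENat.LEInfty.out)).mdifferentiable one_ne_zero
    have h2 : Λ = tangentMap 𝓘(ℝ, EG) 𝓘(ℝ, E) (fun b : G => (b : G ⧸ H)) ∘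
        (T% (leftField (horizontalCoord Q W))) := by
      funext b
      exact congrArg (fun v : TangentSpace 𝓘(ℝ, E) (b : G ⧸ H) =>
        (⟨(b : G ⧸ H), v⟩ : TangentBundle 𝓘(ℝ, E) (G ⧸ H)))
        (lieToTangent_horizontalCoord Q hπ W b).symm
    rw [h2]
    exact (h1 _).comp a (mdifferentiableAt_leftField hW)
  have h3 : MDifferentiableAt 𝓘(ℝ, E) 𝓘(ℝ, E).tangent (Λ ∘ σ) (a : G ⧸ H) := by
    refine MDifferentiableAt.comp (a : G ⧸ H) ?_ hσ
    rwa [hσa]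
  refine h3.congr_of_eventuallyEq ?_
  filter_upwards [hσπ] with x hx
  have : ∀ y : G ⧸ H, y = x → (⟨x, W x⟩ : TangentBundle 𝓘(ℝ, E) (G ⧸ H)) = ⟨y, W y⟩ := by
    rintro _ rfl; rfl
  exact this _ hx

/-- A function on `G ⧸ H` is differentiable if its lift to `G` is. -/
theorem mdifferentiableAt_of_comp_proj {F : Type*} [NormedAddCommGroup F] [NormedSpace ℝ F]
    (Q : AdInvariantInnerProduct EG G) (hπ : Function.Surjective (projDeriv EG E H (1 : G)))
    {f : G ⧸ H → F} {a : G}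
    (hf : MDifferentiableAt 𝓘(ℝ, EG) 𝓘(ℝ, F) (fun b : G => f b) a) :
    MDifferentiableAt 𝓘(ℝ, E) 𝓘(ℝ, F) f (a : G ⧸ H) := by
  obtain ⟨σ, hσ, hσa, hσπ⟩ := exists_local_section Q hπ a
  have h3 : MDifferentiableAt 𝓘(ℝ, E) 𝓘(ℝ, F) ((fun b : G => f b) ∘ σ) (a : G ⧸ H) := by
    refine MDifferentiableAt.comp (a : G ⧸ H) ?_ hσ
    rwa [hσa]
  refine h3.congr_of_eventuallyEq ?_
  filter_upwards [hσπ] with x hx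
  exact congrArg f hx.symm

end LocalSection

/-! ### The canonical reductive connection -/

section ReductiveGeometry

open VectorField

variable {EG : Type*} [NormedAddCommGroup EG] [NormedSpace ℝ EG] [FiniteDimensional ℝ EG]
  {G : Type*} [TopologicalSpace G] [ChartedSpace EG G] [Group G] [LieGroup 𝓘(ℝ, EG) ∞ G]
  {E : Type*} [NormedAddCommGroup E] [NormedSpace ℝ E] [FiniteDimensional ℝ E]
  {H : Subgroup G} [ChartedSpace E (G ⧸ H)] [IsManifold 𝓘(ℝ, E) ∞ (G ⧸ H)]
  [ContMDiffSMul 𝓘(ℝ, EG) 𝓘(ℝ, E) ∞ G (G ⧸ H)]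
  (Q : AdInvariantInnerProduct EG G)

variable (E H) in
/-- The projection of `𝔤 = 𝔪 ⊕ 𝔥` onto `𝔪`. -/
def complProj : EG →L[ℝ] EG :=
  let P : EG →ₗ[ℝ] EG := (reductiveComplement E H Q).subtype ∘ₗ
    Submodule.projectionOnto _ _ (isCompl_reductiveComplement (E := E) (H := H) Q)
  LinearMap.toContinuousLinearMap P

theorem complProj_mem (X : EG) : complProj E H Q X ∈ reductiveComplement E H Q :=
  (Submodule.projectionOnto _ _ (isCompl_reductiveComplement (E := E) (H := H) Q) X).2

theorem complProj_of_mem {X : EG} (hX : X ∈ reductiveComplement E H Q) :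
    complProj E H Q X = X :=
  congrArg Subtype.val (Submodule.projectionOnto_apply_left
    (isCompl_reductiveComplement (E := E) (H := H) Q) ⟨X, hX⟩)

theorem sub_complProj_mem (X : EG) : X - complProj E H Q X ∈ isotropyAlgebra EG E H := by
  have h := isCompl_reductiveComplement (E := E) (H := H) Q
  have h1 : Submodule.projectionOnto _ _ h (X - complProj E H Q X) = 0 := by
    refine Subtype.ext ?_
    change complProj E H Q (X - complProj E H Q X) = 0
    rw [map_sub, complProj_of_mem Q (complProj_mem Q X), sub_self]
  exact (Submodule.projectionOnto_apply_eq_zero_iff h).1 h1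

theorem lieToTangent_complProj (a : G) (X : EG) :
    lieToTangent EG E H a (complProj E H Q X) = lieToTangent EG E H a X := by
  have h := (mem_isotropyAlgebra_iff a _).1 (sub_complProj_mem (E := E) (H := H) Q X)
  exact (sub_eq_zero.1 ((map_sub (lieToTangent EG E H a) X (complProj E H Q X)).symm.trans h)).symm

theorem continuousForm_complProj (X : EG) {Z : EG} (hZ : Z ∈ reductiveComplement E H Q) :
    continuousForm Q (complProj E H Q X) Z = continuousForm Q X Z := by
  have h : continuousForm Q (X - complProj E H Q X) Z = 0 :=
    hZ _ (sub_complProj_mem (E := E) (H := H) Q X)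
  rw [map_sub, _root_.sub_apply, sub_eq_zero] at h
  exact h.symm

theorem continuousForm_neg_left (X Y : EG) :
    continuousForm Q (-X) Y = -continuousForm Q X Y := by
  rw [(continuousForm Q).map_neg, _root_.neg_apply]

theorem continuousForm_symm (X Y : EG) : continuousForm Q X Y = continuousForm Q Y X := Q.symm X Y

variable (EG G) in
theorem continuousBracket_antisymm (X Y : EG) :
    continuousBracket EG G X Y = -continuousBracket EG G Y X := by
  have := lieGroup_minSmoothness EG G
  let X' : GroupLieAlgebra 𝓘(ℝ, EG) G := X
  let Y' : GroupLieAlgebra 𝓘(ℝ, EG) G := Y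
  have h : ⁅X', Y'⁆ = -⁅Y', X'⁆ := (lie_skew X' Y').symm
  exact h

/-- The derivative of a function with values in the subspace `𝔪` has values in `𝔪`. -/
theorem mvfderiv_horizontalCoord_mem
    {Y : Π x : G ⧸ H, TangentSpace 𝓘(ℝ, E) x} {a : G} (hY : MDiffAt (horizontalCoord Q Y) a)
    (w : TangentSpace 𝓘(ℝ, EG) a) :
    mvfderiv 𝓘(ℝ, EG) (horizontalCoord Q Y) a w ∈ reductiveComplement E H Q := by
  have h := mvfderiv_clm_apply (complProj E H Q) hY w
  have h0 : (fun b => complProj E H Q (horizontalCoord Q Y b)) = horizontalCoord Q Y :=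
    funext fun b => complProj_of_mem Q (lieLift_mem Q b (Y b))
  rw [h0] at h
  have h1 := complProj_mem (E := E) (H := H) Q (mvfderiv 𝓘(ℝ, EG) (horizontalCoord Q Y) a w)
  rwa [← h] at h1

theorem reductiveConnection_apply_apply (hπ : Function.Surjective (projDeriv EG E H (1 : G)))
    {Y : Π x : G ⧸ H, TangentSpace 𝓘(ℝ, E) x} {a : G} (hY : MDiffAt (horizontalCoord Q Y) a)
    (u : TangentSpace 𝓘(ℝ, E) (a : G ⧸ H)) :
    reductiveConnection Q hπ Y (a : G ⧸ H) u = lieToTangent EG E H a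
      (mvfderiv 𝓘(ℝ, EG) (horizontalCoord Q Y) a
        (leftTranslate a (lieLift (EG := EG) Q a u))) := by
  rw [reductiveConnection_apply Q hπ hY]
  rfl

/-- The torsion of the canonical reductive connection at `aH` is `-[X, Y]_𝔪`. -/
theorem torsion_reductiveConnection [T2Space (G ⧸ H)]
    (hπ : Function.Surjective (projDeriv EG E H (1 : G))) (a : G)
    (u v : TangentSpace 𝓘(ℝ, E) (a : G ⧸ H)) :
    (reductiveConnection Q hπ).torsion (a : G ⧸ H) u v =
      -lieToTangent EG E H a (continuousBracket EG G (lieLift (EG := EG) Q a u)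
        (lieLift (EG := EG) Q a v)) := by
  obtain ⟨Y, hY, rfl⟩ := exists_section_extending (a : G ⧸ H) u
  obtain ⟨Z, hZ, rfl⟩ := exists_section_extending (a : G ⧸ H) v
  have hY' := horizontalCoord_mdifferentiableAt Q hπ hY
  have hZ' := horizontalCoord_mdifferentiableAt Q hπ hZ
  rw [(reductiveConnection Q hπ).torsion_apply hY hZ]
  -- the horizontal lift of `Y` is related to `Y` by the projection
  have hrel : ∀ Y : Π x : G ⧸ H, TangentSpace 𝓘(ℝ, E) x, ∀ b : G,
      mfderiv 𝓘(ℝ, EG) 𝓘(ℝ, E) (fun b : G => (b : G ⧸ H)) b (leftField (horizontalCoord Q Y) b) =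
        Y b := fun Y b => lieToTangent_horizontalCoord Q hπ Y b
  have h1 := mfderiv_mlieBracket_of_related (f := fun b : G => (b : G ⧸ H)) (x := a)
    (contMDiff_proj (EG := EG) (E := E) (H := H)).contMDiffAt
    (mdifferentiableAt_leftField hY') (mdifferentiableAt_leftField hZ') hY hZ
    (Filter.Eventually.of_forall (hrel Y)) (Filter.Eventually.of_forall (hrel Z))
  rw [← h1, mlieBracket_leftField hY' hZ', reductiveConnection_apply_apply Q hπ hY',
    reductiveConnection_apply_apply Q hπ hZ']
  have h2 : ∀ X Y Z : TangentSpace 𝓘(ℝ, EG) a,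
      (mfderiv 𝓘(ℝ, EG) 𝓘(ℝ, E) (fun b : G => (b : G ⧸ H)) a (X - Y + Z) : E) =
      mfderiv 𝓘(ℝ, EG) 𝓘(ℝ, E) (fun b : G => (b : G ⧸ H)) a X -
      mfderiv 𝓘(ℝ, EG) 𝓘(ℝ, E) (fun b : G => (b : G ⧸ H)) a Y +
      mfderiv 𝓘(ℝ, EG) 𝓘(ℝ, E) (fun b : G => (b : G ⧸ H)) a Z := fun X Y Z => by
    rw [map_add, map_sub]
  refine (congrArg (fun w : E => _ - _ - w) (h2 _ _ _)).trans ?_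
  have h3 : ∀ x y z : E, x - y - (x - y + z) = -z := fun x y z => by abel
  exact h3 _ _ _

theorem torsionAt_reductiveConnection [T2Space (G ⧸ H)]
    (hπ : Function.Surjective (projDeriv EG E H (1 : G))) (a : G) :
    torsionAt (reductiveConnection Q hπ) (a : G ⧸ H) = -reductiveTensor (E := E) (H := H) Q a := by
  ext u v
  refine (torsion_reductiveConnection Q hπ a u v).trans (congrArg Neg.neg ?_)
  exact (lieToTangent_complProj (EG := EG) (E := E) (H := H) Q a _).symm

variable {Q} in
theorem inner_lieToTangent {g : RMetric E (G ⧸ H)} (hg : IsNormalMetric Q g) (a : G) {X Y : EG}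
    (hX : X ∈ reductiveComplement E H Q) (hY : Y ∈ reductiveComplement E H Q) :
    g.inner (a : G ⧸ H) (lieToTangent EG E H a X) (lieToTangent EG E H a Y) =
      continuousForm Q X Y := by
  have hx : ∀ x y : G ⧸ H, x = y → ∀ u v : E,
      (g.inner x : E → _) u v = (g.inner y : E → _) u v := by
    rintro x _ rfl u v; rfl
  have hpt : a • ((1 : G) : G ⧸ H) = (a : G ⧸ H) := congrArg _ (mul_one a)
  refine (congrArg₂ (fun u v : E => (g.inner (a : G ⧸ H) : E → E →L[ℝ] ℝ) u v)
    (lieToTangent_eq a X) (lieToTangent_eq a Y)).trans ?_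
  refine Eq.trans ?_ (hg.base X hX Y hY)
  refine Eq.trans ?_ (hg.invariant a ((1 : G) : G ⧸ H) (projDeriv EG E H 1 X)
    (projDeriv EG E H 1 Y))
  exact (hx _ _ hpt _ _).symm

variable {Q} in
theorem inner_eq_continuousForm (hπ : Function.Surjective (projDeriv EG E H (1 : G)))
    {g : RMetric E (G ⧸ H)} (hg : IsNormalMetric Q g) (a : G)
    (u v : TangentSpace 𝓘(ℝ, E) (a : G ⧸ H)) :
    g.inner (a : G ⧸ H) u v = continuousForm Q (lieLift Q a u) (lieLift Q a v) := by
  rw [← inner_lieToTangent hg a (lieLift_mem Q a u) (lieLift_mem Q a v),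
    lieToTangent_lieLift Q hπ, lieToTangent_lieLift Q hπ]

/-- The canonical reductive connection is metric, because `g(Y, Z)` lifts to `Q(Ŷ, Ẑ)` with a
constant form `Q`. -/
theorem isMetricConnection_reductiveConnection
    (hπ : Function.Surjective (projDeriv EG E H (1 : G))) {g : RMetric E (G ⧸ H)}
    (hg : IsNormalMetric Q g) : IsMetricConnection g (reductiveConnection Q hπ) := by
  intro x v Y Z hY hZ
  obtain ⟨a, rfl⟩ := QuotientGroup.mk_surjective x
  have hY' := horizontalCoord_mdifferentiableAt Q hπ hY
  have hZ' := horizontalCoord_mdifferentiableAt Q hπ hZ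
  have hcomp : (fun b : G => g.inner (b : G ⧸ H) (Y b) (Z b)) =
      fun b => continuousForm Q (horizontalCoord Q Y b) (horizontalCoord Q Z b) :=
    funext fun b => inner_eq_continuousForm hπ hg b (Y b) (Z b)
  have hf : MDifferentiableAt 𝓘(ℝ, EG) 𝓘(ℝ, ℝ)
      (fun b : G => g.inner (b : G ⧸ H) (Y b) (Z b)) a := by
    rw [hcomp]
    exact mdifferentiableAt_bilin (continuousForm Q) hY' hZ'
  have hf' := mdifferentiableAt_of_comp_proj Q hπ (f := fun y => g.inner y (Y y) (Z y)) hf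
  set w : TangentSpace 𝓘(ℝ, EG) a := leftTranslate a (lieLift (EG := EG) Q a v) with hw
  have hwv : mfderiv 𝓘(ℝ, EG) 𝓘(ℝ, E) (fun b : G => (b : G ⧸ H)) a w = v :=
    lieToTangent_lieLift Q hπ a v
  have h1 := mfderiv_comp (I := 𝓘(ℝ, EG)) (I' := 𝓘(ℝ, E)) (I'' := 𝓘(ℝ, ℝ)) a hf'
    (mdifferentiable_proj EG E H a)
  have h2 := mvfderiv_bilin (continuousForm Q) hY' hZ' w
  rw [← hcomp] at h2
  have h3 : (d% (fun y => g.inner y (Y y) (Z y)) (a : G ⧸ H)) v =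
      mvfderiv 𝓘(ℝ, EG) (fun b : G => g.inner (b : G ⧸ H) (Y b) (Z b)) a w := by
    conv_lhs => rw [← hwv]
    exact (DFunLike.congr_fun h1 w).symm
  rw [h3, h2, reductiveConnection_apply_apply Q hπ hY', reductiveConnection_apply_apply Q hπ hZ',
    inner_eq_continuousForm hπ hg, inner_eq_continuousForm hπ hg,
    lieLift_lieToTangent Q hπ (mvfderiv_horizontalCoord_mem Q hY' w),
    lieLift_lieToTangent Q hπ (mvfderiv_horizontalCoord_mem Q hZ' w)]
  rfl

variable (E H) in
/-- The bilinear map `(X, Y) ↦ -[X, Y]_𝔪`, to which the torsion of the canonical reductive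
connection corresponds. -/
def torsionBilin : EG →L[ℝ] EG →L[ℝ] EG :=
  (ContinuousLinearMap.compL ℝ EG EG EG (-complProj E H Q)).comp (continuousBracket EG G)

theorem lieLift_torsion [T2Space (G ⧸ H)]
    (hπ : Function.Surjective (projDeriv EG E H (1 : G))) (a : G)
    (u v : TangentSpace 𝓘(ℝ, E) (a : G ⧸ H)) :
    lieLift Q a ((reductiveConnection Q hπ).torsion (a : G ⧸ H) u v) =
      torsionBilin E H Q (lieLift Q a u) (lieLift Q a v) := by
  refine Eq.trans ?_ (lieLift_lieToTangent Q hπ (a := a)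
    (Submodule.neg_mem _ (complProj_mem (E := E) (H := H) Q _)))
  refine congrArg (lieLift Q a) ((torsion_reductiveConnection Q hπ a u v).trans ?_)
  refine Eq.trans ?_ (map_neg (lieToTangent EG E H a) _).symm
  exact congrArg Neg.neg (lieToTangent_complProj (EG := EG) (E := E) (H := H) Q a _).symm

theorem horizontalCoord_torsion [T2Space (G ⧸ H)]
    (hπ : Function.Surjective (projDeriv EG E H (1 : G)))
    (Y Z : Π x : G ⧸ H, TangentSpace 𝓘(ℝ, E) x) :
    horizontalCoord Q (fun y => (reductiveConnection Q hπ).torsion y (Y y) (Z y)) =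
      fun b : G => torsionBilin E H Q (horizontalCoord Q Y b) (horizontalCoord Q Z b) :=
  funext fun b => lieLift_torsion Q hπ b (Y b) (Z b)

/-- The total skewness of the torsion is the `ad`-invariance of `Q`. -/
theorem hasSkewTorsion_reductiveConnection [T2Space (G ⧸ H)]
    (hπ : Function.Surjective (projDeriv EG E H (1 : G))) {g : RMetric E (G ⧸ H)}
    (hg : IsNormalMetric Q g) : HasSkewTorsion g (reductiveConnection Q hπ) := by
  intro x X Y Z
  obtain ⟨a, rfl⟩ := QuotientGroup.mk_surjective x
  have key : ∀ X Y Z : TangentSpace 𝓘(ℝ, E) (a : G ⧸ H),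
      g.inner (a : G ⧸ H) ((reductiveConnection Q hπ).torsion (a : G ⧸ H) X Y) Z =
        -continuousForm Q (continuousBracket EG G (lieLift (EG := EG) Q a X)
          (lieLift (EG := EG) Q a Y)) (lieLift Q a Z) := by
    intro X Y Z
    rw [inner_eq_continuousForm hπ hg, lieLift_torsion Q hπ]
    change continuousForm Q (-complProj E H Q _) _ = _
    rw [continuousForm_neg_left, continuousForm_complProj Q _ (lieLift_mem Q a Z)]
    rfl
  rw [key, key]
  generalize lieLift Q a X = X'
  generalize hY : lieLift Q a Y = Y'
  generalize hZ : lieLift Q a Z = Z'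
  have h := continuousForm_continuousBracket Q X' Y' Z'
  rw [continuousBracket_antisymm EG G X' Y', continuousBracket_antisymm EG G X' Z',
    continuousForm_neg_left, continuousForm_neg_left, neg_neg, neg_neg, continuousForm_symm Q _ Y']
  exact eq_neg_of_add_eq_zero_left h

/-- The torsion of the canonical reductive connection is parallel, because it corresponds to a
constant bilinear map `𝔪 × 𝔪 → 𝔪`. -/
theorem hasParallelTorsion_reductiveConnection [T2Space (G ⧸ H)]
    (hπ : Function.Surjective (projDeriv EG E H (1 : G))) :
    HasParallelTorsion (reductiveConnection Q hπ) := by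
  intro x v Y Z hY hZ
  obtain ⟨a, rfl⟩ := QuotientGroup.mk_surjective x
  have hY' := horizontalCoord_mdifferentiableAt Q hπ hY
  have hZ' := horizontalCoord_mdifferentiableAt Q hπ hZ
  have hc := horizontalCoord_torsion Q hπ Y Z
  have hW := mdifferentiableAt_bilin (torsionBilin E H Q) hY' hZ'
  rw [← hc] at hW
  set w : TangentSpace 𝓘(ℝ, EG) a := leftTranslate a (lieLift (EG := EG) Q a v) with hw
  have hd := mvfderiv_bilin (torsionBilin E H Q) hY' hZ' w
  rw [← hc] at hd
  have hT : ∀ u v : TangentSpace 𝓘(ℝ, E) (a : G ⧸ H),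
      (reductiveConnection Q hπ).torsion (a : G ⧸ H) u v = lieToTangent EG E H a
        (torsionBilin E H Q (lieLift Q a u) (lieLift Q a v)) := by
    intro u v
    rw [← lieLift_torsion Q hπ, lieToTangent_lieLift Q hπ]
  rw [reductiveConnection_apply_apply Q hπ hW, reductiveConnection_apply_apply Q hπ hY',
    reductiveConnection_apply_apply Q hπ hZ', hT, hT,
    lieLift_lieToTangent Q hπ (mvfderiv_horizontalCoord_mem Q hY' w),
    lieLift_lieToTangent Q hπ (mvfderiv_horizontalCoord_mem Q hZ' w)]
  exact (congrArg (lieToTangent EG E H a) hd).trans (map_add (lieToTangent EG E H a) _ _)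

theorem mdifferentiableAt_torsion_reductiveConnection [T2Space (G ⧸ H)]
    (hπ : Function.Surjective (projDeriv EG E H (1 : G)))
    {Y Z : Π x : G ⧸ H, TangentSpace 𝓘(ℝ, E) x} {a : G} (hY : MDiffAt (T% Y) (a : G ⧸ H))
    (hZ : MDiffAt (T% Z) (a : G ⧸ H)) :
    MDiffAt (T% fun y => (reductiveConnection Q hπ).torsion y (Y y) (Z y)) (a : G ⧸ H) := by
  refine mdifferentiableAt_of_horizontalCoord Q hπ ?_
  rw [horizontalCoord_torsion]
  exact mdifferentiableAt_bilin (torsionBilin E H Q)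
    (horizontalCoord_mdifferentiableAt Q hπ hY) (horizontalCoord_mdifferentiableAt Q hπ hZ)

end ReductiveGeometry

/-! ### Signs and adjoints -/

section Adjoints

variable {T : Type*} [AddCommGroup T] [Module ℝ T] {n : ℕ}

theorem tensorInner_sum {W : Type*} [AddCommGroup W] [Module ℝ W] {p : ℕ} (w : Fin n → W)
    {ι : Type} (s : Finset ι) (f : ι → MultilinearMap ℝ (fun _ : Fin p => W) ℝ)
    (k : MultilinearMap ℝ (fun _ : Fin p => W) ℝ) :
    tensorInner w (∑ i ∈ s, f i) k = ∑ i ∈ s, tensorInner w (f i) k := by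
  simp only [tensorInner, _root_.sum_apply, Finset.sum_mul]
  exact Finset.sum_comm

theorem tensorInner_neg {W : Type*} [AddCommGroup W] [Module ℝ W] {p : ℕ} (w : Fin n → W)
    (h k : MultilinearMap ℝ (fun _ : Fin p => W) ℝ) :
    tensorInner w (-h) k = -tensorInner w h k := by
  simp only [tensorInner, _root_.neg_apply, neg_mul, Finset.sum_neg_distrib]

theorem IsSkew.neg {g : T →ₗ[ℝ] T →ₗ[ℝ] ℝ} {C : Module.End ℝ T} (hC : IsSkew g C) :
    IsSkew g (-C) := fun Y Z => by
  simp only [LinearMap.neg_apply, map_neg, hC Y Z]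

theorem sumSquares_neg {V : Type*} [AddCommGroup V] [Module ℝ V]
    {ρ : Module.End ℝ T → Module.End ℝ V} (hρ : ∀ C, ρ (-C) = -ρ C)
    (e : Module.Basis (Fin n) ℝ T) (B : T →ₗ[ℝ] Module.End ℝ T) :
    sumSquares ρ e (-B) = sumSquares ρ e B := by
  simp only [sumSquares, LinearMap.neg_apply, hρ, LinearMap.neg_comp, LinearMap.comp_neg, neg_neg]

theorem covAct_neg (p : ℕ) (C : Module.End ℝ T) : covAct p (-C) = -covAct p C :=
  leibnizExt_neg (-C)

theorem contraAct_neg (p : ℕ) (C : Module.End ℝ T) : contraAct p (-C) = -contraAct p C := by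
  have h : LinearMap.dualMap (-C) = -LinearMap.dualMap C := map_neg Module.Dual.transpose C
  rw [contraAct, contraAct, h, leibnizExt_neg]

end Adjoints

/-! ### The difference of the curvature tensors -/

section Results

theorem curvature_sub_of_parallel_skew_torsion {E : Type*} [NormedAddCommGroup E]
    [NormedSpace ℝ E] [FiniteDimensional ℝ E] {M : Type*} [TopologicalSpace M] [T2Space M]
    [ChartedSpace E M] [IsManifold 𝓘(ℝ, E) ∞ M] {g : RMetric E M}
    {nabla nablaBar : AffineConnection E M} (h : IsLeviCivita g nabla)
    (hbar : IsMetricWithParallelSkewTorsion g nablaBar) (x : M) (X Y : TangentSpace 𝓘(ℝ, E) x) :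
    curvature nabla x X Y - curvature nablaBar x X Y =
      skewCurvature (torsionAt nablaBar x) X Y :=
  have hhalf := fun x v (Y : Π y : M, TangentSpace 𝓘(ℝ, E) y) (hY : MDiffAt (T% Y) x) =>
    eq_add_half_torsion h.metric h.torsion_free hbar.metric hbar.skew x v hY
  curvature_sub hbar.parallel hhalf x (mdifferentiableAt_cov_tangentFrame h.smooth x)
    (mdifferentiableAt_torsion_tangentFrame h.smooth hbar.smooth hhalf x) X Y

variable {EG : Type*} [NormedAddCommGroup EG] [NormedSpace ℝ EG] [FiniteDimensional ℝ EG]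
  {G : Type*} [TopologicalSpace G] [ChartedSpace EG G] [Group G] [LieGroup 𝓘(ℝ, EG) ∞ G]
  {E : Type*} [NormedAddCommGroup E] [NormedSpace ℝ E] [FiniteDimensional ℝ E]
  {H : Subgroup G} [T2Space (G ⧸ H)] [ChartedSpace E (G ⧸ H)] [IsManifold 𝓘(ℝ, E) ∞ (G ⧸ H)]
  [ContMDiffSMul 𝓘(ℝ, EG) 𝓘(ℝ, E) ∞ G (G ⧸ H)]
  {Q : AdInvariantInnerProduct EG G}

theorem curvature_sub_reductiveConnection {g : RMetric E (G ⧸ H)}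
    {nabla : AffineConnection E (G ⧸ H)}
    (hπ : Function.Surjective (projDeriv EG E H (1 : G))) (hg : IsNormalMetric Q g)
    (h : IsLeviCivita g nabla) (a : G) (X Y : TangentSpace 𝓘(ℝ, E) (a : G ⧸ H)) :
    curvature nabla (a : G ⧸ H) X Y - curvature (reductiveConnection Q hπ) (a : G ⧸ H) X Y =
      skewCurvature (torsionAt (reductiveConnection Q hπ) (a : G ⧸ H)) X Y :=
  curvature_sub (hasParallelTorsion_reductiveConnection Q hπ)
    (fun x v _ hY => eq_add_half_torsion h.metric h.torsion_free
      (isMetricConnection_reductiveConnection Q hπ hg)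
      (hasSkewTorsion_reductiveConnection Q hπ hg) x v hY)
    (a : G ⧸ H) (mdifferentiableAt_cov_tangentFrame h.smooth _)
    (fun i j => mdifferentiableAt_torsion_reductiveConnection Q hπ
      (eventually_mdifferentiableAt_tangentFrame _ i).self_of_nhds
      (eventually_mdifferentiableAt_tangentFrame _ j).self_of_nhds) X Y

theorem isSkew_reductiveTensor {g : RMetric E (G ⧸ H)}
    (hπ : Function.Surjective (projDeriv EG E H (1 : G))) (hg : IsNormalMetric Q g) (a : G)
    (X : TangentSpace 𝓘(ℝ, E) (a : G ⧸ H)) :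
    IsSkew (metricAt g (a : G ⧸ H)) (reductiveTensor Q a X) := by
  have h := (isSkew_torsionAt (hasSkewTorsion_reductiveConnection Q hπ hg) (a : G ⧸ H) X).neg
  rwa [torsionAt_reductiveConnection, LinearMap.neg_apply, neg_neg] at h

end Results

end SkewTorsion

end

theorem mainTheorem2 :
    -- metric connections with parallel skew torsion
    (∀ (E : Type*) [NormedAddCommGroup E] [NormedSpace ℝ E] [FiniteDimensional ℝ E]
      (M : Type*) [TopologicalSpace M] [T2Space M] [ChartedSpace E M] [IsManifold 𝓘(ℝ, E) ∞ M]
      (g : RMetric E M) (nabla nablaBar : AffineConnection E M),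
      IsLeviCivita g nabla →
      IsMetricWithParallelSkewTorsion g nablaBar →
      -- `∇̄ = ∇ + ½ T̄`
      (∀ (x : M) (v : TangentSpace 𝓘(ℝ, E) x) (Y : Π y : M, TangentSpace 𝓘(ℝ, E) y),
        MDiffAt (T% Y) x →
        nablaBar Y x v = nabla Y x v + (1 / 2 : ℝ) • nablaBar.torsion x v (Y x)) ∧
      -- `q(R) - q(R̄) = -¼ ∑ᵢ (T̄_{eᵢ})_*²` on `Symᵖ T*M` and on `Symᵖ TM`
      ∀ (x : M) (n : ℕ) (e : Module.Basis (Fin n) ℝ (TangentSpace 𝓘(ℝ, E) x)),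
        IsOrthonormalBasis g e →
        ∀ p : ℕ,
          (∀ h : CovTensor p (TangentSpace 𝓘(ℝ, E) x),
            IsSymmetricTensor h →
            curvatureEndomorphism (covAct p) (metricAt g x) e
                (curvature nabla x) h
              - curvatureEndomorphism (covAct p)
                (metricAt g x) e (curvature nablaBar x) h
              = -(1 / 4 : ℝ) • sumSquares (covAct p) e
                (torsionAt nablaBar x) h) ∧
          (∀ h : ContraTensor p (TangentSpace 𝓘(ℝ, E) x),
            IsSymmetricTensor h →
            curvatureEndomorphism (contraAct p)
                (metricAt g x) e (curvature nabla x) h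
              - curvatureEndomorphism (contraAct p)
                (metricAt g x) e (curvature nablaBar x) h
              = -(1 / 4 : ℝ) • sumSquares (contraAct p) e
                (torsionAt nablaBar x) h)) ∧
    -- normal homogeneous spaces
    (∀ (EG : Type*) [NormedAddCommGroup EG] [NormedSpace ℝ EG] [FiniteDimensional ℝ EG]
      (G : Type*) [TopologicalSpace G] [ChartedSpace EG G] [Group G] [LieGroup 𝓘(ℝ, EG) ∞ G]
      (H : Subgroup G) (_ : IsClosed (H : Set G))
      (E : Type*) [NormedAddCommGroup E] [NormedSpace ℝ E] [FiniteDimensional ℝ E]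
      -- the smooth structure of `G ⧸ H`: the action of `G` is smooth, the projection a submersion
      [T2Space (G ⧸ H)] [ChartedSpace E (G ⧸ H)] [IsManifold 𝓘(ℝ, E) ∞ (G ⧸ H)]
      [ContMDiffSMul 𝓘(ℝ, EG) 𝓘(ℝ, E) ∞ G (G ⧸ H)]
      (hsub : Function.Surjective (projDeriv EG E H (1 : G)))
      (Q : AdInvariantInnerProduct EG G) (g : RMetric E (G ⧸ H))
      (nabla : AffineConnection E (G ⧸ H)),
      IsNormalMetric Q g →
      IsLeviCivita g nabla →
      ∀ (a : G) (n : ℕ) (e : Module.Basis (Fin n) ℝ (TangentSpace 𝓘(ℝ, E) (a : G ⧸ H))),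
        IsOrthonormalBasis g e →
        ∀ p : ℕ,
          (∃ Astar : (TangentSpace 𝓘(ℝ, E) (a : G ⧸ H) →ₗ[ℝ]
              CovTensor p (TangentSpace 𝓘(ℝ, E) (a : G ⧸ H))) →ₗ[ℝ]
              CovTensor p (TangentSpace 𝓘(ℝ, E) (a : G ⧸ H)),
            IsMetricAdjoint (tensorInner e) e
              (tensorMap (covAct p) e (reductiveTensor Q a))
              Astar ∧
            ∀ h : CovTensor p (TangentSpace 𝓘(ℝ, E) (a : G ⧸ H)),
              IsSymmetricTensor h →
              curvatureEndomorphism (covAct p)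
                  (metricAt g (a : G ⧸ H)) e (curvature nabla _) h
                - curvatureEndomorphism (covAct p)
                  (metricAt g (a : G ⧸ H)) e
                  (curvature (reductiveConnection Q hsub) _) h
                = (1 / 4 : ℝ) • Astar (tensorMap (covAct p) e
                  (reductiveTensor Q a) h)) ∧
          (∃ Astar : (TangentSpace 𝓘(ℝ, E) (a : G ⧸ H) →ₗ[ℝ]
              ContraTensor p (TangentSpace 𝓘(ℝ, E) (a : G ⧸ H))) →ₗ[ℝ]
              ContraTensor p (TangentSpace 𝓘(ℝ, E) (a : G ⧸ H)),
            IsMetricAdjoint (tensorInner e.coord) e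
              (tensorMap (contraAct p) e
                (reductiveTensor Q a))
              Astar ∧
            ∀ h : ContraTensor p (TangentSpace 𝓘(ℝ, E) (a : G ⧸ H)),
              IsSymmetricTensor h →
              curvatureEndomorphism (contraAct p)
                  (metricAt g (a : G ⧸ H)) e (curvature nabla _) h
                - curvatureEndomorphism (contraAct p)
                  (metricAt g (a : G ⧸ H)) e
                  (curvature (reductiveConnection Q hsub) _) h
                = (1 / 4 : ℝ) • Astar (tensorMap (contraAct p) e
                  (reductiveTensor Q a) h))) := by
  refine ⟨?_, ?_⟩
  · intro E _ _ _ M _ _ _ _ g nabla nablaBar h hbar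
    have hR := curvature_sub_of_parallel_skew_torsion h hbar
    refine ⟨fun x v Y hY =>
      eq_add_half_torsion h.metric h.torsion_free hbar.metric hbar.skew x v hY, fun x n e he p => ?_⟩
    replace he : ∀ i j, metricAt g x (e i) (e j) = if i = j then 1 else 0 := he
    refine ⟨fun k hk => ?_, fun k hk => ?_⟩
    · exact curvatureEndomorphism_cov_sub (torsionAt_antisymm x) he
        (isSkew_torsionAt hbar.skew x) (hR x) hk
    · exact curvatureEndomorphism_contra_sub (torsionAt_antisymm x) he
        (isSkew_torsionAt hbar.skew x) (hR x) hk
  · intro EG _ _ _ G _ _ _ _ H _ E _ _ _ _ _ _ _ hsub Q g nabla hg h a n e he p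
    replace he : ∀ i j, metricAt g (a : G ⧸ H) (e i) (e j) = if i = j then 1 else 0 := he
    have hR := curvature_sub_reductiveConnection hsub hg h a
    have hT := torsionAt_reductiveConnection (E := E) (H := H) Q hsub a
    have hskew := isSkew_torsionAt (hasSkewTorsion_reductiveConnection Q hsub hg) (a : G ⧸ H)
    have hA := isSkew_reductiveTensor hsub hg a
    refine ⟨?_, ?_⟩
    · obtain ⟨S, hS, hSA⟩ := exists_metricAdjoint (e := e) (ip := tensorInner e)
        (ρ := covAct p) (A := reductiveTensor Q a) (fun s f v => tensorInner_sum e s f v)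
        (tensorInner_neg e) fun i u v => covAct_tensorInner he (hA (e i)) u v
      refine ⟨S, hS, fun k hk => ?_⟩
      rw [curvatureEndomorphism_cov_sub (torsionAt_antisymm _) he hskew hR hk, hT,
        sumSquares_neg (covAct_neg p), hSA]
      module
    · obtain ⟨S, hS, hSA⟩ := exists_metricAdjoint (e := e) (ip := tensorInner e.coord)
        (ρ := contraAct p) (A := reductiveTensor Q a) (fun s f v => tensorInner_sum e.coord s f v)
        (tensorInner_neg e.coord) fun i u v => contraAct_tensorInner he (hA (e i)) u v
      refine ⟨S, hS, fun k hk => ?_⟩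
      rw [curvatureEndomorphism_contra_sub (torsionAt_antisymm _) he hskew hR hk, hT,
        sumSquares_neg (contraAct_neg p), hSA]
      module
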